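/- **Setting.** Let $X$ be a quasi-projective scheme over $\mathbb C$ with an action of a torus $\mathbb T=(\mathbb C^*)^d$. For $n\ge 0$ the group $S_n$ acts on $X^n$ by $\sigma(x_1,\dots,x_n)=(x_{\sigma^{-1}(1)},\dots,x_{\sigma^{-1}(n)})$. A *sheaf on $[X^n/S_n]$* means a $\mathbb Z/2$-graded, $\mathbb T\times S_n$-equivariant coherent sheaf on $X^n$; $F[k]$ denotes the shift $F[k]^e=F^{e+k}$ with the same equivariant structure, and tensor factors are permuted with the Koszul sign. Subsets of $[n]=\{1,\dots,n\}$ are totally ordered by $A\le B\iff\sum_{i\in A}2^i\le\sum_{i\in B}2^i$. Let $(F_n)_{n\ge1}$ be a sequence where $F_n$ is a sheaf on $[X^n/S_n]$. For a non-empty $A\subseteq[n]$ let $i_A\colon[|A|]\to[n]$ be the increasing map with image $A$, and let $F_A$ be the pullback of $F_{|A|}$ along the projection $X^n\to X^{|A|}$, $x\mapsto x\circ i_A$. For $\sigma\in S_n$, the equivariant structure of $F_{|A|}$, applied to the $\tau\in S_{|A|}$ with $\sigma\circ i_A=i_{\sigma(A)}\circ\tau$, gives an isomorphism $F_A\cong\sigma^*F_{\sigma(A)}$.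 For a set partition $\mathfrak A=\{A_1<\dots<A_l\}$ of $[n]$ into non-empty blocks let $F_{\mathfrak A}=F_{A_1}\otimes\cdots\otimes F_{A_l}$; tensoring the previous isomorphisms and permuting the factors (with Koszul sign) into increasing order gives isomorphisms $\rho_{\mathfrak A,\sigma}\colon F_{\mathfrak A}\cong\sigma^*F_{\sigma(\mathfrak A)}$. **Plethystic exponential and logarithm.** Define $$\mathrm{Exp}\Big(\sum_{n\ge1}F_nq^n\Big)=1+\sum_{n\ge1}\Big(\bigoplus_{\mathfrak A}F_{\mathfrak A}\Big)q^n,$$ the sum being over all set partitions $\mathfrak A$ of $[n]$, with the $S_n$-equivariant structure given by the $\rho_{\mathfrak A,\sigma}$. Define $\mathrm{Log}\big(1+\sum_{n\ge1}F_nq^n\big)=\sum_{n\ge1}G_nq^n$ recursively by $$G_n=F_n\oplus\Big(\langle q^n\rangle\,\mathrm{Exp}\Big(\sum_{k=1}^{n-1}G_kq^k\Big)\Big)[1],$$ where $\langle q^n\rangle$ denotes the coefficient of $q^n$. **Index trees.** An *index tree of order $n$* is a rooted tree in which every node is a leaf or has at least two children, with the leaves $v$ labelled by the blocks $L_v$ of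 a set partition $\mathfrak A(T)$ of $[n]$ (up to isomorphism of labelled rooted trees). For a non-leaf node $v$, let $L_v$ be the union of the labels of the leaves below $v$, and let $P(T)=\{L_v\mid v\text{ a non-leaf node}\}$. (The tree is determined by the set of all its labels.) The group $S_n$ acts on index trees by $L_v\mapsto\sigma(L_v)$. Let $F_T=F_{\mathfrak A(T)}$, and let $\rho_{T,\sigma}\colon F_T\cong\sigma^*F_{\sigma(T)}$ be $(-1)^{l(T,\sigma)}\rho_{\mathfrak A(T),\sigma}$, where $l(T,\sigma)$ is the number of pairs $A<B$ in $P(T)$ with $\sigma(A)>\sigma(B)$. For $k\ge0$ let $$G_{n,k}=\bigoplus_TF_T,$$ the sum being over all index trees $T$ of order $n$ with exactly $k$ non-leaf nodes, with the $S_n$-equivariant structure given by the $\rho_{T,\sigma}$. **Lemma.** For every $n\ge1$ there is an isomorphism of sheaves on $[X^n/S_n]$ (that is, of $\mathbb Z/2$-graded $\mathbb T\times S_n$-equivariant coherent sheaves on $X^n$) $$G_n\cong\bigoplus_{k=0}^{n-1}G_{n,k}[k].$$ -/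

import Mathlib

open scoped TensorProduct

noncomputable section
namespace ShLog

/-! ### Semilinear base change -/

section Algebra

variable {R S T : Type} [CommRing R] [CommRing S] [CommRing T]

/-- A `φ`-semilinear map `g : M → N` exhibits the `S`-module `N` as the base change `S ⊗[R] M`. -/
def IsBC {M N : Type} [AddCommGroup M] [AddCommGroup N] [Module R M] [Module S N]
    (φ : R →+* S) (g : M →ₛₗ[φ] N) : Prop :=
  letI : Algebra R S := φ.toAlgebra
  letI : Module R N := Module.compHom N φ
  haveI : IsScalarTower R S N := ⟨fun r s n => mul_smul (φ r) s n⟩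
  IsBaseChange S ({ toFun := g, map_add' := g.map_add, map_smul' := g.map_smulₛₗ } : M →ₗ[R] N)

section Linear

variable [Algebra R S]

theorem multilinear_unique {Q : Type} [AddCommGroup Q] [Module S Q] :
    ∀ {n : ℕ} {M N : Fin n → Type} [∀ i, AddCommGroup (M i)] [∀ i, AddCommGroup (N i)]
      [∀ i, Module R (M i)] [∀ i, Module R (N i)] [∀ i, Module S (N i)]
      [∀ i, IsScalarTower R S (N i)] (g : ∀ i, M i →ₗ[R] N i)
      (_ : ∀ i, IsBaseChange S (g i)) (f₁ f₂ : MultilinearMap S N Q),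
      (∀ m : ∀ i, M i, f₁ (fun i => g i (m i)) = f₂ (fun i => g i (m i))) → f₁ = f₂ := by
  intro n
  induction n with
  | zero =>
    intro M N _ _ _ _ _ _ g _ f₁ f₂ h
    ext v
    have := h (fun i => i.elim0)
    rwa [Subsingleton.elim (fun i => g i _) v] at this
  | succ n ih =>
    intro M N _ _ _ _ _ _ g hg f₁ f₂ h
    have key : f₁.curryLeft = f₂.curryLeft := by
      apply (hg 0).algHom_ext
      intro x
      apply ih (fun i => g i.succ) (fun i => hg i.succ)
      intro m
      have := h (Fin.cons x m)
      simp only [MultilinearMap.curryLeft_apply]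
      convert this using 2 <;>
      · funext i
        refine Fin.cases ?_ (fun j => ?_) i <;> simp
    rw [← f₁.uncurry_curryLeft, key, f₂.uncurry_curryLeft]

theorem multilinear_extend {Q : Type} [AddCommGroup Q] [Module R Q] [Module S Q]
    [IsScalarTower R S Q] :
    ∀ {n : ℕ} {M N : Fin n → Type} [∀ i, AddCommGroup (M i)] [∀ i, AddCommGroup (N i)]
      [∀ i, Module R (M i)] [∀ i, Module R (N i)] [∀ i, Module S (N i)]
      [∀ i, IsScalarTower R S (N i)] (g : ∀ i, M i →ₗ[R] N i)
      (_ : ∀ i, IsBaseChange S (g i)) (f : MultilinearMap R M Q),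
      ∃ f' : MultilinearMap S N Q, ∀ m : ∀ i, M i, f' (fun i => g i (m i)) = f m := by
  intro n
  induction n with
  | zero =>
    intro M N _ _ _ _ _ _ g _ f
    refine ⟨MultilinearMap.constOfIsEmpty S N (f fun i => i.elim0), fun m => ?_⟩
    rw [MultilinearMap.constOfIsEmpty_apply]
    exact congrArg f (Subsingleton.elim _ _)
  | succ n ih =>
    intro M N _ _ _ _ _ _ g hg f
    choose E hE using fun x : M 0 => ih (fun i => g i.succ) (fun i => hg i.succ) (f.curryLeft x)
    let L : M 0 →ₗ[R] MultilinearMap S (fun i : Fin n => N i.succ) Q :=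
      { toFun := E
        map_add' := fun x y => by
          apply multilinear_unique (fun i => g i.succ) (fun i => hg i.succ)
          intro m
          rw [add_apply, hE, hE, hE, map_add, add_apply]
        map_smul' := fun r x => by
          apply multilinear_unique (fun i => g i.succ) (fun i => hg i.succ)
          intro m
          simp only [RingHom.id_apply, smul_apply]
          rw [hE, hE, map_smul, smul_apply] }
    have _ : IsScalarTower R S (MultilinearMap S (fun i : Fin n => N i.succ) Q) :=
      ⟨fun r s k => by ext v; simp only [smul_apply, smul_assoc]⟩
    refine ⟨((hg 0).lift L).uncurryLeft, fun m => ?_⟩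
    rw [LinearMap.uncurryLeft_apply]
    have h0 : (hg 0).lift L (g 0 (m 0)) = E (m 0) := (hg 0).lift_eq L (m 0)
    rw [h0]
    refine (hE (m 0) (fun i => m i.succ)).trans ?_
    rw [MultilinearMap.curryLeft_apply]
    congr 1
    funext i
    refine Fin.cases ?_ (fun j => ?_) i <;> simp

theorem isBaseChange_piTensor {J : Type} [Finite J] {M N : J → Type} {P : Type}
    [∀ i, AddCommGroup (M i)] [∀ i, AddCommGroup (N i)] [AddCommGroup P] [Module R P] [Module S P]
    [IsScalarTower R S P] [∀ i, Module R (M i)] [∀ i, Module R (N i)] [∀ i, Module S (N i)]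
    [∀ i, IsScalarTower R S (N i)] (g : ∀ i, M i →ₗ[R] N i) (hg : ∀ i, IsBaseChange S (g i))
    (E : (⨂[S] i, N i) ≃ₗ[S] P) (G : (⨂[R] i, M i) →ₗ[R] P)
    (hG : ∀ m, G (PiTensorProduct.tprod R m) =
      E (PiTensorProduct.tprod S (fun i => g i (m i)))) :
    IsBaseChange S G := by
  obtain ⟨n, ⟨e⟩⟩ := Finite.exists_equiv_fin J
  apply IsBaseChange.of_lift_unique
  intro Q _ _ _ _ k
  let _ : AddCommGroup Q := Module.addCommMonoidToAddCommGroup R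
  obtain ⟨f', hf'⟩ := multilinear_extend (S := S) (fun i => g (e.symm i)) (fun i => hg (e.symm i))
    (MultilinearMap.domDomCongrLinearEquiv' R R M Q e
      (k.compMultilinearMap (PiTensorProduct.tprod R)))
  let f'' : MultilinearMap S N Q := (MultilinearMap.domDomCongrLinearEquiv' S S N Q e).symm f'
  have hf'' : ∀ m : ∀ i, M i, f'' (fun i => g i (m i)) = k (PiTensorProduct.tprod R m) := by
    intro m
    refine (hf' (fun i => m (e.symm i))).trans ?_
    exact congrArg (fun v => k (PiTensorProduct.tprod R v)) ((e.piCongrLeft' M).symm_apply_apply m)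
  refine ⟨(PiTensorProduct.lift f'').comp E.symm.toLinearMap, ?_, ?_⟩
  · ext m
    simp [hG, hf'']
  · intro k' hk'
    have huniq : (k'.comp E.toLinearMap).compMultilinearMap (PiTensorProduct.tprod S) = f'' := by
      apply (MultilinearMap.domDomCongrLinearEquiv' S S N Q e).injective
      apply multilinear_unique (fun i => g (e.symm i)) (fun i => hg (e.symm i))
      intro m
      obtain ⟨m, rfl⟩ := (e.piCongrLeft' M).surjective m
      have h1 : ∀ h : MultilinearMap S N Q,
          MultilinearMap.domDomCongrLinearEquiv' S S N Q e h
            (fun i => g (e.symm i) ((e.piCongrLeft' M) m i)) = h (fun i => g i (m i)) := by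
        intro h
        exact congrArg h ((e.piCongrLeft' N).symm_apply_apply (fun i => g i (m i)))
      rw [h1, h1, hf'']
      have := LinearMap.congr_fun hk' (PiTensorProduct.tprod R m)
      simpa [hG] using this
    have : k'.comp E.toLinearMap = PiTensorProduct.lift f'' := by
      ext1
      rw [huniq]
      ext m
      simp
    ext p
    obtain ⟨z, rfl⟩ := E.surjective p
    simpa using LinearMap.congr_fun this z

theorem isBaseChange_pi {J : Type} [Finite J] {M N : J → Type}
    [∀ i, AddCommGroup (M i)] [∀ i, AddCommGroup (N i)]
    [∀ i, Module R (M i)] [∀ i, Module R (N i)] [∀ i, Module S (N i)]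
    [∀ i, IsScalarTower R S (N i)] (g : ∀ i, M i →ₗ[R] N i) (hg : ∀ i, IsBaseChange S (g i)) :
    IsBaseChange S (LinearMap.pi fun i => (g i).comp (LinearMap.proj i)) := by
  classical
  let _ := Fintype.ofFinite J
  refine IsBaseChange.of_equiv ((TensorProduct.piRight R S S M).trans
    (LinearEquiv.piCongrRight fun i => (hg i).equiv)) fun x => ?_
  ext i
  simp

end Linear

section Semilinear

variable {φ : R →+* S}

theorem IsBC.piTensor {J : Type} [Finite J] {M N : J → Type}
    [∀ i, AddCommGroup (M i)] [∀ i, AddCommGroup (N i)]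
    [∀ i, Module R (M i)] [∀ i, Module S (N i)]
    (g : ∀ i, M i →ₛₗ[φ] N i) (hg : ∀ i, IsBC φ (g i))
    (G : (⨂[R] i, M i) →ₛₗ[φ] ⨂[S] i, N i)
    (hG : ∀ m, G (PiTensorProduct.tprod R m) = PiTensorProduct.tprod S (fun i => g i (m i))) :
    IsBC φ G := by
  let _ : Algebra R S := φ.toAlgebra
  let _ : ∀ i, Module R (N i) := fun i => Module.compHom (N i) φ
  have _ : ∀ i, IsScalarTower R S (N i) := fun i => ⟨fun r s n => mul_smul (φ r) s n⟩
  let _ : Module R (⨂[S] i, N i) := Module.compHom _ φ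
  have _ : IsScalarTower R S (⨂[S] i, N i) := ⟨fun r s n => mul_smul (φ r) s n⟩
  exact isBaseChange_piTensor _ hg (LinearEquiv.refl S _) _ hG

theorem IsBC.pi {J : Type} [Finite J] {M N : J → Type}
    [∀ i, AddCommGroup (M i)] [∀ i, AddCommGroup (N i)]
    [∀ i, Module R (M i)] [∀ i, Module S (N i)]
    (g : ∀ i, M i →ₛₗ[φ] N i) (hg : ∀ i, IsBC φ (g i))
    (G : (∀ i, M i) →ₛₗ[φ] ∀ i, N i) (hG : ∀ m i, G m i = g i (m i)) :
    IsBC φ G := by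
  let _ : Algebra R S := φ.toAlgebra
  let _ : ∀ i, Module R (N i) := fun i => Module.compHom (N i) φ
  have _ : ∀ i, IsScalarTower R S (N i) := fun i => ⟨fun r s n => mul_smul (φ r) s n⟩
  have := isBaseChange_pi _ hg
  have e : ({ toFun := G, map_add' := G.map_add, map_smul' := G.map_smulₛₗ } :
      (∀ i, M i) →ₗ[R] ∀ i, N i) = LinearMap.pi fun i =>
        ({ toFun := g i, map_add' := (g i).map_add, map_smul' := (g i).map_smulₛₗ } :
          M i →ₗ[R] N i).comp (LinearMap.proj i) := by
    ext1 m
    funext i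
    exact hG m i
  exact (congrArg (IsBaseChange S) e).mpr this

/-- Base change is insensitive to linear isomorphisms of the source and of the target. -/
theorem IsBC.of_equiv {M N M' N' : Type} [AddCommGroup M] [AddCommGroup N] [AddCommGroup M']
    [AddCommGroup N'] [Module R M] [Module S N] [Module R M'] [Module S N']
    {g : M →ₛₗ[φ] N} (hg : IsBC φ g) (g' : M' →ₛₗ[φ] N') (eM : M ≃ₗ[R] M') (eN : N ≃ₗ[S] N')
    (h : ∀ m, g' (eM m) = eN (g m)) : IsBC φ g' := by
  let _ : Algebra R S := φ.toAlgebra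
  let _ : Module R N := Module.compHom N φ
  have _ : IsScalarTower R S N := ⟨fun r s n => mul_smul (φ r) s n⟩
  let _ : Module R N' := Module.compHom N' φ
  have _ : IsScalarTower R S N' := ⟨fun r s n => mul_smul (φ r) s n⟩
  exact (IsBaseChange.iff_of_equiv_comm eM eN (by ext m; exact h m)).mp hg

/-- The tensor product of a family of `φ`-semilinear maps. -/
def semilinearTensor {J : Type} {M N : J → Type}
    [∀ i, AddCommGroup (M i)] [∀ i, AddCommGroup (N i)]
    [∀ i, Module R (M i)] [∀ i, Module S (N i)] (g : ∀ j, M j →ₛₗ[φ] N j) :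
    (⨂[R] j, M j) →ₛₗ[φ] ⨂[S] j, N j :=
  letI : Module R (⨂[S] j, N j) := Module.compHom _ φ
  let F : MultilinearMap R M (⨂[S] j, N j) :=
    { toFun := fun m => PiTensorProduct.tprod S fun j => g j (m j)
      map_update_add' := fun m i a b => by
        simp only [Function.apply_update (fun j => g j), map_add,
          MultilinearMap.map_update_add]
      map_update_smul' := fun m i c a => by
        simp only [Function.apply_update (fun j => g j), LinearMap.map_smulₛₗ,
          MultilinearMap.map_update_smul]
        rfl }
  { toFun := PiTensorProduct.lift F
    map_add' := map_add _
    map_smul' := map_smul _ }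

theorem semilinearTensor_tprod {J : Type} {M N : J → Type}
    [∀ i, AddCommGroup (M i)] [∀ i, AddCommGroup (N i)]
    [∀ i, Module R (M i)] [∀ i, Module S (N i)] (g : ∀ j, M j →ₛₗ[φ] N j) (m : ∀ j, M j) :
    semilinearTensor g (PiTensorProduct.tprod R m) =
      PiTensorProduct.tprod S fun j => g j (m j) := by
  let _ : Module R (⨂[S] j, N j) := Module.compHom _ φ
  exact PiTensorProduct.lift.tprod (R := R) m

/-- The tensor product of a family of `φ`-semilinear maps, along a bijection of the index sets. -/
def tensorMap {J J' : Type} (e : J ≃ J') {M : J → Type} {N : J' → Type}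
    [∀ i, AddCommGroup (M i)] [∀ i, AddCommGroup (N i)]
    [∀ i, Module R (M i)] [∀ i, Module S (N i)] (g : ∀ j, M (e.symm j) →ₛₗ[φ] N j) :
    (⨂[R] j, M j) →ₛₗ[φ] ⨂[S] j, N j :=
  (semilinearTensor g).comp (PiTensorProduct.reindex R M e).toLinearMap

theorem tensorMap_tprod {J J' : Type} (e : J ≃ J') {M : J → Type} {N : J' → Type}
    [∀ i, AddCommGroup (M i)] [∀ i, AddCommGroup (N i)]
    [∀ i, Module R (M i)] [∀ i, Module S (N i)] (g : ∀ j, M (e.symm j) →ₛₗ[φ] N j)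
    (m : ∀ j, M j) :
    tensorMap e g (PiTensorProduct.tprod R m) =
      PiTensorProduct.tprod S fun j => g j (m (e.symm j)) := by
  rw [tensorMap, LinearMap.comp_apply, LinearEquiv.coe_coe, PiTensorProduct.reindex_tprod,
    semilinearTensor_tprod]

theorem tensorMap_isBC {J J' : Type} [Finite J'] (e : J ≃ J') {M : J → Type} {N : J' → Type}
    [∀ i, AddCommGroup (M i)] [∀ i, AddCommGroup (N i)]
    [∀ i, Module R (M i)] [∀ i, Module S (N i)] (g : ∀ j, M (e.symm j) →ₛₗ[φ] N j)
    (hg : ∀ j, IsBC φ (g j)) : IsBC φ (tensorMap e g) := by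
  have h0 : IsBC φ (semilinearTensor g) := IsBC.piTensor g hg _ (semilinearTensor_tprod g)
  refine h0.of_equiv _ (PiTensorProduct.reindex R M e).symm (LinearEquiv.refl S _) fun z => ?_
  rw [tensorMap, LinearMap.comp_apply, LinearEquiv.coe_coe, LinearEquiv.apply_symm_apply,
    LinearEquiv.refl_apply]

/-- Multiplying a base change map by a sign. -/
theorem IsBC.zsmul {M N : Type} [AddCommGroup M] [AddCommGroup N] [Module R M] [Module S N]
    {g : M →ₛₗ[φ] N} (hg : IsBC φ g) {ε : ℤ} (hε : ε * ε = 1) : IsBC φ (ε • g) := by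
  rcases Int.isUnit_iff.mp (IsUnit.of_mul_eq_one ε hε) with rfl | rfl
  · rwa [one_smul]
  · exact hg.of_equiv _ (LinearEquiv.refl R M) (LinearEquiv.neg S) fun m => by simp

end Semilinear
end Algebra

/-! ### The binary order on subsets and signs of permutations -/

section Signs

open scoped Pointwise

variable {n : ℕ}

/-- The order on subsets of `[n]` is the one given by comparing these numbers. -/
def binWeight (A : Finset (Fin n)) : ℕ := ∑ i ∈ A, 2 ^ (i : ℕ)

theorem binWeight_injective : Function.Injective (binWeight (n := n)) := by
  intro A B h
  have h2 : ∀ C : Finset (Fin n), binWeight C = ∑ i ∈ C.map Fin.valEmbedding, 2 ^ i := by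
    intro C
    simp [binWeight]
  rw [h2, h2] at h
  exact Finset.map_injective _ (Finset.geomSum_injective le_rfl h)

/-- The number of inversions of `σ : S → σ(S)` for a set `S` of subsets of `[n]`. -/
def inversions (σ : Equiv.Perm (Fin n)) (S : Finset (Finset (Fin n))) : ℕ :=
  ((S ×ˢ S).filter fun p =>
    binWeight p.1 < binWeight p.2 ∧ binWeight (σ • p.2) < binWeight (σ • p.1)).card

/-- The sign of the bijection `σ : S → σ(S)` of totally ordered sets. -/
def sgn (σ : Equiv.Perm (Fin n)) (S : Finset (Finset (Fin n))) : ℤ := (-1) ^ inversions σ S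

theorem sgn_mul_self (σ : Equiv.Perm (Fin n)) (S : Finset (Finset (Fin n))) :
    sgn σ S * sgn σ S = 1 := by
  rw [sgn, ← mul_pow]; simp

theorem sgn_one (S : Finset (Finset (Fin n))) : sgn 1 S = 1 := by
  have : inversions 1 S = 0 := by
    rw [inversions, Finset.card_eq_zero, Finset.filter_eq_empty_iff]
    intro p _ h
    simp only [one_smul] at h
    omega
  rw [sgn, this, pow_zero]

theorem prod_pairs_eq {α : Type} (S : Finset α) (a b : α → ℕ)
    (ha : Function.Injective a) (hb : Function.Injective b) (d : α → α → ℤ)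
    (hd : ∀ x y, d x y = d y x) :
    ∏ p ∈ (S ×ˢ S).filter (fun p => a p.1 < a p.2), d p.1 p.2 =
      ∏ p ∈ (S ×ˢ S).filter (fun p => b p.1 < b p.2), d p.1 p.2 := by
  refine Finset.prod_bij' (fun p _ => if b p.1 < b p.2 then p else p.swap)
    (fun p _ => if a p.1 < a p.2 then p else p.swap) ?_ ?_ ?_ ?_ ?_
  · rintro ⟨x, y⟩ h
    simp only [Finset.mem_filter, Finset.mem_product] at h ⊢
    have hne : b x ≠ b y := fun e => by have := hb e; subst this; omega
    split_ifs with h' <;> (simp_all; try omega)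
  · rintro ⟨x, y⟩ h
    simp only [Finset.mem_filter, Finset.mem_product] at h ⊢
    have hne : a x ≠ a y := fun e => by have := ha e; subst this; omega
    split_ifs with h' <;> (simp_all; try omega)
  · rintro ⟨x, y⟩ h
    simp only [Finset.mem_filter, Finset.mem_product] at h
    by_cases h' : b x < b y
    · simp [h', h.2]
    · simp [h', h.2.le]
  · rintro ⟨x, y⟩ h
    simp only [Finset.mem_filter, Finset.mem_product] at h
    by_cases h' : a x < a y
    · simp [h', h.2]
    · simp [h', h.2.le]
  · rintro ⟨x, y⟩ h
    dsimp only
    split_ifs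
    · rfl
    · exact hd x y

theorem sgn_eq_prod (σ : Equiv.Perm (Fin n)) (S : Finset (Finset (Fin n))) :
    sgn σ S = ∏ p ∈ (S ×ˢ S).filter (fun p => binWeight p.1 < binWeight p.2),
      if binWeight (σ • p.2) < binWeight (σ • p.1) then (-1 : ℤ) else 1 := by
  rw [Finset.prod_ite, Finset.prod_const, Finset.prod_const_one, mul_one, Finset.filter_filter]
  rfl

theorem sgn_mul (τ σ : Equiv.Perm (Fin n)) (S : Finset (Finset (Fin n))) :
    sgn (τ * σ) S = sgn τ (σ • S) * sgn σ S := by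
  let d : Finset (Fin n) → Finset (Fin n) → ℤ := fun A B =>
    if (binWeight (σ • A) < binWeight (σ • B) ∧
        binWeight (τ • σ • B) < binWeight (τ • σ • A)) ∨
      (binWeight (σ • B) < binWeight (σ • A) ∧
        binWeight (τ • σ • A) < binWeight (τ • σ • B)) then -1 else 1
  have h1 : sgn τ (σ • S) =
      ∏ p ∈ (S ×ˢ S).filter (fun p => binWeight (σ • p.1) < binWeight (σ • p.2)), d p.1 p.2 := by
    rw [sgn_eq_prod]
    refine (Finset.prod_bij (fun p _ => (σ • p.1, σ • p.2)) ?_ ?_ ?_ ?_).symm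
    · rintro ⟨A, B⟩ h
      simp only [Finset.mem_filter, Finset.mem_product] at h ⊢
      exact ⟨⟨Finset.smul_mem_smul_finset h.1.1, Finset.smul_mem_smul_finset h.1.2⟩, h.2⟩
    · rintro ⟨A, B⟩ _ ⟨A', B'⟩ _ h
      simpa using h
    · rintro ⟨A, B⟩ h
      simp only [Finset.mem_filter, Finset.mem_product, Finset.mem_smul_finset] at h
      obtain ⟨⟨⟨A, hA, rfl⟩, ⟨B, hB, rfl⟩⟩, h⟩ := h
      exact ⟨(A, B), by simp [hA, hB, h], rfl⟩
    · rintro ⟨A, B⟩ h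
      simp only [Finset.mem_filter, Finset.mem_product] at h
      have := h.2
      simp only [d]
      congr 1
      simp [this, this.le]
  have h2 := prod_pairs_eq S (fun A => binWeight (σ • A)) binWeight
    (fun A B h => MulAction.injective σ (binWeight_injective h)) binWeight_injective d
    (fun A B => by simp only [d]; congr 1; exact propext or_comm)
  rw [h1, h2, sgn_eq_prod, sgn_eq_prod, ← Finset.prod_mul_distrib]
  refine Finset.prod_congr rfl ?_
  rintro ⟨A, B⟩ h
  simp only [Finset.mem_filter, Finset.mem_product] at h
  have hne : A ≠ B := by rintro rfl; exact lt_irrefl _ h.2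
  have n1 : binWeight (σ • A) ≠ binWeight (σ • B) := fun e =>
    hne (MulAction.injective σ (binWeight_injective e))
  have n2 : binWeight (τ • σ • A) ≠ binWeight (τ • σ • B) := fun e =>
    hne (MulAction.injective σ (MulAction.injective τ (binWeight_injective e)))
  simp only [d, mul_smul]
  clear_value d
  generalize binWeight (τ • σ • A) = a at *
  generalize binWeight (τ • σ • B) = b at *
  generalize binWeight (σ • A) = a' at *
  generalize binWeight (σ • B) = b' at *
  split_ifs <;> omega

end Signs

/-! ### Complex schemes with a torus action and the points of `X^n` -/

section Geometry

open AlgebraicGeometry CategoryTheory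

/-- The projective space `ℙ^N = Proj ℂ[x₀, …, x_N]` over `ℂ`. -/
def projectiveSpace (N : ℕ) : Over (Spec (CommRingCat.of ℂ)) :=
  letI 𝒜 := MvPolynomial.homogeneousSubmodule (Fin (N + 1)) ℂ
  letI : GradedAlgebra 𝒜 := MvPolynomial.gradedAlgebra
  Over.mk (Proj.toSpecZero 𝒜 ≫ Spec.map (CommRingCat.ofHom (algebraMap ℂ (𝒜 0))))

/-- A complex scheme is quasi-projective if it is isomorphic over `ℂ` to a locally closed
subscheme of some projective space. -/
def IsQuasiProjective (X : Over (Spec (CommRingCat.of ℂ))) : Prop :=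
  ∃ (N : ℕ) (i : X ⟶ projectiveSpace N), IsImmersion i.left

/-- `X(R)`: the `R`-valued points of the complex scheme `X`, for a `ℂ`-algebra `R`. -/
def Points (X : Over (Spec (CommRingCat.of ℂ))) (R : Type) [CommRing R] [Algebra ℂ R] : Type :=
  { x : Spec (CommRingCat.of R) ⟶ X.left //
    x ≫ X.hom = Spec.map (CommRingCat.ofHom (algebraMap ℂ R)) }

variable {X : Over (Spec (CommRingCat.of ℂ))}

section

variable {R S T : Type} [CommRing R] [CommRing S] [CommRing T]
  [Algebra ℂ R] [Algebra ℂ S] [Algebra ℂ T]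

/-- The map `X(R) → X(S)` induced by a homomorphism `R → S`. -/
def Points.map (φ : R →ₐ[ℂ] S) (x : Points X R) : Points X S :=
  ⟨Spec.map (CommRingCat.ofHom (φ : R →+* S)) ≫ x.1, by
    rw [Category.assoc, x.2, ← Spec.map_comp, ← CommRingCat.ofHom_comp, φ.comp_algebraMap]⟩

theorem Points.map_id (x : Points X R) : x.map (AlgHom.id ℂ R) = x := by
  apply Subtype.ext
  change Spec.map (𝟙 (CommRingCat.of R)) ≫ x.1 = x.1
  rw [Spec.map_id, Category.id_comp]

theorem Points.map_comp (ψ : S →ₐ[ℂ] T) (φ : R →ₐ[ℂ] S) (x : Points X R) :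
    x.map (ψ.comp φ) = (x.map φ).map ψ := by
  apply Subtype.ext
  change Spec.map (CommRingCat.ofHom (φ : R →+* S) ≫ CommRingCat.ofHom (ψ : S →+* T)) ≫ x.1 = _
  rw [Spec.map_comp, Category.assoc]
  rfl

/-- The homomorphism `𝕋(R) → 𝕋(S)` for the torus `𝕋 = (ℂ^*)^d`, with `𝕋(R) = (Rˣ)^d`. -/
def torusMap {d : ℕ} (φ : R →ₐ[ℂ] S) : (Fin d → Rˣ) →* (Fin d → Sˣ) where
  toFun t i := Units.map (φ : R →* S) (t i)
  map_one' := by funext i; exact map_one _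
  map_mul' s t := by funext i; exact map_mul _ _ _

end

/-- An action of the torus `𝕋 = (ℂ^*)^d` on the complex scheme `X`, given on points: an action of
the group `𝕋(R) = (Rˣ)^d` on the set `X(R)`, functorial in the `ℂ`-algebra `R`. -/
structure TorusAction (d : ℕ) (X : Over (Spec (CommRingCat.of ℂ))) where
  smul {R : Type} [CommRing R] [Algebra ℂ R] (t : Fin d → Rˣ) (x : Points X R) : Points X R
  one_smul {R : Type} [CommRing R] [Algebra ℂ R] (x : Points X R) : smul 1 x = x
  mul_smul {R : Type} [CommRing R] [Algebra ℂ R] (s t : Fin d → Rˣ) (x : Points X R) :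
    smul (s * t) x = smul s (smul t x)
  map_smul {R S : Type} [CommRing R] [Algebra ℂ R] [CommRing S] [Algebra ℂ S] (φ : R →ₐ[ℂ] S)
    (t : Fin d → Rˣ) (x : Points X R) :
    (smul t x).map φ = smul (torusMap φ t) (x.map φ)

/-- `X^n(R) = X(R)^n`: the points of `X^n` with values in the `ℂ`-algebra `R`, that is the
morphisms `Spec R → X^n`, given by their coordinates. -/
abbrev Pt (X : Over (Spec (CommRingCat.of ℂ))) (n : ℕ) (R : Type) [CommRing R] [Algebra ℂ R] :
    Type :=
  Fin n → Points X R

variable {R S T : Type} [CommRing R] [CommRing S] [CommRing T]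
  [Algebra ℂ R] [Algebra ℂ S] [Algebra ℂ T] {φ : R →ₐ[ℂ] S} {ψ : S →ₐ[ℂ] T}
  {d : ℕ} (a : TorusAction d X)

/-- Morphisms of points over `φ : R → S`: for `x ∈ X^n(R)` and `y ∈ X^m(S)`, an element `t ∈ 𝕋(S)`
and a bijection `σ` of the sets of coordinates with `y = σ (t • φ(x))`, that is
`y_{σ(i)} = t • φ(x_i)`. For `m = n` the bijection is an element of `S_n`, and these are the
morphisms between points of `[X^n / 𝕋 × S_n]` that cover `Spec S → Spec R`. -/
structure PtHom (φ : R →ₐ[ℂ] S) {n m : ℕ} (x : Pt X n R) (y : Pt X m S) where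
  t : Fin d → Sˣ
  perm : Fin n ≃ Fin m
  coord_perm : ∀ i, y (perm i) = a.smul t ((x i).map φ)

variable {a}

/-- The permutation underlying a morphism of points of `X^n`. -/
abbrev PtHom.sigma {n : ℕ} {x : Pt X n R} {y : Pt X n S} (f : PtHom a φ x y) :
    Equiv.Perm (Fin n) := f.perm

variable (a) in
/-- The identity morphism of a point. -/
def PtHom.id {n : ℕ} (x : Pt X n R) : PtHom a (AlgHom.id ℂ R) x x where
  t := 1
  perm := Equiv.refl _
  coord_perm i := by rw [Points.map_id, a.one_smul]; rfl

/-- Composition of morphisms of points (in diagrammatic order). -/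
def PtHom.comp {n m l : ℕ} {x : Pt X n R} {y : Pt X m S} {z : Pt X l T}
    (f : PtHom a φ x y) (g : PtHom a ψ y z) : PtHom a (ψ.comp φ) x z where
  t := g.t * torusMap ψ f.t
  perm := f.perm.trans g.perm
  coord_perm i := by
    rw [Equiv.trans_apply, g.coord_perm, f.coord_perm, Points.map_comp, a.map_smul, a.mul_smul]

theorem PtHom.ext' {n m : ℕ} {x : Pt X n R} {y : Pt X m S} {f g : PtHom a φ x y}
    (h₁ : f.t = g.t) (h₂ : f.perm = g.perm) : f = g := by
  cases f; cases g; cases h₁; cases h₂; rfl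

/-! ### Equivariant coherent sheaves -/

variable (a) in
/-- A `𝕋 × S_n`-equivariant coherent sheaf on `X^n`, described by its values on affine points.

A quasi-coherent sheaf `F` on a scheme `Y` is the same as an `R`-module `F(x) = x^*F` for each
`x : Spec R → Y`, with semilinear maps `F(x) → F(φ(x))` for `φ : R → S` which are functorial and
identify `F(φ(x))` with `S ⊗[R] F(x)`; here `Y` is noetherian, and `F` is coherent if and only if
the modules `F(x)` are finitely generated. An equivariant structure for a group `G` is a functorial
system of isomorphisms `F(x) → F(g • x)` for `g ∈ G(R)`, `x ∈ Y(R)`, compatible with composition.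
Together, this is a quasi-coherent sheaf on the quotient stack `[Y / G]`.
The pullback of sheaves along a morphism `f` is given by `(f^*F)(x) = F(f(x))`, and direct sums and
tensor products of sheaves by direct sums and tensor products over `R` of the values. -/
structure EqCoh (n : ℕ) where
  obj {R : Type} [CommRing R] [Algebra ℂ R] (x : Pt X n R) : Type
  [addCommGroup {R : Type} [CommRing R] [Algebra ℂ R] (x : Pt X n R) : AddCommGroup (obj x)]
  [module {R : Type} [CommRing R] [Algebra ℂ R] (x : Pt X n R) : Module R (obj x)]
  map {R S : Type} [CommRing R] [Algebra ℂ R] [CommRing S] [Algebra ℂ S] {φ : R →ₐ[ℂ] S}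
    {x : Pt X n R} {y : Pt X n S} (f : PtHom a φ x y) : obj x →ₛₗ[(φ : R →+* S)] obj y
  map_id {R : Type} [CommRing R] [Algebra ℂ R] (x : Pt X n R) (v : obj x) :
    map (PtHom.id a x) v = v
  map_comp {R S T : Type} [CommRing R] [Algebra ℂ R] [CommRing S] [Algebra ℂ S] [CommRing T]
    [Algebra ℂ T] {φ : R →ₐ[ℂ] S} {ψ : S →ₐ[ℂ] T} {x : Pt X n R} {y : Pt X n S} {z : Pt X n T}
    (f : PtHom a φ x y) (g : PtHom a ψ y z) (v : obj x) : map (f.comp g) v = map g (map f v)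
  isBC {R S : Type} [CommRing R] [Algebra ℂ R] [CommRing S] [Algebra ℂ S] {φ : R →ₐ[ℂ] S}
    {x : Pt X n R} {y : Pt X n S} (f : PtHom a φ x y) : IsBC (φ : R →+* S) (map f)
  finite {R : Type} [CommRing R] [Algebra ℂ R] (x : Pt X n R) : Module.Finite R (obj x)

attribute [instance] EqCoh.addCommGroup EqCoh.module EqCoh.finite

/-- Homomorphisms of equivariant sheaves. -/
structure EqCoh.Hom {n : ℕ} (F G : EqCoh a n) where
  app {R : Type} [CommRing R] [Algebra ℂ R] (x : Pt X n R) : F.obj x →ₗ[R] G.obj x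
  naturality {R S : Type} [CommRing R] [Algebra ℂ R] [CommRing S] [Algebra ℂ S] {φ : R →ₐ[ℂ] S}
    {x : Pt X n R} {y : Pt X n S} (f : PtHom a φ x y) (v : F.obj x) :
    app y (F.map f v) = G.map f (app x v)

instance {n : ℕ} : Category (EqCoh a n) where
  Hom F G := EqCoh.Hom F G
  id F := ⟨fun _ => LinearMap.id, fun _ _ => rfl⟩
  comp α β := ⟨fun x => (β.app x).comp (α.app x), fun f v => by
    rw [LinearMap.comp_apply, α.naturality, β.naturality]; rfl⟩

/-- The zero sheaf. -/
def EqCoh.zero (n : ℕ) : EqCoh a n where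
  obj _ := PUnit
  map _ := 0
  map_id _ _ := rfl
  map_comp _ _ _ := rfl
  isBC _ := (IsBC.pi (J := Empty) (M := fun _ => PUnit) (N := fun _ => PUnit)
    (fun i => i.elim) (fun i => i.elim) 0 (fun _ i => i.elim)).of_equiv _
      (LinearEquiv.ofSubsingleton _ _) (LinearEquiv.ofSubsingleton _ _) fun _ => rfl
  finite _ := inferInstance

/-- The direct sum of a finite family of equivariant sheaves. -/
def EqCoh.directSum {n : ℕ} {ι : Type} [Finite ι] (F : ι → EqCoh a n) : EqCoh a n where
  obj x := ∀ i, (F i).obj x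
  map f :=
    { toFun := fun v i => (F i).map f (v i)
      map_add' := fun v w => by funext i; exact map_add _ _ _
      map_smul' := fun r v => by funext i; exact LinearMap.map_smulₛₗ _ _ _ }
  map_id x v := by funext i; exact (F i).map_id x (v i)
  map_comp f g v := by funext i; exact (F i).map_comp f g (v i)
  isBC f := IsBC.pi (fun i => (F i).map f) (fun i => (F i).isBC f) _ fun _ _ => rfl
  finite _ := inferInstance

variable (a) in
/-- A sheaf on `[X^n / S_n]`: a `ℤ/2`-graded `𝕋 × S_n`-equivariant coherent sheaf on `X^n`. -/
abbrev SuperSheaf (n : ℕ) : Type 1 := GradedObject (ZMod 2) (EqCoh a n)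

/-- The shift `F[k]`, with `F[k]^e = F^{e + k}` and the same equivariant structure. -/
def SuperSheaf.shift {n : ℕ} (F : SuperSheaf a n) (k : ℕ) : SuperSheaf a n :=
  fun e => F (e + (k : ZMod 2))

/-- The direct sum of a finite family of graded sheaves. -/
def SuperSheaf.directSum {n : ℕ} {ι : Type} [Finite ι] (F : ι → SuperSheaf a n) :
    SuperSheaf a n :=
  fun e => EqCoh.directSum fun i => F i e

/-- The direct sum of two graded sheaves. -/
def SuperSheaf.oplus {n : ℕ} (F G : SuperSheaf a n) : SuperSheaf a n :=
  SuperSheaf.directSum fun b : Bool => cond b F G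

/-- The zero graded sheaf. -/
def SuperSheaf.zero (n : ℕ) : SuperSheaf a n := fun _ => EqCoh.zero n

/-! ### Families of sheaves permuted by `S_n`, and their direct sums -/

variable (a) in
/-- For a set `I` with an action of `S_n`: a family `(F_i)_{i ∈ I}` of `𝕋`-equivariant coherent
sheaves on `X^n`, with isomorphisms `F_i(x) → F_{σ(i)}(σ(x))` for `σ ∈ S_n`, compatible with
composition. -/
structure EqFamily (n : ℕ) (I : Type) [MulAction (Equiv.Perm (Fin n)) I] where
  obj (i : I) {R : Type} [CommRing R] [Algebra ℂ R] (x : Pt X n R) : Type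
  [addCommGroup (i : I) {R : Type} [CommRing R] [Algebra ℂ R] (x : Pt X n R) :
    AddCommGroup (obj i x)]
  [module (i : I) {R : Type} [CommRing R] [Algebra ℂ R] (x : Pt X n R) : Module R (obj i x)]
  map {R S : Type} [CommRing R] [Algebra ℂ R] [CommRing S] [Algebra ℂ S] {φ : R →ₐ[ℂ] S}
    {x : Pt X n R} {y : Pt X n S} (f : PtHom a φ x y) {i j : I} (h : f.sigma • i = j) :
    obj i x →ₛₗ[(φ : R →+* S)] obj j y
  map_id {R : Type} [CommRing R] [Algebra ℂ R] (x : Pt X n R) (i : I) (v : obj i x) :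
    map (PtHom.id a x) (one_smul _ i) v = v
  map_comp {R S T : Type} [CommRing R] [Algebra ℂ R] [CommRing S] [Algebra ℂ S] [CommRing T]
    [Algebra ℂ T] {φ : R →ₐ[ℂ] S} {ψ : S →ₐ[ℂ] T} {x : Pt X n R} {y : Pt X n S} {z : Pt X n T}
    (f : PtHom a φ x y) (g : PtHom a ψ y z) {i j k : I} (hf : f.sigma • i = j)
    (hg : g.sigma • j = k) (hfg : (f.comp g).sigma • i = k) (v : obj i x) :
    map (f.comp g) hfg v = map g hg (map f hf v)
  isBC {R S : Type} [CommRing R] [Algebra ℂ R] [CommRing S] [Algebra ℂ S] {φ : R →ₐ[ℂ] S}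
    {x : Pt X n R} {y : Pt X n S} (f : PtHom a φ x y) {i j : I} (h : f.sigma • i = j) :
    IsBC (φ : R →+* S) (map f h)
  finite (i : I) {R : Type} [CommRing R] [Algebra ℂ R] (x : Pt X n R) : Module.Finite R (obj i x)

attribute [instance] EqFamily.addCommGroup EqFamily.module EqFamily.finite

namespace EqFamily

variable {n : ℕ} {I J : Type} [MulAction (Equiv.Perm (Fin n)) I]
  [MulAction (Equiv.Perm (Fin n)) J]

theorem map_congr (F : EqFamily a n I) {x : Pt X n R} {y : Pt X n S} (f : PtHom a φ x y) {i i' j : I}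
    (e : i = i') (h : f.sigma • i = j)
    (h' : f.sigma • i' = j) (v : ∀ i, F.obj i x) :
    F.map f h (v i) = F.map f h' (v i') := by
  subst e; rfl

/-- The `S_n`-equivariant sheaf `⨁_{i ∈ I} F_i`; the element `σ` of `S_n` maps the summand `F_i` to
the summand `F_{σ(i)}`. -/
def sum [Finite I] (F : EqFamily a n I) : EqCoh a n where
  obj x := ∀ i, F.obj i x
  map f :=
    { toFun := fun v j => F.map f (smul_inv_smul f.sigma j) (v _)
      map_add' := fun v w => by funext i; exact map_add _ _ _
      map_smul' := fun r v => by funext i; exact LinearMap.map_smulₛₗ _ _ _ }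
  map_id x v := by
    funext i
    refine (F.map_congr (PtHom.id a x) ?_ _ (one_smul _ i) v).trans (F.map_id x i (v i))
    rw [inv_smul_eq_iff]
    exact (one_smul _ i).symm
  map_comp f g v := by
    funext k
    let σ : Equiv.Perm (Fin n) := f.sigma
    let τ : Equiv.Perm (Fin n) := g.sigma
    have e : (τ * σ)⁻¹ • k = σ⁻¹ • τ⁻¹ • k := by rw [mul_inv_rev, mul_smul]
    have h : (τ * σ) • σ⁻¹ • τ⁻¹ • k = k := by rw [← e, smul_inv_smul]
    refine (F.map_congr (f.comp g) e _ h v).trans ?_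
    exact F.map_comp f g (smul_inv_smul σ _) (smul_inv_smul τ k) h _
  isBC {R S _ _ _ _ φ x y} f := by
    let σ : Equiv.Perm (Fin n) := f.sigma
    let G : (∀ i, F.obj (σ⁻¹ • i) x) →ₛₗ[(φ : R →+* S)] ∀ i, F.obj i y :=
      { toFun := fun v j => F.map f (smul_inv_smul σ j) (v j)
        map_add' := fun v w => by funext i; exact map_add _ _ _
        map_smul' := fun r v => by funext i; exact LinearMap.map_smulₛₗ _ _ _ }
    have hG : IsBC (φ : R →+* S) G :=
      IsBC.pi (fun j => F.map f (smul_inv_smul σ j)) (fun j => F.isBC f _) G fun _ _ => rfl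
    let e : (∀ i, F.obj i x) ≃ₗ[R] ∀ i, F.obj (σ⁻¹ • i) x :=
      LinearEquiv.piCongrLeft' R (fun i => F.obj i x) (MulAction.toPerm σ)
    refine hG.of_equiv _ e.symm (LinearEquiv.refl S _) fun v => ?_
    obtain ⟨v, rfl⟩ := e.surjective v
    exact congrArg (fun w : ∀ i, F.obj i x => fun j => F.map f (smul_inv_smul σ j) (w (σ⁻¹ • j)))
      (e.symm_apply_apply v)
  finite _ := inferInstance

/-- The family `(F_{u(j)})_{j ∈ J}`, for an equivariant map `u : J → I`. -/
def comap (F : EqFamily a n I) (u : J → I)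
    (hu : ∀ (σ : Equiv.Perm (Fin n)) (j : J), u (σ • j) = σ • u j) : EqFamily a n J where
  obj j _ _ _ x := F.obj (u j) x
  map f _ _ h := F.map f ((hu _ _).symm.trans (congrArg u h))
  map_id x j v := F.map_id x (u j) v
  map_comp f g _ _ _ _ _ _ v := F.map_comp f g _ _ _ v
  isBC f _ _ _ := F.isBC f _
  finite j _ _ _ x := F.finite (u j) x

/-- The same family of sheaves, with the isomorphism `F_i(x) → F_{σ(i)}(σ(x))` multiplied by the
sign `ε(σ, i)`. -/
def twist (F : EqFamily a n I) (ε : Equiv.Perm (Fin n) → I → ℤ)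
    (hsq : ∀ σ i, ε σ i * ε σ i = 1) (hone : ∀ i, ε 1 i = 1)
    (hmul : ∀ τ σ i, ε (τ * σ) i = ε τ (σ • i) * ε σ i) : EqFamily a n I where
  obj i _ _ _ x := F.obj i x
  addCommGroup i _ _ _ x := F.addCommGroup i x
  module i _ _ _ x := F.module i x
  map f i _ h := ε f.sigma i • F.map f h
  map_id x i v := by
    have : ε (PtHom.id a x).sigma i = 1 := hone i
    rw [this, one_smul]
    exact F.map_id x i v
  map_comp f g i j k hf hg hfg v := by
    have : ε (f.comp g).sigma i = ε g.sigma j * ε f.sigma i := by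
      subst hf
      exact hmul _ _ _
    rw [LinearMap.smul_apply, LinearMap.smul_apply, LinearMap.smul_apply, this,
      F.map_comp f g hf hg hfg, map_zsmul, mul_smul]
  isBC f _ _ h := (F.isBC f h).zsmul (hsq _ _)
  finite i _ _ _ x := F.finite i x

end EqFamily

/-! ### The sheaves `F_𝔄` for set partitions `𝔄` of `[n]` -/

section Blocks

open scoped Pointwise

variable {n : ℕ}

/-- For a point `x` of `X^n` and `A ⊆ [n]`, the point `i_{A,X}(x)` of `X^{|A|}` given by the
coordinates in `A`, where `i_A : [|A|] → [n]` is the increasing map with image `A`. -/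
def Pt.restrict (x : Pt X n R) (A : Finset (Fin n)) : Pt X A.card R :=
  fun i => x (A.orderEmbOfFin rfl i)

/-- For `B = σ(A)`, the bijection `τ : [|A|] → [|B|]` with `σ ∘ i_A = i_B ∘ τ`. -/
def blockPerm (σ : Equiv.Perm (Fin n)) {A B : Finset (Fin n)} (h : σ • A = B) :
    Fin A.card ≃ Fin B.card :=
  (A.orderIsoOfFin rfl).toEquiv.trans ((σ.subtypeEquiv fun i => by
    rw [← h, ← Equiv.Perm.smul_def, Finset.smul_mem_smul_finset_iff]).trans
      (B.orderIsoOfFin rfl).symm.toEquiv)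

theorem blockPerm_spec (σ : Equiv.Perm (Fin n)) {A B : Finset (Fin n)} (h : σ • A = B)
    (i : Fin A.card) :
    B.orderEmbOfFin rfl (blockPerm σ h i) = σ (A.orderEmbOfFin rfl i) := by
  simp [blockPerm, ← Finset.coe_orderIsoOfFin_apply]

/-- The morphism `i_{A,X}(x) → i_{B,X}(y)` induced by `f : x → y` when `B = σ(A)`. -/
def PtHom.restrict {x : Pt X n R} {y : Pt X n S} (f : PtHom a φ x y) {A B : Finset (Fin n)}
    (h : f.sigma • A = B) : PtHom a φ (Pt.restrict x A) (Pt.restrict y B) where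
  t := f.t
  perm := blockPerm f.sigma h
  coord_perm i := by
    change y (B.orderEmbOfFin rfl (blockPerm f.sigma h i)) = _
    rw [blockPerm_spec]
    exact f.coord_perm _

theorem PtHom.restrict_comp {x : Pt X n R} {y : Pt X n S} {z : Pt X n T} (f : PtHom a φ x y)
    (g : PtHom a ψ y z)
    {A B C : Finset (Fin n)} (hf : f.sigma • A = B) (hg : g.sigma • B = C)
    (hfg : (f.comp g).sigma • A = C) :
    (f.comp g).restrict hfg = (f.restrict hf).comp (g.restrict hg) := by
  refine PtHom.ext' rfl (Equiv.ext fun i => ?_)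
  apply (C.orderEmbOfFin rfl).injective
  change C.orderEmbOfFin rfl (blockPerm _ hfg i) =
    C.orderEmbOfFin rfl (blockPerm _ hg (blockPerm _ hf i))
  rw [blockPerm_spec, blockPerm_spec, blockPerm_spec]
  rfl

theorem PtHom.restrict_id (x : Pt X n R) {A : Finset (Fin n)} (h : (PtHom.id a x).sigma • A = A) :
    (PtHom.id a x).restrict h = PtHom.id a (Pt.restrict x A) := by
  refine PtHom.ext' rfl (Equiv.ext fun i => ?_)
  apply (A.orderEmbOfFin rfl).injective
  change A.orderEmbOfFin rfl (blockPerm _ h i) = A.orderEmbOfFin rfl i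
  rw [blockPerm_spec]
  rfl

/-- The structure maps of a sequence of graded sheaves, for morphisms between points of `X^m` and
of `X^l` (so that necessarily `m = l`). -/
def seqMap (F : ∀ m, SuperSheaf a m) {m l : ℕ} {p q : ZMod 2} (hpq : p = q)
    {x : Pt X m R} {y : Pt X l S} (f : PtHom a φ x y) : (F m p).obj x →ₛₗ[(φ : R →+* S)] (F l q).obj y := by
  have hml : m = l := Fin.equiv_iff_eq.mp ⟨f.perm⟩
  subst hml
  subst hpq
  exact (F m p).map f

theorem seqMap_id (F : ∀ m, SuperSheaf a m) {m : ℕ} {p : ZMod 2} (x : Pt X m R)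
    (v : (F m p).obj x) : seqMap F rfl (PtHom.id a x) v = v :=
  (F m p).map_id x v

theorem seqMap_comp (F : ∀ m, SuperSheaf a m) {m l k : ℕ} {p q r : ZMod 2} (hpq : p = q)
    (hqr : q = r) (hpr : p = r) {x : Pt X m R} {y : Pt X l S} {z : Pt X k T}
    (f : PtHom a φ x y) (g : PtHom a ψ y z) (v : (F m p).obj x) :
    seqMap F hpr (f.comp g) v = seqMap F hqr g (seqMap F hpq f v) := by
  have hml : m = l := Fin.equiv_iff_eq.mp ⟨f.perm⟩
  have hlk : l = k := Fin.equiv_iff_eq.mp ⟨g.perm⟩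
  subst hml hlk hpq hqr
  exact (F m p).map_comp f g v

theorem seqMap_isBC (F : ∀ m, SuperSheaf a m) {m l : ℕ} {p q : ZMod 2} (hpq : p = q)
    {x : Pt X m R} {y : Pt X l S} (f : PtHom a φ x y) : IsBC (φ : R →+* S) (seqMap F hpq f) := by
  have hml : m = l := Fin.equiv_iff_eq.mp ⟨f.perm⟩
  subst hml
  subst hpq
  exact (F m p).isBC f

/-- Set partitions of `[n]`. -/
abbrev SetPartition (n : ℕ) : Type := Finpartition (Finset.univ : Finset (Fin n))

/-- The blocks of a set partition. -/
abbrev Blocks (P : SetPartition n) : Type := { A : Finset (Fin n) // A ∈ P.parts }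

/-- The action of `S_n` on set partitions of `[n]`: `σ(𝔄) = {σ(A) | A ∈ 𝔄}`. -/
instance : MulAction (Equiv.Perm (Fin n)) (SetPartition n) where
  smul σ P := Finpartition.ofExistsUnique (σ • P.parts) (fun _ _ => Finset.subset_univ _)
    (fun i _ => by
      obtain ⟨A, ⟨hA, hi⟩, huniq⟩ := P.existsUnique_mem (Finset.mem_univ (σ⁻¹ • i))
      refine ⟨σ • A, ⟨Finset.smul_mem_smul_finset hA, ?_⟩, ?_⟩
      · rwa [← Finset.inv_smul_mem_iff]
      · rintro B ⟨hB, hiB⟩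
        obtain ⟨C, hC, rfl⟩ := Finset.mem_smul_finset.mp hB
        rw [← Finset.inv_smul_mem_iff] at hiB
        rw [huniq C ⟨hC, hiB⟩])
    (fun h => by
      obtain ⟨C, hC, hC'⟩ := Finset.mem_smul_finset.mp h
      rw [Finset.smul_finset_eq_empty] at hC'
      subst hC'
      exact P.empty_notMem_parts hC)
  one_smul P := Finpartition.ext (one_smul _ P.parts)
  mul_smul σ τ P := Finpartition.ext (mul_smul σ τ P.parts)

theorem parts_smul (σ : Equiv.Perm (Fin n)) (P : SetPartition n) :
    (σ • P).parts = σ • P.parts := rfl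

/-- The bijection `A ↦ σ(A)` between the blocks of `P` and the blocks of `Q = σ(P)`. -/
def blockEquiv (σ : Equiv.Perm (Fin n)) {P Q : SetPartition n} (h : σ • P = Q) :
    Blocks P ≃ Blocks Q where
  toFun A := ⟨σ • A.1, by subst h; exact Finset.smul_mem_smul_finset A.2⟩
  invFun B := ⟨σ⁻¹ • B.1, by
    subst h
    obtain ⟨C, hC, hC'⟩ := Finset.mem_smul_finset.mp B.2
    rw [← hC', inv_smul_smul]
    exact hC⟩
  left_inv A := by simp
  right_inv B := by simp

theorem smul_blockEquiv_symm (σ : Equiv.Perm (Fin n)) {P Q : SetPartition n} (h : σ • P = Q)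
    (B : Blocks Q) : σ • ((blockEquiv σ h).symm B).1 = B.1 :=
  smul_inv_smul σ B.1

/-- The blocks to which `p` gives odd degree. -/
def oddBlocks {P : SetPartition n} (p : Blocks P → ZMod 2) : Finset (Finset (Fin n)) :=
  ((Finset.univ : Finset (Blocks P)).filter fun A => p A = 1).map (Function.Embedding.subtype _)

theorem oddBlocks_smul (σ : Equiv.Perm (Fin n)) {P Q : SetPartition n} (h : σ • P = Q)
    (p : Blocks P → ZMod 2) (q : Blocks Q → ZMod 2) (hpq : ∀ A, p A = q (blockEquiv σ h A)) :
    oddBlocks q = σ • oddBlocks p := by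
  ext B
  simp only [oddBlocks, Finset.mem_map, Finset.mem_filter, Finset.mem_univ, true_and,
    Finset.mem_smul_finset, Function.Embedding.subtype_apply]
  constructor
  · rintro ⟨B, hB, rfl⟩
    refine ⟨_, ⟨(blockEquiv σ h).symm B, ?_, rfl⟩, ?_⟩
    · rw [hpq, Equiv.apply_symm_apply, hB]
    · exact smul_inv_smul σ B.1
  · rintro ⟨_, ⟨A, hA, rfl⟩, rfl⟩
    exact ⟨blockEquiv σ h A, (hpq A).symm.trans hA, rfl⟩

variable (F : ∀ m, SuperSheaf a m)

/-- The value at the point `x` of the degree `p` part of `F_A = i_{A,X}^* F_{|A|}`. -/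
def BlockObj (A : Finset (Fin n)) (p : ZMod 2) (x : Pt X n R) : Type :=
  (F A.card p).obj (Pt.restrict x A)

instance (A : Finset (Fin n)) (p : ZMod 2) (x : Pt X n R) : AddCommGroup (BlockObj F A p x) :=
  (F A.card p).addCommGroup (Pt.restrict x A)

instance (A : Finset (Fin n)) (p : ZMod 2) (x : Pt X n R) : Module R (BlockObj F A p x) :=
  (F A.card p).module (Pt.restrict x A)

instance (A : Finset (Fin n)) (p : ZMod 2) (x : Pt X n R) :
    Module.Finite R (BlockObj F A p x) :=
  (F A.card p).finite (Pt.restrict x A)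

/-- The isomorphism `F_A(x) → F_{σ(A)}(y)`, given by the `S_{|A|}`-equivariant structure
of `F_{|A|}` and the permutation `τ` with `σ ∘ i_A = i_{σ(A)} ∘ τ`. -/
def blockMap {x : Pt X n R} {y : Pt X n S} (f : PtHom a φ x y) {A B : Finset (Fin n)} (h : f.sigma • A = B)
    {p q : ZMod 2} (hpq : p = q) : BlockObj F A p x →ₛₗ[(φ : R →+* S)] BlockObj F B q y :=
  seqMap F hpq (f.restrict h)

theorem blockMap_id (x : Pt X n R) {A B : Finset (Fin n)} (h : (PtHom.id a x).sigma • A = B)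
    {p q : ZMod 2} (hpq : p = q) (e : B = A) (v : ∀ A p, BlockObj F A p x) :
    blockMap F (PtHom.id a x) h hpq (v A p) = v B q := by
  subst e hpq
  change seqMap F rfl ((PtHom.id a x).restrict h) (v B p) = _
  rw [PtHom.restrict_id x h]
  exact seqMap_id F _ _

theorem blockMap_comp {x : Pt X n R} {y : Pt X n S} {z : Pt X n T} (f : PtHom a φ x y)
    (g : PtHom a ψ y z)
    {A B C : Finset (Fin n)} (hf : f.sigma • A = B) (hg : g.sigma • B = C)
    (hfg : (f.comp g).sigma • A = C) {p q r : ZMod 2} (hpq : p = q) (hqr : q = r) (hpr : p = r)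
    (v : BlockObj F A p x) :
    blockMap F (f.comp g) hfg hpr v = blockMap F g hg hqr (blockMap F f hf hpq v) := by
  change seqMap F hpr ((f.comp g).restrict hfg) v = _
  rw [PtHom.restrict_comp f g hf hg hfg]
  exact seqMap_comp F hpq hqr hpr _ _ v

theorem blockMap_isBC {x : Pt X n R} {y : Pt X n S} (f : PtHom a φ x y) {A B : Finset (Fin n)}
    (h : f.sigma • A = B) {p q : ZMod 2} (hpq : p = q) :
    IsBC (φ : R →+* S) (blockMap F f h hpq) :=
  seqMap_isBC F hpq (f.restrict h)

/-- For a set partition `P = {A_1 < ⋯ < A_l}` of `[n]` and degrees `p`, the sheaf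
`F_{A_1}^{p_1} ⊗ ⋯ ⊗ F_{A_l}^{p_l}`, evaluated at the point `x`. -/
abbrev BlockTensor (P : SetPartition n) (p : Blocks P → ZMod 2) (x : Pt X n R) : Type :=
  ⨂[R] A : Blocks P, BlockObj F A.1 (p A) x

/-- For `Q = σ(P)`, the tensor product of the maps `F_A(x) → F_{σ(A)}(y)` followed by the
permutation of the factors into increasing order, with its Koszul sign: `-1` for each inversion
among the factors of odd degree. -/
def blockTensorMap {x : Pt X n R} {y : Pt X n S} (f : PtHom a φ x y) {P Q : SetPartition n} (h : f.sigma • P = Q)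
    (p : Blocks P → ZMod 2) (q : Blocks Q → ZMod 2)
    (hpq : ∀ A, p A = q (blockEquiv f.sigma h A)) :
    BlockTensor F P p x →ₛₗ[(φ : R →+* S)] BlockTensor F Q q y :=
  sgn f.sigma (oddBlocks p) •
    tensorMap (blockEquiv f.sigma h) fun B =>
      blockMap F f (smul_blockEquiv_symm f.sigma h B)
        ((hpq _).trans (congrArg q (Equiv.apply_symm_apply _ B)))

theorem blockTensorMap_tprod {x : Pt X n R} {y : Pt X n S} (f : PtHom a φ x y) {P Q : SetPartition n}
    (h : f.sigma • P = Q) (p : Blocks P → ZMod 2) (q : Blocks Q → ZMod 2)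
    (hpq : ∀ A, p A = q (blockEquiv f.sigma h A)) (m : ∀ A : Blocks P, BlockObj F A.1 (p A) x) :
    blockTensorMap F f h p q hpq (PiTensorProduct.tprod R m) =
      sgn f.sigma (oddBlocks p) • PiTensorProduct.tprod S fun B : Blocks Q =>
        blockMap F f (smul_blockEquiv_symm f.sigma h B)
          ((hpq _).trans (congrArg q (Equiv.apply_symm_apply _ B)))
          (m ((blockEquiv f.sigma h).symm B)) := by
  exact congrArg (fun w => sgn f.sigma (oddBlocks p) • w)
    (tensorMap_tprod (φ := (φ : R →+* S)) (blockEquiv f.sigma h)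
      (M := fun A : Blocks P => BlockObj F A.1 (p A) x)
      (N := fun B : Blocks Q => BlockObj F B.1 (q B) y) _ m)

theorem blockTensorMap_id (x : Pt X n R) {P : SetPartition n}
    (h : (PtHom.id a x).sigma • P = P) (p : Blocks P → ZMod 2)
    (hpq : ∀ A, p A = p (blockEquiv (PtHom.id a x).sigma h A)) (v : BlockTensor F P p x) :
    blockTensorMap F (PtHom.id a x) h p p hpq v = v := by
  induction v using PiTensorProduct.induction_on with
  | smul_tprod r m =>
    rw [LinearMap.map_smulₛₗ, blockTensorMap_tprod]
    have hs : sgn (PtHom.id a x).sigma (oddBlocks p) = 1 := sgn_one _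
    rw [hs, one_smul]
    refine congrArg₂ (fun (s : R) w => s • PiTensorProduct.tprod R w) rfl ?_
    funext B
    have hB : (blockEquiv (PtHom.id a x).sigma h).symm B = B :=
      Subtype.ext (one_smul _ B.1)
    have key : ∀ (A : Blocks P) (e : A = B) (h₁ : (PtHom.id a x).sigma • A.1 = B.1)
        (h₂ : p A = p B), blockMap F (PtHom.id a x) h₁ h₂ (m A) = m B := by
      rintro A rfl h₁ h₂
      change seqMap F h₂ ((PtHom.id a x).restrict h₁) (m A) = m A
      rw [PtHom.restrict_id x h₁]
      exact seqMap_id F _ _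
    exact key _ hB _ _
  | add v w hv hw => rw [map_add, hv, hw]

theorem blockTensorMap_comp {x : Pt X n R} {y : Pt X n S} {z : Pt X n T} (f : PtHom a φ x y)
    (g : PtHom a ψ y z)
    {P Q P' : SetPartition n} (hf : f.sigma • P = Q) (hg : g.sigma • Q = P')
    (hfg : (f.comp g).sigma • P = P') (p : Blocks P → ZMod 2) (q : Blocks Q → ZMod 2)
    (r : Blocks P' → ZMod 2) (hpq : ∀ A, p A = q (blockEquiv f.sigma hf A))
    (hqr : ∀ A, q A = r (blockEquiv g.sigma hg A))
    (hpr : ∀ A, p A = r (blockEquiv (f.comp g).sigma hfg A)) (v : BlockTensor F P p x) :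
    blockTensorMap F (f.comp g) hfg p r hpr v =
      blockTensorMap F g hg q r hqr (blockTensorMap F f hf p q hpq v) := by
  induction v using PiTensorProduct.induction_on with
  | smul_tprod s m =>
    rw [LinearMap.map_smulₛₗ, LinearMap.map_smulₛₗ, LinearMap.map_smulₛₗ, blockTensorMap_tprod,
      blockTensorMap_tprod, map_zsmul, blockTensorMap_tprod, smul_smul]
    have hs : sgn (f.comp g).sigma (oddBlocks p) =
        sgn f.sigma (oddBlocks p) * sgn g.sigma (oddBlocks q) := by
      rw [oddBlocks_smul f.sigma hf p q hpq, mul_comm]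
      exact sgn_mul g.sigma f.sigma _
    rw [hs]
    refine congrArg₂ (fun (s : T) w => s • _ • PiTensorProduct.tprod T w) rfl ?_
    funext C
    have hC : (blockEquiv (f.comp g).sigma hfg).symm C =
        (blockEquiv f.sigma hf).symm ((blockEquiv g.sigma hg).symm C) := by
      apply Subtype.ext
      change (g.sigma * f.sigma)⁻¹ • C.1 = f.sigma⁻¹ • g.sigma⁻¹ • C.1
      rw [mul_inv_rev, mul_smul]
    have key : ∀ (A A' : Blocks P) (B : Blocks Q) (_ : A' = A) (h₁ : (f.comp g).sigma • A'.1 = C.1)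
        (h₂ : p A' = r C) (h₃ : f.sigma • A.1 = B.1) (h₄ : p A = q B)
        (h₅ : g.sigma • B.1 = C.1) (h₆ : q B = r C),
        blockMap F (f.comp g) h₁ h₂ (m A') =
          blockMap F g h₅ h₆ (blockMap F f h₃ h₄ (m A)) := by
      rintro A _ B rfl h₁ h₂ h₃ h₄ h₅ h₆
      exact blockMap_comp F f g h₃ h₅ h₁ h₄ h₆ h₂ _
    exact key _ _ _ hC _ _ _ _ _ _
  | add v w hv hw => rw [map_add, map_add, map_add, hv, hw]

theorem blockTensorMap_isBC {x : Pt X n R} {y : Pt X n S} (f : PtHom a φ x y) {P Q : SetPartition n}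
    (h : f.sigma • P = Q) (p : Blocks P → ZMod 2) (q : Blocks Q → ZMod 2)
    (hpq : ∀ A, p A = q (blockEquiv f.sigma h A)) :
    IsBC (φ : R →+* S) (blockTensorMap F f h p q hpq) := by
  have h1 := tensorMap_isBC (φ := (φ : R →+* S)) (blockEquiv f.sigma h)
    (M := fun A : Blocks P => BlockObj F A.1 (p A) x)
    (N := fun B : Blocks Q => BlockObj F B.1 (q B) y)
    (fun B => blockMap F f (smul_blockEquiv_symm f.sigma h B)
        ((hpq _).trans (congrArg q (Equiv.apply_symm_apply _ B))))
    (fun B => blockMap_isBC F f _ _)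
  exact h1.zsmul (sgn_mul_self f.sigma (oddBlocks p))

/-- Degrees `p_A` for the blocks `A` of `P`, with sum `e`. -/
abbrev Degrees (P : SetPartition n) (e : ZMod 2) : Type :=
  { p : Blocks P → ZMod 2 // ∑ A, p A = e }

/-- Transport of degrees from `Q = σ(P)` to `P`. -/
def Degrees.pull (σ : Equiv.Perm (Fin n)) {P Q : SetPartition n} (h : σ • P = Q) {e : ZMod 2}
    (q : Degrees Q e) : Degrees P e :=
  ⟨fun A => q.1 (blockEquiv σ h A), by
    exact (Equiv.sum_comp (blockEquiv σ h) q.1).trans q.2⟩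

/-- Transport of degrees is bijective. -/
def Degrees.pullEquiv (σ : Equiv.Perm (Fin n)) {P Q : SetPartition n} (h : σ • P = Q)
    (e : ZMod 2) : Degrees Q e ≃ Degrees P e where
  toFun := Degrees.pull σ h
  invFun p := ⟨fun B => p.1 ((blockEquiv σ h).symm B), by
    exact (Equiv.sum_comp (blockEquiv σ h).symm p.1).trans p.2⟩
  left_inv q := by
    apply Subtype.ext; funext B
    exact congrArg q.1 (Equiv.apply_symm_apply _ B)
  right_inv p := by
    apply Subtype.ext; funext A
    exact congrArg p.1 (Equiv.symm_apply_apply _ A)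

theorem blockTensorMap_congr {x : Pt X n R} {y : Pt X n S} (f : PtHom a φ x y) {P Q : SetPartition n}
    {e : ZMod 2} (h : f.sigma • P = Q) {p p' : Degrees P e} (hp : p = p') (q : Degrees Q e)
    (hpq : ∀ A, p.1 A = q.1 (blockEquiv f.sigma h A))
    (hpq' : ∀ A, p'.1 A = q.1 (blockEquiv f.sigma h A))
    (v : ∀ p : Degrees P e, BlockTensor F P p.1 x) :
    blockTensorMap F f h p.1 q.1 hpq (v p) = blockTensorMap F f h p'.1 q.1 hpq' (v p') := by
  subst hp; rfl

/-- The family `(F_𝔄)` of sheaves, for `𝔄` ranging over the set partitions of `[n]`, in degree `e`: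
`F_𝔄 = F_{A_1} ⊗ ⋯ ⊗ F_{A_l}` for `𝔄 = {A_1 < ⋯ < A_l}`, the tensor product of graded sheaves, with
the isomorphisms `F_𝔄(x) → F_{σ(𝔄)}(σ(x))`. -/
def partitionFamily (e : ZMod 2) : EqFamily a n (SetPartition n) where
  obj P _ _ _ x := ∀ p : Degrees P e, BlockTensor F P p.1 x
  map f P Q h :=
    { toFun := fun v q => blockTensorMap F f h (q.pull f.sigma h).1 q.1 (fun _ => rfl) (v _)
      map_add' := fun v w => by funext i; exact map_add _ _ _
      map_smul' := fun r v => by funext i; exact LinearMap.map_smulₛₗ _ _ _ }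
  map_id x P v := by
    funext q
    have hq : ∀ h, q.pull (PtHom.id a x).sigma h = q := by
      intro h
      apply Subtype.ext; funext A
      exact congrArg q.1 (Subtype.ext (one_smul _ A.1))
    exact (blockTensorMap_congr F (PtHom.id a x) _ (hq _) q (fun _ => rfl)
      (fun A => congrArg q.1 (Subtype.ext (one_smul _ A.1).symm)) v).trans
        (blockTensorMap_id F x _ q.1 _ (v q))
  map_comp f g P Q P' hf hg hfg v := by
    funext r
    have hr : r.pull (f.comp g).sigma hfg = (r.pull g.sigma hg).pull f.sigma hf := by
      apply Subtype.ext; funext A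
      exact congrArg r.1 (Subtype.ext (mul_smul g.sigma f.sigma A.1))
    refine (blockTensorMap_congr F (f.comp g) hfg hr r (fun _ => rfl)
      (fun A => congrArg r.1 (Subtype.ext (mul_smul g.sigma f.sigma A.1).symm)) v).trans ?_
    exact blockTensorMap_comp F f g hf hg hfg _ (r.pull g.sigma hg).1 r.1 (fun _ => rfl)
      (fun _ => rfl) _ _
  isBC {R S _ _ _ _ φ x y} f P Q h := by
    let E : (∀ p : Degrees P e, BlockTensor F P p.1 x) ≃ₗ[R]
        ∀ q : Degrees Q e, BlockTensor F P (q.pull f.sigma h).1 x :=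
      LinearEquiv.piCongrLeft' R (fun p : Degrees P e => BlockTensor F P p.1 x)
        (Degrees.pullEquiv f.sigma h e).symm
    let G : (∀ q : Degrees Q e, BlockTensor F P (q.pull f.sigma h).1 x) →ₛₗ[(φ : R →+* S)]
        ∀ q : Degrees Q e, BlockTensor F Q q.1 y :=
      { toFun := fun v q =>
          blockTensorMap F f h (q.pull f.sigma h).1 q.1 (fun _ => rfl) (v q)
        map_add' := fun v w => by funext i; exact map_add _ _ _
        map_smul' := fun r v => by funext i; exact LinearMap.map_smulₛₗ _ _ _ }
    have hG : IsBC (φ : R →+* S) G :=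
      IsBC.pi (fun q : Degrees Q e =>
        blockTensorMap F f h (q.pull f.sigma h).1 q.1 (fun _ => rfl))
        (fun q => blockTensorMap_isBC F f h _ _ _) G fun _ _ => rfl
    refine hG.of_equiv _ E.symm (LinearEquiv.refl S _) fun v => ?_
    obtain ⟨v, rfl⟩ := E.surjective v
    exact congrArg (fun (w : ∀ p : Degrees P e, BlockTensor F P p.1 x) (q : Degrees Q e) =>
      blockTensorMap F f h (q.pull f.sigma h).1 q.1 (fun _ => rfl) (w (q.pull f.sigma h)))
      (E.symm_apply_apply v)
  finite _ _ _ _ _ := inferInstance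

/-! ### The plethystic exponential and logarithm -/

/-- The coefficient of `q^n`, for `n ≥ 1`, in the plethystic exponential of `∑ F_m q^m`: the direct
sum of the `F_𝔄` over all set partitions `𝔄` of `[n]`, permuted by `S_n`. -/
def shExp (F : ∀ m, SuperSheaf a m) (n : ℕ) : SuperSheaf a n :=
  fun e => (partitionFamily F e).sum

/-- The coefficient `G_n` of `q^n`, for `n ≥ 1`, in the plethystic logarithm of `1 + ∑ F_m q^m`:
`G_n` is the direct sum of `F_n` and of the shift by `1` of the coefficient of `q^n` in the
plethystic exponential of `∑_{m=1}^{n-1} G_m q^m`. -/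
def shLog (F : ∀ m, SuperSheaf a m) (n : ℕ) : SuperSheaf a n :=
  (F n).oplus ((shExp (fun m => if 1 ≤ m ∧ m < n then shLog F m else SuperSheaf.zero m) n).shift 1)
termination_by n
decreasing_by omega

/-! ### Index trees -/

/-- Index trees of order `n`: rooted trees in which each node is a leaf or has at least two
children, with the leaves labelled by the blocks of a set partition of `[n]`. Each node is labelled
by the union of the labels of the leaves below it; the labels of the nodes are distinct, and a node
is below another one if and only if its label is contained in that of the other. The tree is thus
given by the set of the labels of its nodes. -/
@[ext]
structure IndexTree (n : ℕ) where
  nodes : Finset (Finset (Fin n))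
  univ_mem : Finset.univ ∈ nodes
  empty_notMem : ∅ ∉ nodes
  laminar : ∀ A ∈ nodes, ∀ B ∈ nodes, A ⊆ B ∨ B ⊆ A ∨ Disjoint A B
  eq_union : ∀ A ∈ nodes, (∃ B ∈ nodes, B ⊂ A) →
    ∀ i ∈ A, ∃ B ∈ nodes, B ⊂ A ∧ i ∈ B

namespace IndexTree

/-- The labels of the leaves: the minimal elements of the set of labels. -/
def leaves (T : IndexTree n) : Finset (Finset (Fin n)) :=
  T.nodes.filter fun A => ∀ B ∈ T.nodes, ¬ B ⊂ A

/-- The labels of the non-leaf nodes. -/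
def inner (T : IndexTree n) : Finset (Finset (Fin n)) := T.nodes \ T.leaves

/-- The set partition given by the labels of the leaves. -/
def leafPartition (T : IndexTree n) : SetPartition n :=
  Finpartition.ofExistsUnique T.leaves (fun _ _ => Finset.subset_univ _)
    (fun i _ => by
      obtain ⟨A, hA, hmin⟩ := Finset.exists_min_image (T.nodes.filter fun A => i ∈ A)
        Finset.card ⟨Finset.univ, Finset.mem_filter.mpr ⟨T.univ_mem, Finset.mem_univ i⟩⟩
      rw [Finset.mem_filter] at hA
      refine ⟨A, ⟨Finset.mem_filter.mpr ⟨hA.1, fun B hB hBA => ?_⟩, hA.2⟩, ?_⟩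
      · obtain ⟨C, hC, hCA, hi⟩ := T.eq_union A hA.1 ⟨B, hB, hBA⟩ i hA.2
        exact absurd (hmin C (Finset.mem_filter.mpr ⟨hC, hi⟩))
          (not_le.mpr (Finset.card_lt_card hCA))
      · rintro B ⟨hB, hi⟩
        rw [leaves, Finset.mem_filter] at hB
        rcases T.laminar A hA.1 B hB.1 with h | h | h
        · by_contra hne
          exact hB.2 A hA.1 (h.ssubset_of_ne (Ne.symm hne))
        · exact Finset.eq_of_subset_of_card_le h (hmin B (Finset.mem_filter.mpr ⟨hB.1, hi⟩))
        · exact absurd hi (Finset.disjoint_left.mp h hA.2))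
    (fun h => T.empty_notMem (Finset.mem_filter.mp h).1)

/-- `σ(T)`: the same tree, with each label `L` replaced by `σ(L)`. -/
instance : MulAction (Equiv.Perm (Fin n)) (IndexTree n) where
  smul σ T :=
    { nodes := σ • T.nodes
      univ_mem := by
        rw [← Finset.smul_finset_univ (a := σ)]
        exact Finset.smul_mem_smul_finset T.univ_mem
      empty_notMem := fun h => by
        obtain ⟨C, hC, hC'⟩ := Finset.mem_smul_finset.mp h
        rw [Finset.smul_finset_eq_empty] at hC'
        subst hC'
        exact T.empty_notMem hC
      laminar := fun A hA B hB => by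
        obtain ⟨A, hA', rfl⟩ := Finset.mem_smul_finset.mp hA
        obtain ⟨B, hB', rfl⟩ := Finset.mem_smul_finset.mp hB
        have hd : Disjoint A B → Disjoint (σ • A) (σ • B) := fun h => by
          rw [Finset.disjoint_left] at h ⊢
          intro i hi hi'
          rw [← Finset.inv_smul_mem_iff] at hi hi'
          exact h hi hi'
        exact (T.laminar A hA' B hB').imp Finset.smul_finset_subset_smul_finset
          (Or.imp Finset.smul_finset_subset_smul_finset hd)
      eq_union := fun A hA h i hi => by
        obtain ⟨A, hA', rfl⟩ := Finset.mem_smul_finset.mp hA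
        have hss : ∀ B C : Finset (Fin n), σ • B ⊂ σ • C ↔ B ⊂ C := fun B C => by
          simp only [Finset.ssubset_iff_subset_ne, Finset.smul_finset_subset_smul_finset_iff, ne_eq,
            smul_left_cancel_iff]
        obtain ⟨B, hB, hBA⟩ := h
        obtain ⟨B, hB', rfl⟩ := Finset.mem_smul_finset.mp hB
        rw [← Finset.inv_smul_mem_iff] at hi
        obtain ⟨C, hC, hCA, hiC⟩ := T.eq_union A hA' ⟨B, hB', (hss B A).mp hBA⟩ _ hi
        exact ⟨σ • C, Finset.smul_mem_smul_finset hC, (hss C A).mpr hCA,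
          Finset.inv_smul_mem_iff.mp hiC⟩ }
  one_smul T := IndexTree.ext (one_smul _ T.nodes)
  mul_smul σ τ T := IndexTree.ext (mul_smul σ τ T.nodes)

theorem nodes_smul (σ : Equiv.Perm (Fin n)) (T : IndexTree n) :
    (σ • T).nodes = σ • T.nodes := rfl

theorem leaves_smul (σ : Equiv.Perm (Fin n)) (T : IndexTree n) :
    (σ • T).leaves = σ • T.leaves := by
  have hss : ∀ B C : Finset (Fin n), σ • B ⊂ σ • C ↔ B ⊂ C := fun B C => by
    simp only [Finset.ssubset_iff_subset_ne, Finset.smul_finset_subset_smul_finset_iff, ne_eq,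
      smul_left_cancel_iff]
  ext A
  obtain ⟨A, rfl⟩ := MulAction.surjective σ A
  simp only [leaves, nodes_smul, Finset.mem_filter, Finset.smul_mem_smul_finset_iff]
  refine and_congr_right fun _ => ⟨fun h B hB hBA => ?_, fun h B hB hBA => ?_⟩
  · exact h (σ • B) (Finset.smul_mem_smul_finset hB) ((hss B A).mpr hBA)
  · obtain ⟨B, hB', rfl⟩ := Finset.mem_smul_finset.mp hB
    exact h B hB' ((hss B A).mp hBA)

theorem inner_smul (σ : Equiv.Perm (Fin n)) (T : IndexTree n) :
    (σ • T).inner = σ • T.inner := by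
  rw [inner, inner, leaves_smul, nodes_smul, Finset.smul_finset_sdiff]

theorem leafPartition_smul (σ : Equiv.Perm (Fin n)) (T : IndexTree n) :
    (σ • T).leafPartition = σ • T.leafPartition :=
  Finpartition.ext (leaves_smul σ T)

instance : Finite (IndexTree n) :=
  Finite.of_injective IndexTree.nodes fun _ _ h => IndexTree.ext h

end IndexTree

/-- The set `𝒯_{n,k}` of index trees of order `n` with `k` non-leaf nodes. -/
abbrev IndexTreeWith (n k : ℕ) : Type := { T : IndexTree n // T.inner.card = k }

instance (k : ℕ) : MulAction (Equiv.Perm (Fin n)) (IndexTreeWith n k) where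
  smul σ T := ⟨σ • T.1, by rw [IndexTree.inner_smul, Finset.card_smul_finset, T.2]⟩
  one_smul T := Subtype.ext (one_smul _ T.1)
  mul_smul σ τ T := Subtype.ext (mul_smul σ τ T.1)

/-- The family `(F_T)` of sheaves `F_T = F_{𝔄(T)}`, for `T` ranging over the index trees of
order `n` with `k` non-leaf nodes, in degree `e`. The isomorphism `F_T(x) → F_{σ(T)}(σ(x))` is the
one for set partitions, multiplied by the sign of the bijection given by `σ` between the sets of
non-leaf nodes of `T` and of `σ(T)`, totally ordered by the order on subsets of `[n]`. -/
def treeFamily (k : ℕ) (e : ZMod 2) : EqFamily a n (IndexTreeWith n k) :=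
  ((partitionFamily F e).comap (fun T : IndexTreeWith n k => T.1.leafPartition)
    fun σ T => IndexTree.leafPartition_smul σ T.1).twist (fun σ T => sgn σ T.1.inner)
      (fun σ T => sgn_mul_self σ T.1.inner) (fun T => sgn_one T.1.inner)
      fun τ σ T => (sgn_mul τ σ T.1.inner).trans
        (congrArg (fun S => sgn τ S * sgn σ T.1.inner) (IndexTree.inner_smul σ T.1).symm)

/-- The sheaf `G_{n,k} = ⨁_T F_T` on `[X^n / S_n]`, where `T` ranges over the index trees of
order `n` with `k` non-leaf nodes. -/
def treeSheaf (F : ∀ m, SuperSheaf a m) (n k : ℕ) : SuperSheaf a n :=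
  fun e => (treeFamily F k e).sum

end Blocks
end Geometry
end ShLog

end

noncomputable section
namespace ShLog

/-! ### Iterated tensor products and tensor products over disjoint unions. -/

section NestedTensor

variable {R : Type} [CommRing R]

/-! The series exponentiated in the recursion stops before `q^n`, so the partition with the single
block `[n]` contributes zero, and `G_n` is `F_n` plus the shift by one of the `G_𝔄` for partitions
`𝔄` with at least two blocks. By induction each `G_A` is a sum of sheaves `F_T[k]` over trees on
`A`. Tensor products distribute over direct sums, so a summand of `G_𝔄` is a choice of one tree for
each block. Joining these trees under a new root gives precisely the trees whose root is not a leaf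
(`DegTree.decompose_bijective`); the shift by one counts the new root, and the tree with a single
node accounts for `F_n`. This settles the matter without the action of `S_n`.

The real content is the comparison of signs. Fix the degree of each leaf, and regard each non-leaf
node and each leaf of odd degree as an odd symbol; the total degree of a summand is the parity of
its number of symbols. In `G_{n,k}[k]` a permutation acts with the sign of its effect on the
non-leaf nodes times the Koszul sign of its effect on the odd leaves (`DegTree.symSign`). This is
the sign of the permutation of all symbols when they are ordered with the non-leaf nodes first. In
the recursion one finds instead the Koszul sign of the permutation of the blocks of odd total
degree, times one such sign for each block. By `relSign_lex` this is the sign of the same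
permutation when the symbols are grouped by the child of the root above them. The root itself never
takes part in an inversion. Changing the orders on source and target changes the sign by a
coboundary, so the two actions become equal once each summand is rescaled by the sign of the shuffle
between its two orders, `DegTree.rootSign`; this is `DegTree.rootSign_mul`.

The induction hypothesis is packaged as `TreeDecomp`: projections to the summands of all trees with
degrees, natural up to `symSign` and jointly bijective. Tensor products are indexed by unordered
sets of blocks, so that all signs are explicit scalars and `assemble_natural` is free of signs. The
final isomorphism collects the projections by their number `k` of non-leaf nodes, where `k < n` by
`IndexTree.card_inner_lt`. -/

theorem multilinear_ext_tprod {Q : Type} [AddCommGroup Q] [Module R Q] :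
    ∀ {n : ℕ} {β : Fin n → Type} {M : ∀ i, β i → Type} [∀ i j, AddCommGroup (M i j)]
      [∀ i j, Module R (M i j)] (f₁ f₂ : MultilinearMap R (fun i => ⨂[R] j, M i j) Q),
      (∀ m : ∀ i j, M i j, f₁ (fun i => PiTensorProduct.tprod R (m i)) =
        f₂ (fun i => PiTensorProduct.tprod R (m i))) → f₁ = f₂ := by
  intro n
  induction n with
  | zero =>
    intro β M _ _ f₁ f₂ h
    ext v
    have := h (fun i => i.elim0)
    rwa [Subsingleton.elim (fun i => PiTensorProduct.tprod R _) v] at this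
  | succ n ih =>
    intro β M _ _ f₁ f₂ h
    have key : f₁.curryLeft = f₂.curryLeft := by
      apply PiTensorProduct.ext
      ext1 m₀
      apply ih (β := fun i => β i.succ) (M := fun i => M i.succ)
      intro m
      have := h (Fin.cons m₀ m)
      simp only [LinearMap.compMultilinearMap_apply, MultilinearMap.curryLeft_apply]
      convert this using 2 <;>
      · funext i
        refine Fin.cases ?_ (fun j => ?_) i <;> simp
    rw [← f₁.uncurry_curryLeft, key, f₂.uncurry_curryLeft]

/-- This and the next lemma give multilinearity in the arguments outside, respectively inside, the
first index. The decidability instances are arbitrary because the axioms of a multilinear map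
quantify over them. -/
theorem cons_sigma_update_succ {n : ℕ} {β : Fin (n + 1) → Type} {M : ∀ i, β i → Type}
    [DecidableEq (Σ i, β i)] [DecidableEq (Σ i : Fin n, β i.succ)] (m₀ : ∀ j, M 0 j)
    (m : ∀ p : Σ i : Fin n, β i.succ, M p.1.succ p.2) (p : Σ i : Fin n, β i.succ)
    (z : M p.1.succ p.2) :
    (fun q : Σ i, β i => Fin.cons (α := fun i => ∀ j, M i j) m₀
        (fun i j => Function.update m p z ⟨i, j⟩) q.1 q.2) =
      Function.update (fun q : Σ i, β i => Fin.cons (α := fun i => ∀ j, M i j) m₀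
        (fun i j => m ⟨i, j⟩) q.1 q.2) ⟨p.1.succ, p.2⟩ z := by
  funext q
  obtain ⟨i, j⟩ := q
  obtain ⟨k, l⟩ := p
  induction i using Fin.cases with
  | zero =>
    rw [Function.update_of_ne]
    · rfl
    · intro h; exact (Fin.succ_ne_zero k) (congrArg Sigma.fst h).symm
  | succ i =>
    by_cases h : (⟨i, j⟩ : Σ i : Fin n, β i.succ) = ⟨k, l⟩
    · cases h
      simp only [Fin.cons_succ]
      convert (rfl : z = z) using 1 <;> simp
    · rw [Function.update_of_ne]
      · simp only [Fin.cons_succ]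
        convert Function.update_of_ne h _ _
      · intro h'
        apply h
        have h1 := congrArg Sigma.fst h'
        have h1 : i = k := Fin.succ_injective _ h1
        subst h1
        simpa using h'

theorem cons_sigma_update_zero {n : ℕ} {β : Fin (n + 1) → Type} {M : ∀ i, β i → Type}
    [DecidableEq (Σ i, β i)] [DecidableEq (β 0)] (m₀ : ∀ j, M 0 j)
    (m : ∀ p : Σ i : Fin n, β i.succ, M p.1.succ p.2) (k : β 0) (z : M 0 k) :
    (fun q : Σ i, β i => Fin.cons (α := fun i => ∀ j, M i j) (Function.update m₀ k z)
        (fun i j => m ⟨i, j⟩) q.1 q.2) =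
      Function.update (fun q : Σ i, β i => Fin.cons (α := fun i => ∀ j, M i j) m₀
        (fun i j => m ⟨i, j⟩) q.1 q.2) ⟨0, k⟩ z := by
  funext q
  obtain ⟨i, j⟩ := q
  induction i using Fin.cases with
  | zero =>
    by_cases h : j = k
    · subst h
      simp
    · rw [Function.update_of_ne (by simpa using h)]
      simp only [Fin.cons_zero]
      exact Function.update_of_ne h _ _
  | succ i =>
    rw [Function.update_of_ne]
    · rfl
    · intro h; exact (Fin.succ_ne_zero i) (congrArg Sigma.fst h)

/-- Fixing the arguments of a multilinear map that belong to the first index. -/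
def sigmaFix {Q : Type} [AddCommGroup Q] [Module R Q] {n : ℕ} {β : Fin (n + 1) → Type}
    {M : ∀ i, β i → Type} [∀ i j, AddCommGroup (M i j)] [∀ i j, Module R (M i j)]
    (f : MultilinearMap R (fun p : Σ i, β i => M p.1 p.2) Q) (m₀ : ∀ j, M 0 j) :
    MultilinearMap R (fun p : Σ i : Fin n, β i.succ => M p.1.succ p.2) Q where
  toFun m := f fun p => Fin.cons (α := fun i => ∀ j, M i j) m₀ (fun i j => m ⟨i, j⟩) p.1 p.2
  map_update_add' m p x y := by
    classical
    simp only [cons_sigma_update_succ, f.map_update_add]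
  map_update_smul' m p c x := by
    classical
    simp only [cons_sigma_update_succ, f.map_update_smul]

theorem sigmaFix_apply {Q : Type} [AddCommGroup Q] [Module R Q] {n : ℕ} {β : Fin (n + 1) → Type}
    {M : ∀ i, β i → Type} [∀ i j, AddCommGroup (M i j)] [∀ i j, Module R (M i j)]
    (f : MultilinearMap R (fun p : Σ i, β i => M p.1 p.2) Q) (m₀ : ∀ j, M 0 j)
    (m : ∀ p : Σ i : Fin n, β i.succ, M p.1.succ p.2) :
    sigmaFix f m₀ m =
      f fun p => Fin.cons (α := fun i => ∀ j, M i j) m₀ (fun i j => m ⟨i, j⟩) p.1 p.2 :=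
  rfl

/-- Universal property of the iterated tensor product, by currying off the first index: the
partially extended map is multilinear in the arguments of that index, so it factors through their
tensor product. -/
theorem multilinear_sigma_extend_fin {Q : Type} [AddCommGroup Q] [Module R Q] :
    ∀ {n : ℕ} {β : Fin n → Type} {M : ∀ i, β i → Type} [∀ i j, AddCommGroup (M i j)]
      [∀ i j, Module R (M i j)] (f : MultilinearMap R (fun p : Σ i, β i => M p.1 p.2) Q),
      ∃ f' : MultilinearMap R (fun i => ⨂[R] j, M i j) Q, ∀ m : ∀ i j, M i j,
        f' (fun i => PiTensorProduct.tprod R (m i)) = f fun p => m p.1 p.2 := by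
  intro n
  induction n with
  | zero =>
    intro β M _ _ f
    refine ⟨MultilinearMap.constOfIsEmpty R _ (f fun p => p.1.elim0), fun m => ?_⟩
    rw [MultilinearMap.constOfIsEmpty_apply]
    exact congrArg f (Subsingleton.elim _ _)
  | succ n ih =>
    intro β M _ _ f
    -- The extension over the remaining indices is chosen separately for each `m₀`. It is unique by
    -- `multilinear_ext_tprod`, which is why `E` is itself multilinear in `m₀`.
    choose E hE using fun m₀ => ih (β := fun i => β i.succ) (M := fun i => M i.succ) (sigmaFix f m₀)
    let L : MultilinearMap R (fun j => M 0 j)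
        (MultilinearMap R (fun i : Fin n => ⨂[R] j, M i.succ j) Q) :=
      { toFun := E
        map_update_add' := fun m₀ k x y => by
          classical
          apply multilinear_ext_tprod
          intro m
          rw [add_apply, hE, hE, hE]
          simp only [sigmaFix_apply]
          have := fun z => cons_sigma_update_zero m₀ (fun p => m p.1 p.2) k z
          simp only at this
          rw [this, this, this, f.map_update_add]
        map_update_smul' := fun m₀ k c x => by
          classical
          apply multilinear_ext_tprod
          intro m
          rw [smul_apply, hE, hE]
          simp only [sigmaFix_apply]
          have := fun z => cons_sigma_update_zero m₀ (fun p => m p.1 p.2) k z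
          simp only at this
          rw [this, this, f.map_update_smul] }
    refine ⟨(PiTensorProduct.lift L).uncurryLeft, fun m => ?_⟩
    rw [LinearMap.uncurryLeft_apply, PiTensorProduct.lift.tprod]
    refine (hE (m 0) (fun i => m i.succ)).trans ?_
    rw [sigmaFix_apply]
    congr 1
    funext p
    obtain ⟨i, j⟩ := p
    induction i using Fin.cases <;> rfl

theorem multilinear_sigma_extend {ι : Type} [Finite ι] {Q : Type} [AddCommGroup Q] [Module R Q]
    {β : ι → Type} {M : ∀ i, β i → Type} [∀ i j, AddCommGroup (M i j)]
    [∀ i j, Module R (M i j)] (f : MultilinearMap R (fun p : Σ i, β i => M p.1 p.2) Q) :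
    ∃ f' : MultilinearMap R (fun i => ⨂[R] j, M i j) Q, ∀ m : ∀ i j, M i j,
      f' (fun i => PiTensorProduct.tprod R (m i)) = f fun p => m p.1 p.2 := by
  obtain ⟨n, ⟨e⟩⟩ := Finite.exists_equiv_fin ι
  let σ : (Σ k : Fin n, β (e.symm k)) ≃ Σ i, β i := Equiv.sigmaCongrLeft e.symm
  let f₀ : MultilinearMap R (fun q : Σ k : Fin n, β (e.symm k) => M (e.symm q.1) q.2) Q :=
    MultilinearMap.domDomCongrLinearEquiv' R R (fun p : Σ i, β i => M p.1 p.2) Q σ.symm f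
  obtain ⟨f', hf'⟩ := @multilinear_sigma_extend_fin R _ Q _ _ n (fun k => β (e.symm k))
    (fun k => M (e.symm k)) (fun _ _ => inferInstance) (fun _ _ => inferInstance) f₀
  refine ⟨(MultilinearMap.domDomCongrLinearEquiv' R R (fun i => ⨂[R] j, M i j) Q e).symm f',
    fun m => ?_⟩
  refine (hf' (fun k => m (e.symm k))).trans ?_
  exact congrArg f
    ((σ.symm.piCongrLeft' fun p : Σ i, β i => M p.1 p.2).symm_apply_apply fun p => m p.1 p.2)

variable {ι : Type} {β : ι → Type} {M : ∀ i, β i → Type} [∀ i j, AddCommGroup (M i j)]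
  [∀ i j, Module R (M i j)]

/-- The map from the tensor product over a disjoint union to the iterated tensor product. -/
def sigmaToNested : (⨂[R] p : Σ i, β i, M p.1 p.2) →ₗ[R] ⨂[R] i, ⨂[R] j, M i j :=
  PiTensorProduct.lift
    ((PiTensorProduct.tprod R).compMultilinearMap fun _ => PiTensorProduct.tprod R)

theorem sigmaToNested_tprod (m : ∀ p : Σ i, β i, M p.1 p.2) :
    sigmaToNested (PiTensorProduct.tprod R m) =
      PiTensorProduct.tprod R fun i => PiTensorProduct.tprod R fun j => m ⟨i, j⟩ := by
  rw [sigmaToNested, PiTensorProduct.lift.tprod]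
  rfl

theorem exists_nestedToSigma [Finite ι] :
    ∃ G : (⨂[R] i, ⨂[R] j, M i j) →ₗ[R] ⨂[R] p : Σ i, β i, M p.1 p.2,
      ∀ m : ∀ i j, M i j, G (PiTensorProduct.tprod R fun i => PiTensorProduct.tprod R (m i)) =
        PiTensorProduct.tprod R fun p : Σ i, β i => m p.1 p.2 := by
  obtain ⟨f', hf'⟩ := multilinear_sigma_extend
    (PiTensorProduct.tprod R : MultilinearMap R (fun p : Σ i, β i => M p.1 p.2) _)
  refine ⟨PiTensorProduct.lift f', fun m => ?_⟩
  rw [PiTensorProduct.lift.tprod, hf']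

/-- The usual extensionality leaves arbitrary elements in the inner tensor products. Numbering the
outer index set allows `multilinear_ext_tprod` to reduce these to pure tensors as well. -/
theorem linearMap_ext_nested [Finite ι] {Q : Type} [AddCommGroup Q] [Module R Q]
    {f g : (⨂[R] i, ⨂[R] j, M i j) →ₗ[R] Q}
    (h : ∀ m : ∀ i j, M i j, f (PiTensorProduct.tprod R fun i => PiTensorProduct.tprod R (m i)) =
      g (PiTensorProduct.tprod R fun i => PiTensorProduct.tprod R (m i))) : f = g := by
  obtain ⟨n, ⟨e⟩⟩ := Finite.exists_equiv_fin ι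
  apply PiTensorProduct.ext
  apply (MultilinearMap.domDomCongrLinearEquiv' R R (fun i => ⨂[R] j, M i j) Q e).injective
  apply multilinear_ext_tprod (β := fun k => β (e.symm k)) (M := fun k => M (e.symm k))
  intro m
  obtain ⟨m, rfl⟩ := (e.piCongrLeft' fun i => ∀ j, M i j).surjective m
  have h1 : ∀ k : MultilinearMap R (fun i => ⨂[R] j, M i j) Q,
      MultilinearMap.domDomCongrLinearEquiv' R R (fun i => ⨂[R] j, M i j) Q e k
        (fun i => PiTensorProduct.tprod R ((e.piCongrLeft' fun i => ∀ j, M i j) m i)) =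
      k fun i => PiTensorProduct.tprod R (m i) := by
    intro k
    exact congrArg k ((e.piCongrLeft' fun i => ⨂[R] j, M i j).symm_apply_apply
      fun i => PiTensorProduct.tprod R (m i))
  rw [h1, h1]
  exact h m

/-- The iterated tensor product is the tensor product over the disjoint union. -/
def nestedEquivSigma [Finite ι] :
    (⨂[R] i, ⨂[R] j, M i j) ≃ₗ[R] ⨂[R] p : Σ i, β i, M p.1 p.2 :=
  LinearEquiv.ofLinearMap exists_nestedToSigma.choose sigmaToNested
    (by
      ext m
      change exists_nestedToSigma.choose (sigmaToNested (PiTensorProduct.tprod R m)) =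
        PiTensorProduct.tprod R m
      rw [sigmaToNested_tprod]
      exact exists_nestedToSigma.choose_spec fun i j => m ⟨i, j⟩)
    (by
      apply linearMap_ext_nested
      intro m
      rw [LinearMap.comp_apply, exists_nestedToSigma.choose_spec, sigmaToNested_tprod]
      rfl)

theorem nestedEquivSigma_tprod [Finite ι] (m : ∀ i j, M i j) :
    nestedEquivSigma (PiTensorProduct.tprod R fun i => PiTensorProduct.tprod R (m i)) =
      PiTensorProduct.tprod R fun p : Σ i, β i => m p.1 p.2 :=
  exists_nestedToSigma.choose_spec m

/-- Semilinear maps on an iterated tensor product are determined by their values on iterated pure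
tensors. -/
theorem nested_semilinear_ext [Finite ι] {S : Type} [CommRing S] {φ : R →+* S} {Q : Type}
    [AddCommGroup Q] [Module S Q] (f g : (⨂[R] i, ⨂[R] j, M i j) →ₛₗ[φ] Q)
    (h : ∀ m : ∀ i j, M i j, f (PiTensorProduct.tprod R fun i => PiTensorProduct.tprod R (m i)) =
      g (PiTensorProduct.tprod R fun i => PiTensorProduct.tprod R (m i)))
    (u : ⨂[R] i, ⨂[R] j, M i j) : f u = g u := by
  -- Over `R` acting on `Q` through `φ`, semilinear maps become linear, and the linear statement
  -- applies.
  let _ : Module R Q := Module.compHom Q φ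
  let f' : (⨂[R] i, ⨂[R] j, M i j) →ₗ[R] Q :=
    { toFun := f, map_add' := f.map_add, map_smul' := f.map_smulₛₗ }
  let g' : (⨂[R] i, ⨂[R] j, M i j) →ₗ[R] Q :=
    { toFun := g, map_add' := g.map_add, map_smul' := g.map_smulₛₗ }
  exact LinearMap.congr_fun (linearMap_ext_nested (f := f') (g := g') h) u

end NestedTensor

/-! ### Distributivity of tensor products over finite direct sums. -/

section Distribute

variable {R : Type} [CommRing R] {ι : Type} {κ : ι → Type} {M : ∀ i, κ i → Type}
  [∀ i j, AddCommGroup (M i j)] [∀ i j, Module R (M i j)]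

/-- Tensor products distribute over finite products. -/
theorem piTensor_proj_bijective [Finite ι] [∀ i, Finite (κ i)] :
    Function.Bijective fun (w : ⨂[R] i, ∀ j : κ i, M i j) (p : ∀ i, κ i) =>
      PiTensorProduct.map (fun i => LinearMap.proj (R := R) (φ := M i) (p i)) w := by
  classical
  let _ : ∀ i, Fintype (κ i) := fun i => Fintype.ofFinite _
  let _ : Fintype ι := Fintype.ofFinite ι
  -- Finite products are direct sums, for which distributivity is an equivalence; `key` then
  -- identifies its components with the tensor products of projections.
  let E : (⨂[R] i, ∀ j : κ i, M i j) ≃ₗ[R] ∀ p : ∀ i, κ i, ⨂[R] i, M i (p i) :=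
    ((PiTensorProduct.congr fun i =>
      (DirectSum.linearEquivFunOnFintype R (κ i) (M i)).symm).trans
        PiTensorProduct.ofDirectSumEquiv).trans
          (DirectSum.linearEquivFunOnFintype R (∀ i, κ i) fun p => ⨂[R] i, M i (p i))
  have key : (E : (⨂[R] i, ∀ j : κ i, M i j) →ₗ[R] _) = LinearMap.pi fun p : ∀ i, κ i =>
      PiTensorProduct.map fun i => LinearMap.proj (R := R) (φ := M i) (p i) := by
    refine PiTensorProduct.ext (MultilinearMap.ext fun m => funext fun p => ?_)
    change E (PiTensorProduct.tprod R m) p = PiTensorProduct.map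
      (fun i => LinearMap.proj (R := R) (φ := M i) (p i)) (PiTensorProduct.tprod R m)
    rw [PiTensorProduct.map_tprod]
    simp only [E, LinearEquiv.trans_apply, PiTensorProduct.congr_tprod]
    exact PiTensorProduct.ofDirectSumEquiv_tprod_apply _ _
  have := E.bijective
  have h2 : (E : (⨂[R] i, ∀ j : κ i, M i j) → _) = fun w p =>
      PiTensorProduct.map (fun i => LinearMap.proj (R := R) (φ := M i) (p i)) w := by
    funext w p
    exact congrFun (LinearMap.congr_fun key w) p
  rwa [h2] at this

/-- If modules `V i` are the products of the `M i j`, then their tensor product is the product of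
the tensor products `⨂ i, M i (p i)`. -/
theorem piTensor_map_bijective [Finite ι] [∀ i, Finite (κ i)] {V : ι → Type}
    [∀ i, AddCommGroup (V i)] [∀ i, Module R (V i)] (π : ∀ i j, V i →ₗ[R] M i j)
    (hπ : ∀ i, Function.Bijective fun v j => π i j v) :
    Function.Bijective fun (u : ⨂[R] i, V i) (p : ∀ i, κ i) =>
      PiTensorProduct.map (fun i => π i (p i)) u := by
  let E : ∀ i, V i ≃ₗ[R] ∀ j, M i j := fun i => LinearEquiv.ofBijective (LinearMap.pi (π i)) (hπ i)
  have h1 := (piTensor_proj_bijective (R := R) (M := M)).comp (PiTensorProduct.congr E).bijective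
  convert h1 using 1
  funext u p
  exact LinearMap.congr_fun (PiTensorProduct.map_comp
    (fun i => LinearMap.proj (R := R) (φ := M i) (p i)) fun i => (E i).toLinearMap) u

end Distribute

theorem tprod_zsmul {R J : Type} [CommRing R] [Fintype J] {M : J → Type} [∀ i, AddCommGroup (M i)]
    [∀ i, Module R (M i)] (c : J → ℤ) (v : ∀ i, M i) :
    PiTensorProduct.tprod R (fun i => c i • v i) = (∏ i, c i) • PiTensorProduct.tprod R v := by
  have := (PiTensorProduct.tprod R).map_smul_univ (fun i => (c i : R)) v
  simp only [Int.cast_smul_eq_zsmul] at this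
  rw [this, ← Int.cast_prod, Int.cast_smul_eq_zsmul]

/-! ### Signs relating two orders on a finite set. -/

section RelSign

variable {α β γ δ ι : Type} [LinearOrder β] [LinearOrder γ] [LinearOrder δ]

/-- The sign of the permutation relating the orders on `N` given by `a` and by `b`. -/
def relSign (N : Finset α) (a : α → β) (b : α → γ) : ℤ :=
  ∏ p ∈ (N ×ˢ N).filter (fun p => a p.1 < a p.2), if b p.2 < b p.1 then -1 else 1

/-- Images are written with `Finset.map` so that the same formula makes sense for bijections `[m] →
[n]` with `m` and `n` formally different, as occur between blocks. -/
theorem sgn_eq_relSign {n : ℕ} (σ : Equiv.Perm (Fin n)) (S : Finset (Finset (Fin n))) :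
    sgn σ S = relSign S binWeight (fun A => binWeight (A.map σ.toEmbedding)) := by
  have : ∀ A : Finset (Fin n), A.map σ.toEmbedding = A.image fun i => σ • i := fun A =>
    Finset.map_eq_image _ _
  simp only [this]
  exact sgn_eq_prod σ S

theorem relSign_congr {N : Finset α} {a : α → β} {a' : α → δ} {b : α → γ} {δ' : Type}
    [LinearOrder δ'] {b' : α → δ'}
    (h : ∀ x ∈ N, ∀ y ∈ N, a x < a y ↔ a' x < a' y)
    (h' : ∀ x ∈ N, ∀ y ∈ N, b x < b y ↔ b' x < b' y) : relSign N a b = relSign N a' b' := by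
  refine Finset.prod_congr ?_ ?_
  · ext ⟨x, y⟩
    simp only [Finset.mem_filter, Finset.mem_product]
    exact and_congr_right fun hxy => h x hxy.1 y hxy.2
  · rintro ⟨x, y⟩ hxy
    simp only [Finset.mem_filter, Finset.mem_product] at hxy
    simp only [h' y hxy.1.2 x hxy.1.1]

theorem relSign_eq_one {N : Finset α} {a : α → β} {b : α → γ}
    (h : ∀ x ∈ N, ∀ y ∈ N, a x < a y → ¬ b y < b x) : relSign N a b = 1 := by
  refine Finset.prod_eq_one ?_
  rintro ⟨x, y⟩ hxy
  simp only [Finset.mem_filter, Finset.mem_product] at hxy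
  exact if_neg (h x hxy.1.1 y hxy.1.2 hxy.2)

theorem relSign_mul_self (N : Finset α) (a : α → β) (b : α → γ) :
    relSign N a b * relSign N a b = 1 := by
  rw [relSign, ← Finset.prod_mul_distrib]
  refine Finset.prod_eq_one fun p _ => ?_
  split_ifs <;> rfl

theorem relSign_map {N : Finset α} (e : α ↪ ι) (a : ι → β) (b : ι → γ) :
    relSign (N.map e) a b = relSign N (fun x => a (e x)) (fun x => b (e x)) := by
  refine (Finset.prod_bij (fun p _ => (e p.1, e p.2)) ?_ ?_ ?_ ?_).symm
  · rintro ⟨x, y⟩ h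
    simpa using h
  · rintro ⟨x, y⟩ _ ⟨x', y'⟩ _ h
    simpa using h
  · rintro ⟨x, y⟩ h
    simp only [Finset.mem_filter, Finset.mem_product, Finset.mem_map] at h
    obtain ⟨⟨⟨x, hx, rfl⟩, ⟨y, hy, rfl⟩⟩, h⟩ := h
    exact ⟨(x, y), by simp [hx, hy, h], rfl⟩
  · rintro ⟨x, y⟩ _
    rfl

/-- Either side is the product of a symmetric function over unordered pairs of distinct elements; an
injective order function merely selects one ordering of each pair. -/
theorem prod_ordered_pairs_eq {N : Finset α} {a : α → β} {b : α → γ} (ha : Set.InjOn a N)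
    (hb : Set.InjOn b N) (d : α → α → ℤ) (hd : ∀ x y, d x y = d y x) :
    ∏ p ∈ (N ×ˢ N).filter (fun p => a p.1 < a p.2), d p.1 p.2 =
      ∏ p ∈ (N ×ˢ N).filter (fun p => b p.1 < b p.2), d p.1 p.2 := by
  refine Finset.prod_bij' (fun p _ => if b p.1 < b p.2 then p else p.swap)
    (fun p _ => if a p.1 < a p.2 then p else p.swap) ?_ ?_ ?_ ?_ ?_
  · rintro ⟨x, y⟩ h
    simp only [Finset.mem_filter, Finset.mem_product] at h ⊢
    have hne : b x ≠ b y := fun e => by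
      have := hb h.1.1 h.1.2 e
      subst this
      exact lt_irrefl _ h.2
    split_ifs with h'
    · exact ⟨h.1, h'⟩
    · exact ⟨h.1.symm, lt_of_le_of_ne (not_lt.mp h') hne.symm⟩
  · rintro ⟨x, y⟩ h
    simp only [Finset.mem_filter, Finset.mem_product] at h ⊢
    have hne : a x ≠ a y := fun e => by
      have := ha h.1.1 h.1.2 e
      subst this
      exact lt_irrefl _ h.2
    split_ifs with h'
    · exact ⟨h.1, h'⟩
    · exact ⟨h.1.symm, lt_of_le_of_ne (not_lt.mp h') hne.symm⟩
  · rintro ⟨x, y⟩ h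
    simp only [Finset.mem_filter, Finset.mem_product] at h
    by_cases h' : b x < b y
    · simp [h', h.2]
    · simp [h', h.2.le]
  · rintro ⟨x, y⟩ h
    simp only [Finset.mem_filter, Finset.mem_product] at h
    by_cases h' : a x < a y
    · simp [h', h.2]
    · simp [h', h.2.le]
  · rintro ⟨x, y⟩ h
    dsimp only
    split_ifs
    · rfl
    · exact hd x y

/-- A pair is inverted between `a` and `c` exactly when it is inverted in one, but not both, of the
two intermediate steps. Whether `b` and `c` disagree on a pair does not depend on its ordering, so
both factors can be taken over the pairs ordered by `a`. -/
theorem relSign_trans {N : Finset α} {a : α → β} {b : α → γ} {c : α → δ} (ha : Set.InjOn a N)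
    (hb : Set.InjOn b N) (hc : Set.InjOn c N) :
    relSign N a b * relSign N b c = relSign N a c := by
  let d : α → α → ℤ := fun x y =>
    if (b x < b y ∧ c y < c x) ∨ (b y < b x ∧ c x < c y) then -1 else 1
  have h1 : relSign N b c = ∏ p ∈ (N ×ˢ N).filter (fun p => b p.1 < b p.2), d p.1 p.2 := by
    refine Finset.prod_congr rfl ?_
    rintro ⟨x, y⟩ h
    simp only [Finset.mem_filter, Finset.mem_product] at h
    simp only [d]
    congr 1
    simp [h.2, h.2.le]
  rw [h1, prod_ordered_pairs_eq hb ha d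
    (fun x y => by simp only [d]; congr 1; exact propext or_comm), relSign, relSign,
    ← Finset.prod_mul_distrib]
  refine Finset.prod_congr rfl ?_
  rintro ⟨x, y⟩ h
  simp only [Finset.mem_filter, Finset.mem_product] at h
  have hne : x ≠ y := by rintro rfl; exact lt_irrefl _ h.2
  have n1 : b x ≠ b y := fun e => hne (hb h.1.1 h.1.2 e)
  have n2 : c x ≠ c y := fun e => hne (hc h.1.1 h.1.2 e)
  simp only [d]
  rcases lt_or_gt_of_ne n1 with h1 | h1 <;> rcases lt_or_gt_of_ne n2 with h2 | h2 <;>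
    simp [h1, h2, not_lt_of_gt h1, not_lt_of_gt h2]

/-- The sign relating two orders on a fibered set that are lexicographic for orders on the base:
each inversion between two fibers of odd size contributes a sign, and each fiber contributes the
sign of its own permutation. -/
theorem relSign_lex [DecidableEq ι] {β' γ' : Type} [LinearOrder β'] [LinearOrder γ']
    {N : Finset α} {I : Finset ι} (g : α → ι) (hg : ∀ x ∈ N, g x ∈ I) {u : ι → β'} {v : ι → γ'}
    (hu : Set.InjOn u I) (hv : Set.InjOn v I) (a : α → β) (b : α → γ) :
    relSign N (fun x => toLex (u (g x), a x)) (fun x => toLex (v (g x), b x)) =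
      relSign (I.filter fun i => Odd (N.filter fun x => g x = i).card) u v *
        ∏ i ∈ I, relSign (N.filter fun x => g x = i) a b := by
  classical
  let D : α × α → ℤ := fun p =>
    if toLex (v (g p.2), b p.2) < toLex (v (g p.1), b p.1) then -1 else 1
  -- Pairs in different fibers are compared on the base, pairs in the same fiber by `a`.
  have hsplit : (N ×ˢ N).filter (fun p => toLex (u (g p.1), a p.1) < toLex (u (g p.2), a p.2)) =
      (((I ×ˢ I).filter fun q => u q.1 < u q.2).biUnion fun q =>
        (N.filter fun x => g x = q.1) ×ˢ (N.filter fun x => g x = q.2)) ∪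
      (I.biUnion fun i => ((N.filter fun x => g x = i) ×ˢ (N.filter fun x => g x = i)).filter
        fun p => a p.1 < a p.2) := by
    ext ⟨x, y⟩
    simp only [Finset.mem_filter, Finset.mem_product, Finset.mem_union, Finset.mem_biUnion,
      Prod.Lex.toLex_lt_toLex]
    constructor
    · rintro ⟨⟨hx, hy⟩, h | h⟩
      · exact Or.inl ⟨(g x, g y), ⟨⟨hg x hx, hg y hy⟩, h⟩, ⟨hx, rfl⟩, hy, rfl⟩
      · have := hu (hg x hx) (hg y hy) h.1
        exact Or.inr ⟨g x, hg x hx, ⟨⟨hx, rfl⟩, hy, this.symm⟩, h.2⟩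
    · rintro (⟨⟨i, j⟩, ⟨_, h⟩, ⟨hx, rfl⟩, hy, rfl⟩ | ⟨i, _, ⟨⟨hx, rfl⟩, hy, e⟩, h⟩)
      · exact ⟨⟨hx, hy⟩, Or.inl h⟩
      · exact ⟨⟨hx, hy⟩, Or.inr ⟨by rw [e], h⟩⟩
  change ∏ p ∈ (N ×ˢ N).filter _, D p = _
  rw [hsplit, Finset.prod_union, Finset.prod_biUnion, Finset.prod_biUnion]
  · congr 1
    · rw [relSign]
      -- Between two distinct fibers all pairs are inverted or none is. The exponent is the product
      -- of the two sizes, so a sign survives only if both are odd.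
      have hprod : ∀ q ∈ (I ×ˢ I).filter (fun q => u q.1 < u q.2),
          ∏ p ∈ (N.filter fun x => g x = q.1) ×ˢ (N.filter fun x => g x = q.2), D p =
            if Odd (N.filter fun x => g x = q.1).card ∧ Odd (N.filter fun x => g x = q.2).card
              then (if v q.2 < v q.1 then -1 else 1) else 1 := by
        rintro ⟨i, j⟩ hq
        simp only [Finset.mem_filter, Finset.mem_product] at hq
        have hne : v i ≠ v j := fun e => by
          have := hv hq.1.1 hq.1.2 e
          subst this
          exact lt_irrefl _ hq.2
        rw [Finset.prod_congr rfl (g := fun _ => if v j < v i then (-1 : ℤ) else 1)]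
        · rw [Finset.prod_const, Finset.card_product]
          dsimp only
          split_ifs with h1 h2 h2
          · exact (h2.1.mul h2.2).neg_one_pow
          · rw [← Nat.odd_mul, Nat.not_odd_iff_even] at h2
            exact h2.neg_one_pow
          · exact one_pow _
          · exact one_pow _
        · rintro ⟨x, y⟩ h
          simp only [Finset.mem_filter, Finset.mem_product] at h
          simp only [D, h.1.2, h.2.2, Prod.Lex.toLex_lt_toLex, hne.symm, false_and, or_false]
      rw [Finset.prod_congr rfl hprod, ← Finset.prod_filter, Finset.filter_filter]
      refine Finset.prod_congr ?_ fun _ _ => rfl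
      ext ⟨i, j⟩
      simp only [Finset.mem_filter, Finset.mem_product]
      tauto
    · refine Finset.prod_congr rfl fun i _ => Finset.prod_congr rfl ?_
      rintro ⟨x, y⟩ h
      simp only [Finset.mem_filter, Finset.mem_product] at h
      simp only [D, h.1.1.2, h.1.2.2, Prod.Lex.toLex_lt_toLex, lt_irrefl, true_and, false_or]
  · intro i _ j _ hij
    rw [Function.onFun, Finset.disjoint_left]
    rintro ⟨x, y⟩ h h'
    simp only [Finset.mem_filter, Finset.mem_product] at h h'
    exact hij (h.1.1.2.symm.trans h'.1.1.2)
  · rintro ⟨i, j⟩ _ ⟨i', j'⟩ _ hij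
    rw [Function.onFun, Finset.disjoint_left]
    rintro ⟨x, y⟩ h h'
    simp only [Finset.mem_filter, Finset.mem_product] at h h'
    exact hij (Prod.ext (h.1.2.symm.trans h'.1.2) (h.2.2.symm.trans h'.2.2))
  · rw [Finset.disjoint_left]
    rintro ⟨x, y⟩ h h'
    simp only [Finset.mem_filter, Finset.mem_product, Finset.mem_biUnion] at h h'
    obtain ⟨⟨i, j⟩, ⟨_, h⟩, ⟨_, rfl⟩, _, rfl⟩ := h
    obtain ⟨i, _, ⟨⟨_, h1⟩, _, h2⟩, _⟩ := h'
    simp only [h1, h2, lt_irrefl] at h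

end RelSign

/-! ### Subtrees of index trees, and trees with degrees for the leaves. -/

section Trees

open scoped Pointwise

variable {m n l : ℕ}

/-- The increasing map `[|A|] → [n]` with image `A`. -/
abbrev blockEmb (A : Finset (Fin n)) : Fin A.card ↪ Fin n := (A.orderEmbOfFin rfl).toEmbedding

theorem map_univ_blockEmb (A : Finset (Fin n)) : Finset.univ.map (blockEmb A) = A :=
  Finset.map_orderEmbOfFin_univ A rfl

theorem map_blockEmb_subset (A : Finset (Fin n)) (C : Finset (Fin A.card)) :
    C.map (blockEmb A) ⊆ A := by
  conv_rhs => rw [← map_univ_blockEmb A]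
  exact Finset.map_subset_map.mpr (Finset.subset_univ C)

theorem exists_map_blockEmb {A B : Finset (Fin n)} (h : B ⊆ A) :
    ∃ C : Finset (Fin A.card), C.map (blockEmb A) = B := by
  rw [← map_univ_blockEmb A] at h
  obtain ⟨C, -, hC⟩ := Finset.subset_map_iff.mp h
  exact ⟨C, hC.symm⟩

/-- Comparing binary expansions is comparing the largest element of the symmetric difference. The
colexicographic form makes invariance under increasing embeddings available, so that inversions
below a block can be counted in `[|A|]` or in `[n]`. -/
theorem binWeight_lt_iff_colex {A B : Finset (Fin n)} :
    binWeight A < binWeight B ↔ toColex A < toColex B := by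
  have h : ∀ C : Finset (Fin n), binWeight C = ∑ i ∈ C.image Fin.val, 2 ^ i := fun C =>
    (Finset.sum_image fun _ _ _ _ e => Fin.val_injective e).symm
  rw [h, h, Finset.geomSum_lt_geomSum_iff_toColex_lt_toColex le_rfl,
    Finset.Colex.toColex_image_lt_toColex_image Fin.val_strictMono]

theorem binWeight_map_lt_iff (g : Fin m ↪o Fin n) {A B : Finset (Fin m)} :
    binWeight (A.map g.toEmbedding) < binWeight (B.map g.toEmbedding) ↔
      binWeight A < binWeight B := by
  rw [binWeight_lt_iff_colex, binWeight_lt_iff_colex, Finset.map_eq_image, Finset.map_eq_image]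
  exact Finset.Colex.toColex_image_lt_toColex_image g.strictMono

namespace IndexTree

theorem nonempty_of_mem (T : IndexTree n) {A : Finset (Fin n)} (h : A ∈ T.nodes) : A.Nonempty :=
  Finset.nonempty_iff_ne_empty.mpr fun e => T.empty_notMem (e ▸ h)

theorem mem_leaves {T : IndexTree n} {A : Finset (Fin n)} :
    A ∈ T.leaves ↔ A ∈ T.nodes ∧ ∀ B ∈ T.nodes, ¬ B ⊂ A :=
  Finset.mem_filter

theorem mem_inner {T : IndexTree n} {A : Finset (Fin n)} :
    A ∈ T.inner ↔ A ∈ T.nodes ∧ ∃ B ∈ T.nodes, B ⊂ A := by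
  rw [inner, Finset.mem_sdiff, mem_leaves]
  push Not
  constructor
  · rintro ⟨h, h'⟩
    exact ⟨h, h' h⟩
  · rintro ⟨h, h'⟩
    exact ⟨h, fun _ => h'⟩

theorem univ_mem_inner {T : IndexTree n} (h : T.inner.Nonempty) : Finset.univ ∈ T.inner := by
  obtain ⟨A, hA⟩ := h
  obtain ⟨_, B, hB, hBA⟩ := mem_inner.mp hA
  exact mem_inner.mpr ⟨T.univ_mem, B, hB, hBA.trans_subset (Finset.subset_univ A)⟩

/-- The subtree of `T` below the node `g([m])`, with labels in `[m]`. -/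
def comap (T : IndexTree n) (g : Fin m ↪ Fin n) (h : Finset.univ.map g ∈ T.nodes) :
    IndexTree m where
  nodes := Finset.univ.filter fun C => C.map g ∈ T.nodes
  univ_mem := by simpa using h
  empty_notMem := by simpa using T.empty_notMem
  laminar A hA B hB := by
    simp only [Finset.mem_filter, Finset.mem_univ, true_and] at hA hB
    simpa using T.laminar _ hA _ hB
  eq_union A hA hex i hi := by
    simp only [Finset.mem_filter, Finset.mem_univ, true_and] at hA hex ⊢
    obtain ⟨B, hB, hBA⟩ := hex
    obtain ⟨C, hC, hCA, hiC⟩ := T.eq_union _ hA ⟨_, hB, Finset.map_ssubset_map.mpr hBA⟩ (g i)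
      (Finset.mem_map_of_mem g hi)
    obtain ⟨C, -, rfl⟩ := Finset.subset_map_iff.mp hCA.1
    exact ⟨C, hC, Finset.map_ssubset_map.mp hCA, by simpa using hiC⟩

theorem mem_comap_nodes {T : IndexTree n} {g : Fin m ↪ Fin n} {h : Finset.univ.map g ∈ T.nodes}
    {C : Finset (Fin m)} : C ∈ (T.comap g h).nodes ↔ C.map g ∈ T.nodes := by
  simp [comap]

theorem exists_comap_ssubset {T : IndexTree n} {g : Fin m ↪ Fin n}
    {h : Finset.univ.map g ∈ T.nodes} {C : Finset (Fin m)} :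
    (∃ B ∈ (T.comap g h).nodes, B ⊂ C) ↔ ∃ B ∈ T.nodes, B ⊂ C.map g := by
  constructor
  · rintro ⟨B, hB, hBC⟩
    exact ⟨_, mem_comap_nodes.mp hB, Finset.map_ssubset_map.mpr hBC⟩
  · rintro ⟨B, hB, hBC⟩
    obtain ⟨B, -, rfl⟩ := Finset.subset_map_iff.mp hBC.1
    exact ⟨B, mem_comap_nodes.mpr hB, Finset.map_ssubset_map.mp hBC⟩

theorem mem_comap_inner {T : IndexTree n} {g : Fin m ↪ Fin n} {h : Finset.univ.map g ∈ T.nodes}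
    {C : Finset (Fin m)} : C ∈ (T.comap g h).inner ↔ C.map g ∈ T.inner := by
  rw [mem_inner, mem_inner, mem_comap_nodes, exists_comap_ssubset]

theorem mem_comap_leaves {T : IndexTree n} {g : Fin m ↪ Fin n} {h : Finset.univ.map g ∈ T.nodes}
    {C : Finset (Fin m)} : C ∈ (T.comap g h).leaves ↔ C.map g ∈ T.leaves := by
  have := exists_comap_ssubset (T := T) (h := h) (C := C)
  rw [mem_leaves, mem_leaves, mem_comap_nodes]
  refine and_congr_right fun _ => ?_
  rw [← not_iff_not]
  push Not
  exact this

/-- The children of the root of a tree with more than one node. -/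
def children (T : IndexTree n) : Finset (Finset (Fin n)) :=
  (T.nodes.erase Finset.univ).filter fun A => ∀ B ∈ T.nodes, A ⊂ B → B = Finset.univ

theorem mem_children {T : IndexTree n} {A : Finset (Fin n)} :
    A ∈ T.children ↔
      A ∈ T.nodes ∧ A ≠ Finset.univ ∧ ∀ B ∈ T.nodes, A ⊂ B → B = Finset.univ := by
  rw [children, Finset.mem_filter, Finset.mem_erase]
  tauto

/-- Among the nodes other than the root that contain `B`, one of maximal cardinality has only the
root above it. -/
theorem exists_child {T : IndexTree n} {B : Finset (Fin n)} (hB : B ∈ T.nodes)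
    (hne : B ≠ Finset.univ) : ∃ A ∈ T.children, B ⊆ A := by
  obtain ⟨A, hA, hmax⟩ := Finset.exists_max_image
    ((T.nodes.erase Finset.univ).filter fun A => B ⊆ A) Finset.card
    ⟨B, by simp [hB, hne]⟩
  simp only [Finset.mem_filter, Finset.mem_erase] at hA hmax
  refine ⟨A, mem_children.mpr ⟨hA.1.2, hA.1.1, fun C hC hAC => ?_⟩, hA.2⟩
  by_contra hC'
  exact absurd (hmax C ⟨⟨hC', hC⟩, hA.2.trans hAC.1⟩) (not_le.mpr (Finset.card_lt_card hAC))

theorem child_eq_of_mem {T : IndexTree n} {A B : Finset (Fin n)} (hA : A ∈ T.children)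
    (hB : B ∈ T.children) {i : Fin n} (hi : i ∈ A) (hi' : i ∈ B) : A = B := by
  rw [mem_children] at hA hB
  rcases T.laminar A hA.1 B hB.1 with h | h | h
  · by_contra hne
    exact hB.2.1 (hA.2.2 B hB.1 (h.ssubset_of_ne hne))
  · by_contra hne
    exact hA.2.1 (hB.2.2 A hA.1 (h.ssubset_of_ne (Ne.symm hne)))
  · exact absurd hi' (Finset.disjoint_left.mp h hi)

/-- The set partition given by the labels of the children of the root. -/
def rootPartition (T : IndexTree n) (h : Finset.univ ∈ T.inner) : SetPartition n :=
  Finpartition.ofExistsUnique T.children (fun _ _ => Finset.subset_univ _)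
    (fun i _ => by
      rw [mem_inner] at h
      obtain ⟨B, hB, hBu, hi⟩ := T.eq_union _ h.1 h.2 i (Finset.mem_univ i)
      obtain ⟨A, hA, hBA⟩ := exists_child hB hBu.ne
      exact ⟨A, ⟨hA, hBA hi⟩, fun C hC => child_eq_of_mem hC.1 hA hC.2 (hBA hi)⟩)
    (fun h => T.empty_notMem (mem_children.mp h).1)

theorem rootPartition_parts (T : IndexTree n) (h : Finset.univ ∈ T.inner) :
    (T.rootPartition h).parts = T.children := rfl

theorem smul_eq_map (σ : Equiv.Perm (Fin n)) (A : Finset (Fin n)) :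
    σ • A = A.map σ.toEmbedding := by
  rw [Finset.map_eq_image]
  rfl

end IndexTree

/-- An index tree with a degree for each leaf. -/
structure DegTree (n : ℕ) where
  tree : IndexTree n
  deg : Blocks tree.leafPartition → ZMod 2

namespace DegTree

/-- The leaves of odd degree. -/
def odd (t : DegTree n) : Finset (Finset (Fin n)) := oddBlocks t.deg

theorem mem_odd {t : DegTree n} {A : Finset (Fin n)} :
    A ∈ t.odd ↔ ∃ h : A ∈ t.tree.leaves, t.deg ⟨A, h⟩ = 1 := by
  simp only [odd, oddBlocks, Finset.mem_map, Finset.mem_filter, Finset.mem_univ, true_and,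
    Function.Embedding.subtype_apply, Subtype.exists, exists_and_right, exists_eq_right]
  rfl

theorem odd_subset_leaves (t : DegTree n) : t.odd ⊆ t.tree.leaves := fun _ h =>
  (mem_odd.mp h).1

-- A function to `ℤ/2` is determined by the set where it equals `1`. Comparing two sets of subsets
-- avoids comparing degree functions whose domains depend on the tree.
@[ext]
theorem ext {t t' : DegTree n} (h : t.tree.nodes = t'.tree.nodes) (h' : t.odd = t'.odd) :
    t = t' := by
  obtain ⟨T, r⟩ := t
  obtain ⟨T', r'⟩ := t'
  obtain rfl : T = T' := IndexTree.ext h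
  congr
  funext A
  have := Finset.ext_iff.mp h' A.1
  simp only [mem_odd] at this
  have h1 : r A = 1 ↔ r' A = 1 :=
    ⟨fun e => (this.mp ⟨A.2, e⟩).2, fun e => (this.mpr ⟨A.2, e⟩).2⟩
  generalize r A = a at h1
  generalize r' A = b at h1
  revert a b
  decide

/-- The labels of the nodes that carry an odd symbol: the non-leaf nodes and the leaves of odd
degree. -/
def symbols (t : DegTree n) : Finset (Finset (Fin n)) := t.tree.inner ∪ t.odd

theorem disjoint_inner_odd (t : DegTree n) : Disjoint t.tree.inner t.odd :=
  Finset.sdiff_disjoint.mono_right t.odd_subset_leaves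

theorem symbols_subset_nodes (t : DegTree n) : t.symbols ⊆ t.tree.nodes :=
  Finset.union_subset Finset.sdiff_subset (t.odd_subset_leaves.trans (Finset.filter_subset _ _))

/-- The total degree. -/
def degree (t : DegTree n) : ZMod 2 := ∑ A, t.deg A + (t.tree.inner.card : ZMod 2)

/-- This links the grading with the combinatorics: a tensor factor is odd for the Koszul rule
exactly when its tree has an odd number of symbols. -/
theorem degree_eq_card (t : DegTree n) : t.degree = (t.symbols.card : ZMod 2) := by
  rw [symbols, Finset.card_union_of_disjoint t.disjoint_inner_odd, Nat.cast_add, add_comm, degree]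
  congr 1
  rw [odd, oddBlocks, Finset.card_map, Finset.card_filter, Nat.cast_sum]
  refine Finset.sum_congr rfl fun A _ => ?_
  generalize t.deg A = a
  revert a
  decide

/-- The part of the tree below the node `g([m])`. -/
def comap (t : DegTree n) (g : Fin m ↪ Fin n) (h : Finset.univ.map g ∈ t.tree.nodes) :
    DegTree m where
  tree := t.tree.comap g h
  deg C := t.deg ⟨C.1.map g, IndexTree.mem_comap_leaves.mp C.2⟩

theorem mem_comap_odd {t : DegTree n} {g : Fin m ↪ Fin n} {h : Finset.univ.map g ∈ t.tree.nodes}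
    {C : Finset (Fin m)} : C ∈ (t.comap g h).odd ↔ C.map g ∈ t.odd := by
  rw [mem_odd, mem_odd]
  exact ⟨fun ⟨_, h₂⟩ => ⟨_, h₂⟩,
    fun ⟨h₁, h₂⟩ => ⟨(IndexTree.mem_comap_leaves (h := h)).mpr h₁, h₂⟩⟩

theorem mem_comap_symbols {t : DegTree n} {g : Fin m ↪ Fin n}
    {h : Finset.univ.map g ∈ t.tree.nodes}
    {C : Finset (Fin m)} : C ∈ (t.comap g h).symbols ↔ C.map g ∈ t.symbols := by
  rw [symbols, symbols, Finset.mem_union, Finset.mem_union, mem_comap_odd]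
  exact or_congr_left (IndexTree.mem_comap_inner (h := h))

end DegTree

/-! ### Grafting trees onto a set partition -/

/-- The union of the images in `[n]` of sets of subsets of the blocks. -/
def unionBlocks {P : SetPartition n} (f : ∀ A : Blocks P, Finset (Finset (Fin A.1.card))) :
    Finset (Finset (Fin n)) :=
  Finset.univ.biUnion fun A => (f A).map (Finset.mapEmbedding (blockEmb A.1)).toEmbedding

theorem mem_unionBlocks {P : SetPartition n} {f : ∀ A : Blocks P, Finset (Finset (Fin A.1.card))}
    {B : Finset (Fin n)} :
    B ∈ unionBlocks f ↔ ∃ A : Blocks P, ∃ C ∈ f A, C.map (blockEmb A.1) = B := by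
  simp [unionBlocks]

theorem block_eq_of_mem {P : SetPartition n} {A B : Blocks P} {i : Fin n} (hi : i ∈ A.1)
    (hi' : i ∈ B.1) : A = B :=
  Subtype.ext (P.eq_of_mem_parts A.2 B.2 hi hi')

theorem block_eq_of_map {P : SetPartition n} {A B : Blocks P} {C : Finset (Fin A.1.card)}
    (hC : C.Nonempty) {D : Finset (Fin B.1.card)}
    (h : C.map (blockEmb A.1) = D.map (blockEmb B.1)) : A = B := by
  obtain ⟨i, hi⟩ := hC
  have h1 := Finset.mem_map_of_mem (blockEmb A.1) hi
  have h2 := h ▸ h1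
  exact block_eq_of_mem (map_blockEmb_subset _ _ h1) (map_blockEmb_subset _ _ h2)

/-- A nonempty subset lies in at most one block, so the images of the various `f A` cannot
interfere; the empty set would lie in every block. -/
theorem map_mem_unionBlocks {P : SetPartition n}
    {f : ∀ A : Blocks P, Finset (Finset (Fin A.1.card))} {A : Blocks P} {C : Finset (Fin A.1.card)}
    (hC : C.Nonempty) : C.map (blockEmb A.1) ∈ unionBlocks f ↔ C ∈ f A := by
  rw [mem_unionBlocks]
  constructor
  · rintro ⟨B, D, hD, h⟩
    obtain rfl := block_eq_of_map hC h.symm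
    rwa [← Finset.map_injective _ h]
  · intro h
    exact ⟨A, C, h, rfl⟩

theorem card_unionBlocks {P : SetPartition n}
    {f : ∀ A : Blocks P, Finset (Finset (Fin A.1.card))} (h : ∀ A, ∀ C ∈ f A, C.Nonempty) :
    (unionBlocks f).card = ∑ A, (f A).card := by
  rw [unionBlocks, Finset.card_biUnion]
  · simp
  · intro A _ B _ hAB
    rw [Function.onFun, Finset.disjoint_left]
    intro C hC hC'
    simp only [Finset.mem_map, RelEmbedding.coe_toEmbedding, Finset.mapEmbedding_apply] at hC hC'
    obtain ⟨C, hC, rfl⟩ := hC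
    obtain ⟨D, hD, e⟩ := hC'
    exact hAB (block_eq_of_map (h A C hC) e.symm)

end Trees

/-! ### Cutting a tree at its root. -/

section TreeDecomposition

open scoped Pointwise

variable {m n l : ℕ}

theorem block_ne_univ {P : SetPartition n} (hP : Finset.univ ∉ P.parts) (A : Blocks P) :
    A.1 ≠ Finset.univ := fun e => hP (Eq.subst (motive := fun B => B ∈ P.parts) e A.2)

namespace IndexTree

theorem child_mem_nodes {T : IndexTree n} (h : Finset.univ ∈ T.inner)
    (A : Blocks (T.rootPartition h)) : Finset.univ.map (blockEmb A.1) ∈ T.nodes := by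
  rw [map_univ_blockEmb]
  exact (mem_children.mp A.2).1

theorem exists_block_map {T : IndexTree n} (h : Finset.univ ∈ T.inner) {B : Finset (Fin n)}
    (hB : B ∈ T.nodes) (hne : B ≠ Finset.univ) :
    ∃ (A : Blocks (T.rootPartition h)) (C : Finset (Fin A.1.card)), C.map (blockEmb A.1) = B := by
  obtain ⟨A, hA, hBA⟩ := exists_child hB hne
  obtain ⟨C, hC⟩ := exists_map_blockEmb hBA
  exact ⟨⟨A, hA⟩, C, hC⟩

theorem univ_notMem_rootPartition {T : IndexTree n} (h : Finset.univ ∈ T.inner) :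
    Finset.univ ∉ (T.rootPartition h).parts := fun h' => (mem_children.mp h').2.1 rfl

theorem univ_notMem_leaves {T : IndexTree n} (h : Finset.univ ∈ T.inner) :
    Finset.univ ∉ T.leaves := (Finset.mem_sdiff.mp h).2

/-- The leaves of a tree are the leaves of the subtrees below the children of the root. -/
def sigmaLeavesEquiv (T : IndexTree n) (h : Finset.univ ∈ T.inner) :
    (Σ A : Blocks (T.rootPartition h),
      Blocks (T.comap (blockEmb A.1) (child_mem_nodes h A)).leafPartition) ≃
        Blocks T.leafPartition :=
  Equiv.ofBijective (fun p => ⟨p.2.1.map (blockEmb p.1.1), mem_comap_leaves.mp p.2.2⟩) <| by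
    constructor
    · rintro ⟨A, C⟩ ⟨B, D⟩ e
      have e : C.1.map (blockEmb A.1) = D.1.map (blockEmb B.1) := congrArg Subtype.val e
      obtain rfl := block_eq_of_map (nonempty_of_mem _ (mem_leaves.mp C.2).1) e
      have := Subtype.ext (Finset.map_injective _ e)
      rw [this]
    · rintro ⟨B, hB⟩
      have hB' := mem_leaves.mp hB
      obtain ⟨A, C, rfl⟩ := exists_block_map h hB'.1 fun e => univ_notMem_leaves h (e ▸ hB)
      exact ⟨⟨A, ⟨C, mem_comap_leaves.mpr hB⟩⟩, rfl⟩

end IndexTree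

namespace DegTree

open IndexTree

variable (t : DegTree n) (h : Finset.univ ∈ t.tree.inner)

/-- The part of the tree below a child of the root. -/
def part (A : Blocks (t.tree.rootPartition h)) : DegTree A.1.card :=
  t.comap (blockEmb A.1) (child_mem_nodes h A)

theorem mem_part_nodes {A : Blocks (t.tree.rootPartition h)} {C : Finset (Fin A.1.card)} :
    C ∈ (t.part h A).tree.nodes ↔ C.map (blockEmb A.1) ∈ t.tree.nodes :=
  mem_comap_nodes (h := child_mem_nodes h A)

theorem mem_part_inner {A : Blocks (t.tree.rootPartition h)} {C : Finset (Fin A.1.card)} :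
    C ∈ (t.part h A).tree.inner ↔ C.map (blockEmb A.1) ∈ t.tree.inner :=
  mem_comap_inner (h := child_mem_nodes h A)

theorem mem_part_odd {A : Blocks (t.tree.rootPartition h)} {C : Finset (Fin A.1.card)} :
    C ∈ (t.part h A).odd ↔ C.map (blockEmb A.1) ∈ t.odd :=
  mem_comap_odd (h := child_mem_nodes h A)

theorem mem_part_symbols {A : Blocks (t.tree.rootPartition h)} {C : Finset (Fin A.1.card)} :
    C ∈ (t.part h A).symbols ↔ C.map (blockEmb A.1) ∈ t.symbols :=
  mem_comap_symbols (h := child_mem_nodes h A)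

theorem univ_notMem_odd {t : DegTree n} (h : Finset.univ ∈ t.tree.inner) :
    Finset.univ ∉ t.odd := fun h' =>
  univ_notMem_leaves h (t.odd_subset_leaves h')

/-- Every node other than the root lies below exactly one child, hence a set of nodes containing the
root is recovered from its traces on the parts. This serves both for the nodes and for the symbols.
-/
theorem eq_insert_unionBlocks {S : Finset (Finset (Fin n))} (hS : S ⊆ t.tree.nodes)
    (hu : Finset.univ ∈ S)
    (f : ∀ A : Blocks (t.tree.rootPartition h), Finset (Finset (Fin A.1.card)))
    (hf : ∀ A C, C ∈ f A ↔ C.map (blockEmb A.1) ∈ S) :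
    S = insert Finset.univ (unionBlocks f) := by
  ext B
  rw [Finset.mem_insert, mem_unionBlocks]
  constructor
  · intro hB
    by_cases hne : B = Finset.univ
    · exact Or.inl hne
    · obtain ⟨A, C, rfl⟩ := exists_block_map h (hS hB) hne
      exact Or.inr ⟨A, C, (hf A C).mpr hB, rfl⟩
  · rintro (rfl | ⟨A, C, hC, rfl⟩)
    · exact hu
    · exact (hf A C).mp hC

theorem nodes_eq :
    t.tree.nodes = insert Finset.univ (unionBlocks fun A => (t.part h A).tree.nodes) :=
  t.eq_insert_unionBlocks h subset_rfl t.tree.univ_mem _ fun _ _ => t.mem_part_nodes h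

theorem symbols_eq :
    t.symbols = insert Finset.univ (unionBlocks fun A => (t.part h A).symbols) :=
  t.eq_insert_unionBlocks h t.symbols_subset_nodes (Finset.mem_union_left _ h) _
    fun _ _ => t.mem_part_symbols h

theorem odd_eq : t.odd = unionBlocks fun A => (t.part h A).odd := by
  ext B
  rw [mem_unionBlocks]
  constructor
  · intro hB
    obtain ⟨A, C, rfl⟩ := exists_block_map h (mem_leaves.mp (t.odd_subset_leaves hB)).1
      fun e => univ_notMem_odd h (e ▸ hB)
    exact ⟨A, C, (t.mem_part_odd h).mpr hB, rfl⟩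
  · rintro ⟨A, C, hC, rfl⟩
    exact (t.mem_part_odd h).mp hC

theorem nonempty_of_mem_symbols {B : Finset (Fin n)} (hB : B ∈ t.symbols) : B.Nonempty :=
  nonempty_of_mem _ (t.symbols_subset_nodes hB)

theorem univ_notMem_unionBlocks {P : SetPartition n} (hP : Finset.univ ∉ P.parts)
    (f : ∀ A : Blocks P, Finset (Finset (Fin A.1.card))) : Finset.univ ∉ unionBlocks f := by
  rw [mem_unionBlocks]
  rintro ⟨A, C, -, e⟩
  have := map_blockEmb_subset A.1 C
  rw [e, Finset.univ_subset_iff] at this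
  exact block_ne_univ hP A this

theorem card_symbols : t.symbols.card = ∑ A, (t.part h A).symbols.card + 1 := by
  rw [t.symbols_eq h, Finset.card_insert_of_notMem
    (univ_notMem_unionBlocks (univ_notMem_rootPartition h) _),
    card_unionBlocks fun A C hC => (t.part h A).nonempty_of_mem_symbols hC]

/-- The root is the one symbol that belongs to no part. This is the combinatorial form of the shift
by one in the recursion. -/
theorem sum_degree_part : ∑ A, (t.part h A).degree = t.degree + 1 := by
  rw [degree_eq_card t, t.card_symbols h]
  simp only [degree_eq_card]
  push_cast
  rw [add_assoc, CharTwo.add_self_eq_zero, add_zero]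

end DegTree

theorem sum_card_blocks (P : SetPartition n) : ∑ A : Blocks P, A.1.card = n := by
  have := P.sum_card_parts
  rw [Finset.card_univ, Fintype.card_fin] at this
  exact (Finset.sum_coe_sort P.parts Finset.card).trans this

theorem block_card_pos {P : SetPartition n} (A : Blocks P) : 1 ≤ A.1.card :=
  Finset.card_pos.mpr (P.nonempty_of_mem_parts A.2)

theorem block_card_lt {P : SetPartition n} (hP : Finset.univ ∉ P.parts) (A : Blocks P) :
    A.1.card < n := by
  have : A.1.card < (Finset.univ : Finset (Fin n)).card :=
    Finset.card_lt_card (Finset.ssubset_univ_iff.mpr (block_ne_univ hP A))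
  simpa using this

theorem two_le_card_blocks {P : SetPartition n} (hn : 1 ≤ n) (hP : Finset.univ ∉ P.parts) :
    2 ≤ Fintype.card (Blocks P) := by
  by_contra hlt
  have hlt : Fintype.card (Blocks P) ≤ 1 := by omega
  have hsub := Fintype.card_le_one_iff_subsingleton.mp hlt
  have hs := sum_card_blocks P
  obtain ⟨A, hA, -⟩ := P.existsUnique_mem (Finset.mem_univ (⟨0, hn⟩ : Fin n))
  have := Fintype.sum_subsingleton (fun A : Blocks P => A.1.card) ⟨A, hA.1⟩
  have h2 := block_card_lt hP ⟨A, hA.1⟩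
  omega

/-- A tree of order `n ≥ 1` has fewer than `n` non-leaf nodes. -/
theorem IndexTree.card_inner_lt : ∀ (n : ℕ) (_ : 1 ≤ n) (T : IndexTree n), T.inner.card < n := by
  intro n
  induction n using Nat.strong_induction_on with
  | _ n ih =>
    intro hn T
    rcases T.inner.eq_empty_or_nonempty with h0 | hne
    · rw [h0]; exact hn
    · have h := univ_mem_inner hne
      -- With all leaf degrees zero the symbols are exactly the non-leaf nodes, so `card_symbols`
      -- counts the latter.
      let t : ∀ {m} (_ : IndexTree m), DegTree m := fun T => ⟨T, fun _ => 0⟩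
      have hsym : ∀ {m} (s : DegTree m), s.deg = (fun _ => 0) → s.symbols = s.tree.inner := by
        intro m s hs
        rw [DegTree.symbols, Finset.union_eq_left]
        intro B hB
        obtain ⟨_, h1⟩ := DegTree.mem_odd.mp hB
        rw [hs] at h1
        exact absurd h1 zero_ne_one
      have h1 : T.inner.card =
          ∑ A : Blocks (T.rootPartition h), ((t T).part h A).symbols.card + 1 :=
        (congrArg Finset.card (hsym (t T) rfl)).symm.trans ((t T).card_symbols h)
      have hP := univ_notMem_rootPartition h
      have h2 : ∀ A : Blocks (T.rootPartition h),
          ((t T).part h A).symbols.card + 1 ≤ A.1.card := by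
        intro A
        rw [hsym _ rfl]
        exact ih _ (block_card_lt hP A) (block_card_pos A) _
      -- A block `A` carries at most `|A| - 1` non-leaf nodes. Summing over at least two blocks and
      -- adding the root leaves at most `n - 1`.
      have h3 := Finset.sum_le_sum fun A (_ : A ∈ Finset.univ) => h2 A
      rw [sum_card_blocks, Finset.sum_add_distrib, Finset.sum_const, Finset.card_univ,
        smul_eq_mul, mul_one] at h3
      have h4 := two_le_card_blocks hn hP
      omega

namespace IndexTree

/-- The tree whose root has the blocks of `P` as children, with the trees `f A` below them. -/
def graft {P : SetPartition n} (hn : 1 ≤ n) (hP : Finset.univ ∉ P.parts)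
    (f : ∀ A : Blocks P, IndexTree A.1.card) : IndexTree n where
  nodes := insert Finset.univ (unionBlocks fun A => (f A).nodes)
  univ_mem := Finset.mem_insert_self _ _
  empty_notMem := by
    rw [Finset.mem_insert, mem_unionBlocks]
    rintro (h | ⟨A, C, hC, e⟩)
    · exact Finset.univ_nonempty_iff.mpr ⟨⟨0, hn⟩⟩ |>.ne_empty h.symm
    · rw [Finset.map_eq_empty] at e
      exact (f A).empty_notMem (e ▸ hC)
  laminar A hA B hB := by
    rw [Finset.mem_insert, mem_unionBlocks] at hA hB
    rcases hA with rfl | ⟨A, C, hC, rfl⟩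
    · exact Or.inr (Or.inl (Finset.subset_univ B))
    rcases hB with rfl | ⟨B, D, hD, rfl⟩
    · exact Or.inl (Finset.subset_univ _)
    by_cases hAB : A = B
    · subst hAB
      simpa using (f A).laminar C hC D hD
    · refine Or.inr (Or.inr (Finset.disjoint_left.mpr fun i hi hi' => hAB ?_))
      exact block_eq_of_mem (map_blockEmb_subset _ _ hi) (map_blockEmb_subset _ _ hi')
  eq_union A hA hex i hi := by
    rw [Finset.mem_insert, mem_unionBlocks] at hA
    rcases hA with rfl | ⟨A, C, hC, rfl⟩
    · obtain ⟨A, ⟨hA, hiA⟩, -⟩ := P.existsUnique_mem (Finset.mem_univ i)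
      refine ⟨A, Finset.mem_insert_of_mem (mem_unionBlocks.mpr
        ⟨⟨A, hA⟩, _, (f ⟨A, hA⟩).univ_mem, map_univ_blockEmb A⟩), ?_, hiA⟩
      exact Finset.ssubset_univ_iff.mpr fun e => hP (e ▸ hA)
    · obtain ⟨i, hi', rfl⟩ := Finset.mem_map.mp hi
      obtain ⟨B, hB, hBC⟩ := hex
      rw [Finset.mem_insert] at hB
      rcases hB with rfl | hB
      · exact absurd (Finset.subset_univ _) hBC.2
      obtain ⟨B, -, rfl⟩ := Finset.subset_map_iff.mp hBC.1
      have hBne : B.Nonempty := by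
        obtain ⟨A', D, hD, e⟩ := mem_unionBlocks.mp hB
        have := (nonempty_of_mem _ hD).map (f := blockEmb A'.1)
        rwa [e, Finset.map_nonempty] at this
      have hB := (map_mem_unionBlocks hBne).mp hB
      obtain ⟨D, hD, hDC, hiD⟩ := (f A).eq_union C hC
        ⟨B, hB, Finset.map_ssubset_map.mp hBC⟩ i hi'
      exact ⟨_, Finset.mem_insert_of_mem (mem_unionBlocks.mpr ⟨A, D, hD, rfl⟩),
        Finset.map_ssubset_map.mpr hDC, Finset.mem_map_of_mem _ hiD⟩

section

variable {P : SetPartition n} (hn : 1 ≤ n) (hP : Finset.univ ∉ P.parts)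
  (f : ∀ A : Blocks P, IndexTree A.1.card)

theorem block_mem_graft (A : Blocks P) : A.1 ∈ (graft hn hP f).nodes :=
  Finset.mem_insert_of_mem (mem_unionBlocks.mpr
    ⟨A, _, (f A).univ_mem, map_univ_blockEmb A.1⟩)

theorem univ_mem_inner_graft : Finset.univ ∈ (graft hn hP f).inner := by
  obtain ⟨A, ⟨hA, -⟩, -⟩ := P.existsUnique_mem (Finset.mem_univ (⟨0, hn⟩ : Fin n))
  exact mem_inner.mpr ⟨Finset.mem_insert_self _ _, A, block_mem_graft hn hP f ⟨A, hA⟩,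
    Finset.ssubset_univ_iff.mpr fun e => hP (e ▸ hA)⟩

/-- The blocks are nodes, and every node other than the root is contained in a block. Hence the
blocks are exactly the maximal nodes below the root. -/
theorem rootPartition_graft :
    (graft hn hP f).rootPartition (univ_mem_inner_graft hn hP f) = P := by
  apply Finpartition.ext
  rw [rootPartition_parts]
  have hsub : ∀ B ∈ (graft hn hP f).nodes, B ≠ Finset.univ → ∃ A : Blocks P, B ⊆ A.1 := by
    intro B hB hne
    rcases Finset.mem_insert.mp hB with rfl | hB
    · exact absurd rfl hne
    · obtain ⟨A, C, -, rfl⟩ := mem_unionBlocks.mp hB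
      exact ⟨A, map_blockEmb_subset _ _⟩
  have hmem : ∀ A ∈ P.parts, A ∈ (graft hn hP f).children := by
    intro A hA
    refine mem_children.mpr ⟨block_mem_graft hn hP f ⟨A, hA⟩, fun e => hP (e ▸ hA),
      fun B hB hAB => ?_⟩
    by_contra hne
    obtain ⟨A', hA'⟩ := hsub B hB hne
    obtain ⟨i, hi⟩ := P.nonempty_of_mem_parts hA
    have := congrArg Subtype.val (block_eq_of_mem (A := ⟨A, hA⟩) (B := A') hi (hA' (hAB.1 hi)))
    subst this
    exact hAB.2 hA'
  ext A
  refine ⟨fun hA => ?_, hmem A⟩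
  have hA' := mem_children.mp hA
  obtain ⟨B, hB⟩ := hsub A hA'.1 hA'.2.1
  obtain ⟨i, hi⟩ := nonempty_of_mem _ hA'.1
  rw [child_eq_of_mem hA (hmem B.1 B.2) hi (hB hi)]
  exact B.2

theorem map_mem_graft {A : Blocks P} {C : Finset (Fin A.1.card)} :
    C.map (blockEmb A.1) ∈ (graft hn hP f).nodes ↔ C ∈ (f A).nodes := by
  constructor
  · intro h
    have hC : C.Nonempty := by simpa using nonempty_of_mem _ h
    rcases Finset.mem_insert.mp h with h | h
    · have := map_blockEmb_subset A.1 C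
      rw [h, Finset.univ_subset_iff] at this
      exact absurd this (block_ne_univ hP A)
    · exact (map_mem_unionBlocks hC).mp h
  · intro h
    exact Finset.mem_insert_of_mem (mem_unionBlocks.mpr ⟨A, C, h, rfl⟩)

end

end IndexTree

namespace DegTree

open IndexTree

variable {P : SetPartition n} (hn : 1 ≤ n) (hP : Finset.univ ∉ P.parts)
  (f : ∀ A : Blocks P, DegTree A.1.card)

/-- Grafting trees with degrees for their leaves. -/
def graft : DegTree n where
  tree := IndexTree.graft hn hP fun A => (f A).tree
  -- The degrees are rebuilt from the set of odd leaves, which requires no choice of the block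
  -- containing `B`.
  deg B := if B.1 ∈ unionBlocks fun A => (f A).odd then 1 else 0

theorem map_mem_graft_leaves {A : Blocks P} {C : Finset (Fin A.1.card)} :
    C.map (blockEmb A.1) ∈ (graft hn hP f).tree.leaves ↔ C ∈ (f A).tree.leaves := by
  rw [mem_leaves, mem_leaves]
  refine and_congr (map_mem_graft hn hP _) ⟨fun h B hB hBC => ?_, fun h B hB hBC => ?_⟩
  · exact h _ ((map_mem_graft hn hP _).mpr hB) (Finset.map_ssubset_map.mpr hBC)
  · obtain ⟨B, -, rfl⟩ := Finset.subset_map_iff.mp hBC.1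
    exact h _ ((map_mem_graft hn hP _).mp hB) (Finset.map_ssubset_map.mp hBC)

theorem map_mem_graft_odd {A : Blocks P} {C : Finset (Fin A.1.card)} :
    C.map (blockEmb A.1) ∈ (graft hn hP f).odd ↔ C ∈ (f A).odd := by
  have key : ∀ hC : C ∈ (f A).tree.leaves,
      C.map (blockEmb A.1) ∈ unionBlocks (fun A => (f A).odd) ↔ C ∈ (f A).odd := fun hC =>
    map_mem_unionBlocks (nonempty_of_mem _ (mem_leaves.mp hC).1)
  rw [mem_odd]
  constructor
  · rintro ⟨h, h'⟩
    simp only [graft] at h'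
    split_ifs at h' with h1
    · exact (key ((map_mem_graft_leaves hn hP f).mp h)).mp h1
    · exact absurd h' (by decide)
  · intro h
    have hC := odd_subset_leaves _ h
    exact ⟨(map_mem_graft_leaves hn hP f).mpr hC, if_pos ((key hC).mpr h)⟩

/-- The block `A` is taken from the root partition of the grafted tree and reinterpreted through
`hA` as a block of `P`, with the same underlying set. Both sides then have the same type without
transport along `rootPartition_graft`. -/
theorem part_graft (h : Finset.univ ∈ (graft hn hP f).tree.inner)
    (A : Blocks ((graft hn hP f).tree.rootPartition h)) (hA : A.1 ∈ P.parts) :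
    (graft hn hP f).part h A = f ⟨A.1, hA⟩ := by
  refine DegTree.ext ?_ ?_
  · ext C
    exact ((graft hn hP f).mem_part_nodes h).trans
      (map_mem_graft hn hP (fun A => (f A).tree) (A := ⟨A.1, hA⟩))
  · ext C
    exact ((graft hn hP f).mem_part_odd h).trans (map_mem_graft_odd hn hP f (A := ⟨A.1, hA⟩))

end DegTree

/-! ### Trees with more than one node as grafted trees -/

/-- Set partitions with more than one block, with degrees for the blocks. -/
abbrev NodeIndex (n : ℕ) (e : ZMod 2) : Type :=
  Σ P : { P : SetPartition n // Finset.univ ∉ P.parts }, Σ p : Degrees P.1 e,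
    ∀ A : Blocks P.1, { s : DegTree A.1.card // s.degree = p.1 A }

/-- The degrees of the blocks are forced by the trees, so the partition and the trees determine
everything. Quantifying over subsets rather than over blocks keeps the comparison free of casts. -/
theorem NodeIndex.ext {e : ZMod 2} {s s' : NodeIndex n e} (h : s.1.1 = s'.1.1)
    (h' : ∀ (A : Finset (Fin n)) (hA : A ∈ s.1.1.parts) (hA' : A ∈ s'.1.1.parts),
      (s.2.2 ⟨A, hA⟩).1 = (s'.2.2 ⟨A, hA'⟩).1) : s = s' := by
  obtain ⟨⟨P, hP⟩, ⟨p, hp⟩, f⟩ := s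
  obtain ⟨⟨P', hP'⟩, ⟨p', hp'⟩, f'⟩ := s'
  obtain rfl : P = P' := h
  have hpp : p = p' := by
    funext A
    exact (f A).2.symm.trans ((congrArg DegTree.degree (h' A.1 A.2 A.2)).trans (f' A).2)
  subst hpp
  have hff : f = f' := funext fun A => Subtype.ext (h' A.1 A.2 A.2)
  rw [hff]

/-- The decomposition of a tree with more than one node at its root. -/
def DegTree.decompose {e : ZMod 2}
    (t : { t : DegTree n // t.degree = e ∧ Finset.univ ∈ t.tree.inner }) :
    NodeIndex n (e + ((1 : ℕ) : ZMod 2)) :=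
  ⟨⟨t.1.tree.rootPartition t.2.2, IndexTree.univ_notMem_rootPartition t.2.2⟩,
    ⟨fun A => (t.1.part t.2.2 A).degree, by rw [t.1.sum_degree_part, t.2.1, Nat.cast_one]⟩,
    fun A => ⟨t.1.part t.2.2 A, rfl⟩⟩

theorem DegTree.decompose_bijective (hn : 1 ≤ n) (e : ZMod 2) :
    Function.Bijective (DegTree.decompose (n := n) (e := e)) := by
  constructor
  · rintro ⟨t, ht, h⟩ ⟨t', ht', h'⟩ hs
    -- The right-hand sides depend only on the decomposition `s`, so generalizing over `s` lets `hs`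
    -- be used without rewriting in dependent types.
    have hnode : ∀ s : NodeIndex n (e + ((1 : ℕ) : ZMod 2)), decompose ⟨t, ht, h⟩ = s →
        t.tree.nodes = insert Finset.univ (unionBlocks fun A => (s.2.2 A).1.tree.nodes) ∧
          t.odd = unionBlocks fun A => (s.2.2 A).1.odd := by
      rintro _ rfl
      exact ⟨t.nodes_eq h, t.odd_eq h⟩
    obtain ⟨h1, h2⟩ := hnode _ hs
    apply Subtype.ext
    exact DegTree.ext (h1.trans (t'.nodes_eq h').symm) (h2.trans (t'.odd_eq h').symm)
  · rintro s
    have hroot := IndexTree.univ_mem_inner_graft hn s.1.2 fun A => (s.2.2 A).1.tree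
    have hP := IndexTree.rootPartition_graft hn s.1.2 fun A => (s.2.2 A).1.tree
    let t := DegTree.graft hn s.1.2 fun A => (s.2.2 A).1
    have hdeg : t.degree = e := by
      have h1 := t.sum_degree_part hroot
      have h2 : ∑ A, (t.part hroot A).degree = e + 1 := by
        rw [← Nat.cast_one, ← s.2.1.2]
        -- The identity on underlying subsets, between the blocks of two equal partitions.
        let E : Blocks (t.tree.rootPartition hroot) ≃ Blocks s.1.1 :=
          Equiv.subtypeEquivRight fun A => by
            rw [show t.tree.rootPartition hroot = s.1.1 from hP]
        refine Fintype.sum_equiv E _ _ fun A => ?_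
        rw [DegTree.part_graft hn s.1.2 _ hroot A (E A).2]
        exact (s.2.2 _).2
      exact add_right_cancel (h1.symm.trans h2)
    refine ⟨⟨t, hdeg, hroot⟩, NodeIndex.ext hP fun A hA hA' => ?_⟩
    exact DegTree.part_graft hn s.1.2 _ hroot ⟨A, hA⟩ hA'

end TreeDecomposition

/-! ### Maps between the values `F_A(x)` along injections of coordinates. -/

section PointEmbeddings

open AlgebraicGeometry CategoryTheory
open scoped Pointwise

variable {X : Over (Spec (CommRingCat.of ℂ))} {R S T : Type} [CommRing R] [CommRing S] [CommRing T]
  [Algebra ℂ R] [Algebra ℂ S] [Algebra ℂ T] {φ : R →ₐ[ℂ] S} {ψ : S →ₐ[ℂ] T}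
  {d : ℕ} {a : TorusAction d X} {m n l : ℕ}

variable (a) in
/-- Morphisms of points over `φ`, up to an injection of the sets of coordinates: an element
`t ∈ 𝕋(S)` and an injection `g` with `y_{g(i)} = t • φ(x_i)`. -/
structure PtEmb (φ : R →ₐ[ℂ] S) (x : Pt X m R) (y : Pt X n S) where
  t : Fin d → Sˣ
  emb : Fin m ↪ Fin n
  coord_emb : ∀ i, y (emb i) = a.smul t ((x i).map φ)

/-- A morphism of points as a morphism of points up to an injection. -/
def PtHom.toEmb {x : Pt X m R} {y : Pt X n S} (f : PtHom a φ x y) : PtEmb a φ x y where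
  t := f.t
  emb := f.perm.toEmbedding
  coord_emb := f.coord_perm

namespace PtEmb

/-- The bijection `[|A|] → [|B|]` induced by an injection `g` with `B = g(A)`. -/
def blockPerm (g : Fin m ↪ Fin n) {A : Finset (Fin m)} {B : Finset (Fin n)} (h : A.map g = B) :
    Fin A.card ≃ Fin B.card :=
  (A.orderIsoOfFin rfl).toEquiv.trans
    ((Equiv.ofBijective (fun i : A => (⟨g i.1, h ▸ Finset.mem_map_of_mem g i.2⟩ : B)) (by
      constructor
      · intro i j e
        exact Subtype.ext (g.injective (congrArg Subtype.val e))
      · rintro ⟨j, hj⟩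
        subst h
        obtain ⟨i, hi, rfl⟩ := Finset.mem_map.mp hj
        exact ⟨⟨i, hi⟩, rfl⟩)).trans (B.orderIsoOfFin rfl).symm.toEquiv)

theorem blockPerm_spec (g : Fin m ↪ Fin n) {A : Finset (Fin m)} {B : Finset (Fin n)}
    (h : A.map g = B) (i : Fin A.card) :
    B.orderEmbOfFin rfl (blockPerm g h i) = g (A.orderEmbOfFin rfl i) := by
  simp only [blockPerm, ← Finset.coe_orderIsoOfFin_apply, Equiv.trans_apply, RelIso.coe_fn_toEquiv,
    OrderIso.apply_symm_apply]
  rfl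

/-- The morphism between the points given by the coordinates in `A` and in `B = g(A)`. -/
def restrict {x : Pt X m R} {y : Pt X n S} (f : PtEmb a φ x y) {A : Finset (Fin m)}
    {B : Finset (Fin n)} (h : A.map f.emb = B) :
    PtHom a φ (Pt.restrict x A) (Pt.restrict y B) where
  t := f.t
  perm := blockPerm f.emb h
  coord_perm i := by
    change y (B.orderEmbOfFin rfl (blockPerm f.emb h i)) = _
    rw [blockPerm_spec]
    exact f.coord_emb _

variable (a) in
/-- The inclusion of the coordinates in `A`. -/
def ofBlock (x : Pt X n R) (A : Finset (Fin n)) :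
    PtEmb a (AlgHom.id ℂ R) (Pt.restrict x A) x where
  t := 1
  emb := blockEmb A
  coord_emb i := by rw [Points.map_id, a.one_smul]; rfl

variable (F : ∀ m, SuperSheaf a m)

/-- The map `F_A(x) → F_B(y)` for `B = g(A)`. -/
def blockMap {x : Pt X m R} {y : Pt X n S} (f : PtEmb a φ x y) {A : Finset (Fin m)}
    {B : Finset (Fin n)} (h : A.map f.emb = B) {p q : ZMod 2} (hpq : p = q) :
    BlockObj F A p x →ₛₗ[(φ : R →+* S)] BlockObj F B q y :=
  seqMap F hpq (f.restrict h)

/-- Composites of block maps depend only on the composite of the morphisms of points. -/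
theorem blockMap_blockMap {k : ℕ} {R' : Type} [CommRing R'] [Algebra ℂ R'] {φ' : R →ₐ[ℂ] R'}
    {ψ' : R' →ₐ[ℂ] T} (hψ : ψ.comp φ = ψ'.comp φ') {x : Pt X m R} {y : Pt X n S} {y' : Pt X k R'}
    {z : Pt X l T} (f : PtEmb a φ x y)
    (g : PtEmb a ψ y z) (f' : PtEmb a φ' x y') (g' : PtEmb a ψ' y' z)
    (ht : g.t * torusMap ψ f.t = g'.t * torusMap ψ' f'.t)
    (he : ∀ i, g.emb (f.emb i) = g'.emb (f'.emb i)) {A : Finset (Fin m)} {B : Finset (Fin n)}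
    {B' : Finset (Fin k)} {C : Finset (Fin l)} (hf : A.map f.emb = B) (hg : B.map g.emb = C)
    (hf' : A.map f'.emb = B') (hg' : B'.map g'.emb = C) {p q q' r : ZMod 2} (hpq : p = q)
    (hqr : q = r) (hpq' : p = q') (hqr' : q' = r) (v : BlockObj F A p x) :
    g.blockMap F hg hqr (f.blockMap F hf hpq v) =
      g'.blockMap F hg' hqr' (f'.blockMap F hf' hpq' v) := by
  -- The two composites lie over ring homomorphisms that are equal by `hψ` but not syntactically the
  -- same. It suffices to compare torus elements and permutations.
  have key : ∀ (θ θ' : R →ₐ[ℂ] T) (_ : θ = θ') (h : PtHom a θ (Pt.restrict x A) (Pt.restrict z C))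
      (h' : PtHom a θ' (Pt.restrict x A) (Pt.restrict z C)) (_ : h.t = h'.t) (_ : h.perm = h'.perm)
      (hpr : p = r), seqMap F hpr h v = seqMap F hpr h' v := by
    rintro θ _ rfl h h' h1 h2 hpr
    rw [PtHom.ext' h1 h2]
  refine (seqMap_comp F hpq hqr (hpq.trans hqr) (f.restrict hf) (g.restrict hg) v).symm.trans ?_
  refine Eq.trans ?_ (seqMap_comp F hpq' hqr' (hpq.trans hqr) (f'.restrict hf')
    (g'.restrict hg') v)
  refine key _ _ hψ _ _ ht (Equiv.ext fun i => ?_) _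
  apply (C.orderEmbOfFin rfl).injective
  change C.orderEmbOfFin rfl (blockPerm _ hg (blockPerm _ hf i)) =
    C.orderEmbOfFin rfl (blockPerm _ hg' (blockPerm _ hf' i))
  rw [blockPerm_spec, blockPerm_spec, blockPerm_spec, blockPerm_spec]
  exact he _

/-- Identifies the maps along injections with the block maps used to define the equivariant
structure on `F_𝔄`. -/
theorem restrict_toEmb {x : Pt X n R} {y : Pt X n S} (f : PtHom a φ x y) {A B : Finset (Fin n)}
    (h : A.map f.toEmb.emb = B) (h' : f.sigma • A = B) :
    f.toEmb.restrict h = f.restrict h' := by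
  refine PtHom.ext' rfl (Equiv.ext fun i => ?_)
  apply (B.orderEmbOfFin rfl).injective
  change B.orderEmbOfFin rfl (blockPerm _ h i) = B.orderEmbOfFin rfl (ShLog.blockPerm _ h' i)
  rw [blockPerm_spec, ShLog.blockPerm_spec]
  rfl

/-- The tensor product of the block maps along a bijection of the index sets. -/
def tensor {x : Pt X m R} {y : Pt X n S} (f : PtEmb a φ x y) {J J' : Type}
    {A : J → Finset (Fin m)} {p : J → ZMod 2} {B : J' → Finset (Fin n)} {q : J' → ZMod 2}
    (e : J ≃ J') (hA : ∀ j, (A (e.symm j)).map f.emb = B j) (hp : ∀ j, p (e.symm j) = q j) :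
    (⨂[R] j, BlockObj F (A j) (p j) x) →ₛₗ[(φ : R →+* S)] ⨂[S] j, BlockObj F (B j) (q j) y :=
  tensorMap e fun j => f.blockMap F (hA j) (hp j)

theorem tensor_tprod {x : Pt X m R} {y : Pt X n S} (f : PtEmb a φ x y) {J J' : Type}
    {A : J → Finset (Fin m)} {p : J → ZMod 2} {B : J' → Finset (Fin n)} {q : J' → ZMod 2}
    (e : J ≃ J') (hA : ∀ j, (A (e.symm j)).map f.emb = B j) (hp : ∀ j, p (e.symm j) = q j)
    (v : ∀ j, BlockObj F (A j) (p j) x) :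
    f.tensor F e hA hp (PiTensorProduct.tprod R v) =
      PiTensorProduct.tprod S fun j => f.blockMap F (hA j) (hp j) (v (e.symm j)) :=
  tensorMap_tprod (φ := (φ : R →+* S)) e _ v

/-- The morphism given by a bijection of the coordinates. -/
def _root_.ShLog.PtHom.ofPerm {x : Pt X m R} {y : Pt X n R} (e : Fin m ≃ Fin n)
    (h : ∀ i, y (e i) = x i) : PtHom a (AlgHom.id ℂ R) x y where
  t := 1
  perm := e
  coord_perm i := by rw [Points.map_id, a.one_smul, h]

/-- A bijection of the coordinates induces a linear isomorphism. -/
def _root_.ShLog.seqEquiv {x : Pt X m R} {y : Pt X n R} (e : Fin m ≃ Fin n)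
    (h : ∀ i, y (e i) = x i) {p q : ZMod 2} (hpq : p = q) : (F m p).obj x ≃ₗ[R] (F n q).obj y where
  toFun := seqMap F hpq (PtHom.ofPerm e h)
  map_add' := map_add _
  map_smul' := map_smul _
  invFun := seqMap F hpq.symm (PtHom.ofPerm e.symm fun i => by rw [← h, e.apply_symm_apply])
  left_inv v := by
    subst hpq
    refine (seqMap_comp F rfl rfl rfl _ _ v).symm.trans (Eq.trans ?_ (seqMap_id F x v))
    exact congrArg (fun k => seqMap F rfl k v) (PtHom.ext' (by
      change (1 : Fin d → Rˣ) * torusMap _ 1 = 1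
      rw [map_one, one_mul]) (Equiv.ext fun i => e.symm_apply_apply i))
  right_inv v := by
    subst hpq
    refine (seqMap_comp F rfl rfl rfl _ _ v).symm.trans (Eq.trans ?_ (seqMap_id F y v))
    exact congrArg (fun k => seqMap F rfl k v) (PtHom.ext' (by
      change (1 : Fin d → Rˣ) * torusMap _ 1 = 1
      rw [map_one, one_mul]) (Equiv.ext fun i => e.apply_symm_apply i))

/-- The isomorphism `F_C(x_A) ≅ F_B(x)` for `C ⊆ [|A|]` with image `B ⊆ A`. -/
def ofBlockEquiv (x : Pt X n R) (A : Finset (Fin n)) {C : Finset (Fin A.card)} {B : Finset (Fin n)}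
    (h : C.map (blockEmb A) = B) {p q : ZMod 2} (hpq : p = q) :
    BlockObj F C p (Pt.restrict x A) ≃ₗ[R] BlockObj F B q x :=
  seqEquiv F (blockPerm (blockEmb A) h) (fun i => congrArg x (blockPerm_spec _ h i)) hpq

end PtEmb

end PointEmbeddings

/-! ### Signs of relabellings of trees and the shuffle at the root. -/

section TreeSigns

open scoped Pointwise

variable {m n l : ℕ}

namespace DegTree

open IndexTree

/-- `t'` is the tree obtained from `t` by relabelling along `g`. -/
structure IsImage (g : Fin m ≃ Fin n) (t : DegTree m) (t' : DegTree n) : Prop where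
  nodes : ∀ C, C ∈ t.tree.nodes ↔ C.map g.toEmbedding ∈ t'.tree.nodes
  odd : ∀ C, C ∈ t.odd ↔ C.map g.toEmbedding ∈ t'.odd

theorem exists_map_eq (g : Fin m ≃ Fin n) (B : Finset (Fin n)) :
    ∃ C : Finset (Fin m), C.map g.toEmbedding = B :=
  ⟨B.map g.symm.toEmbedding, by ext; simp⟩

namespace IsImage

variable {g : Fin m ≃ Fin n} {t : DegTree m} {t' : DegTree n} (h : IsImage g t t')

include h

theorem exists_ssubset (C : Finset (Fin m)) :
    (∃ B ∈ t.tree.nodes, B ⊂ C) ↔ ∃ B ∈ t'.tree.nodes, B ⊂ C.map g.toEmbedding := by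
  constructor
  · rintro ⟨B, hB, hBC⟩
    exact ⟨_, (h.nodes B).mp hB, Finset.map_ssubset_map.mpr hBC⟩
  · rintro ⟨B, hB, hBC⟩
    obtain ⟨B, rfl⟩ := exists_map_eq g B
    exact ⟨B, (h.nodes B).mpr hB, Finset.map_ssubset_map.mp hBC⟩

theorem inner (C : Finset (Fin m)) :
    C ∈ t.tree.inner ↔ C.map g.toEmbedding ∈ t'.tree.inner := by
  rw [mem_inner, mem_inner, h.nodes, h.exists_ssubset]

theorem leaves (C : Finset (Fin m)) :
    C ∈ t.tree.leaves ↔ C.map g.toEmbedding ∈ t'.tree.leaves := by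
  have := h.exists_ssubset C
  rw [mem_leaves, mem_leaves, h.nodes]
  refine and_congr_right fun _ => ?_
  rw [← not_iff_not]
  push Not
  exact this

theorem symbols (C : Finset (Fin m)) :
    C ∈ t.symbols ↔ C.map g.toEmbedding ∈ t'.symbols := by
  rw [DegTree.symbols, DegTree.symbols, Finset.mem_union, Finset.mem_union, h.inner, h.odd]

theorem children (C : Finset (Fin m)) :
    C ∈ t.tree.children ↔ C.map g.toEmbedding ∈ t'.tree.children := by
  have hu : (Finset.univ : Finset (Fin n)) = Finset.univ.map g.toEmbedding := by ext; simp
  rw [mem_children, mem_children, h.nodes]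
  refine and_congr_right fun _ => and_congr ?_ ⟨fun h' B hB hCB => ?_, fun h' B hB hCB => ?_⟩
  · rw [hu, ne_eq, ne_eq, Finset.map_inj]
  · obtain ⟨B, rfl⟩ := exists_map_eq g B
    rw [h' B ((h.nodes B).mpr hB) (Finset.map_ssubset_map.mp hCB), hu]
  · have := h' _ ((h.nodes B).mp hB) (Finset.map_ssubset_map.mpr hCB)
    rwa [hu, Finset.map_inj] at this

theorem univ_mem_inner : Finset.univ ∈ t.tree.inner ↔ Finset.univ ∈ t'.tree.inner := by
  rw [h.inner]
  have hu : Finset.univ.map g.toEmbedding = (Finset.univ : Finset (Fin n)) := by ext; simp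
  rw [hu]

theorem symbols_eq :
    t'.symbols = t.symbols.map (Finset.mapEmbedding g.toEmbedding).toEmbedding := by
  ext B
  obtain ⟨C, rfl⟩ := exists_map_eq g B
  rw [← h.symbols]
  exact (Finset.mem_map' (Finset.mapEmbedding g.toEmbedding).toEmbedding).symm

omit h in
/-- The bijection between the leaves. -/
def leafEquiv (h : IsImage g t t') : Blocks t.tree.leafPartition ≃ Blocks t'.tree.leafPartition :=
  Equiv.ofBijective (fun C => ⟨C.1.map g.toEmbedding, (h.leaves C.1).mp C.2⟩) <| by
    constructor
    · intro C D e
      exact Subtype.ext (Finset.map_injective _ (congrArg Subtype.val e))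
    · rintro ⟨B, hB⟩
      obtain ⟨C, rfl⟩ := exists_map_eq g B
      exact ⟨⟨C, (h.leaves C).mpr hB⟩, rfl⟩

theorem map_leafEquiv_symm (B : Blocks t'.tree.leafPartition) :
    (h.leafEquiv.symm B).1.map g.toEmbedding = B.1 :=
  congrArg Subtype.val (h.leafEquiv.apply_symm_apply B)

theorem deg_leafEquiv (C : Blocks t.tree.leafPartition) : t.deg C = t'.deg (h.leafEquiv C) := by
  have := h.odd C.1
  rw [mem_odd, mem_odd] at this
  have h1 : t.deg C = 1 ↔ t'.deg (h.leafEquiv C) = 1 :=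
    ⟨fun e => (this.mp ⟨C.2, e⟩).2, fun e => (this.mpr ⟨(h.leafEquiv C).2, e⟩).2⟩
  generalize t.deg C = a at h1
  generalize t'.deg (h.leafEquiv C) = b at h1
  revert a b
  decide

theorem deg_leafEquiv_symm (B : Blocks t'.tree.leafPartition) :
    t.deg (h.leafEquiv.symm B) = t'.deg B := by
  rw [h.deg_leafEquiv, Equiv.apply_symm_apply]

end IsImage

/-- The sign of a relabelling: that of the permutation of the non-leaf nodes, times the Koszul sign
of the permutation of the leaves. -/
def symSign (g : Fin m ≃ Fin n) (t : DegTree m) : ℤ :=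
  relSign t.tree.inner binWeight (fun C => binWeight (C.map g.toEmbedding)) *
    relSign t.odd binWeight (fun C => binWeight (C.map g.toEmbedding))

/-- The order on symbols in which the non-leaf nodes precede the leaves. -/
def innerFirst (t : DegTree n) (B : Finset (Fin n)) : ℕ ×ₗ ℕ :=
  toLex (if B ∈ t.tree.inner then 0 else 1, binWeight B)

/-- The child of the root above a node. -/
def childAbove (t : DegTree n) (B : Finset (Fin n)) : Finset (Fin n) :=
  (t.tree.children.filter fun A => B ⊆ A).biUnion id

/-- The order on symbols in which the symbols below one child of the root are consecutive. -/
def byChild (t : DegTree n) (B : Finset (Fin n)) : ℕ ×ₗ (ℕ ×ₗ ℕ) :=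
  toLex (binWeight (t.childAbove B), t.innerFirst B)

/-- The sign of the shuffle that collects the symbols below each child of the root. -/
def rootSign (t : DegTree n) : ℤ :=
  relSign (t.symbols.erase Finset.univ) t.innerFirst t.byChild

theorem innerFirst_injective (t : DegTree n) : Function.Injective t.innerFirst := fun _ _ h =>
  binWeight_injective (congrArg (fun p => (ofLex p).2) h)

theorem byChild_injective (t : DegTree n) : Function.Injective t.byChild := fun _ _ h =>
  t.innerFirst_injective (congrArg (fun p => (ofLex p).2) h)

/-- Children of the root are disjoint, so the union defining `childAbove` has a single term when `B`
is nonempty. -/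
theorem childAbove_eq {t : DegTree n} {A B : Finset (Fin n)} (hA : A ∈ t.tree.children)
    (hB : B.Nonempty) (hBA : B ⊆ A) : t.childAbove B = A := by
  obtain ⟨i, hi⟩ := hB
  have : t.tree.children.filter (fun A => B ⊆ A) = {A} := by
    ext C
    rw [Finset.mem_filter, Finset.mem_singleton]
    constructor
    · rintro ⟨hC, hBC⟩
      exact child_eq_of_mem hC hA (hBC hi) (hBA hi)
    · rintro rfl
      exact ⟨hA, hBA⟩
  rw [childAbove, this, Finset.singleton_biUnion, id]

theorem IsImage.childAbove {g : Fin n ≃ Fin n} {t t' : DegTree n} (h : IsImage g t t')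
    (B : Finset (Fin n)) :
    t'.childAbove (B.map g.toEmbedding) = (t.childAbove B).map g.toEmbedding := by
  ext i
  simp only [DegTree.childAbove, Finset.mem_biUnion, Finset.mem_filter, id, Finset.mem_map]
  constructor
  · rintro ⟨A, ⟨hA, hBA⟩, hi⟩
    obtain ⟨A, rfl⟩ := exists_map_eq g A
    obtain ⟨j, hj, rfl⟩ := Finset.mem_map.mp hi
    exact ⟨j, ⟨A, ⟨(h.children A).mpr hA, Finset.map_subset_map.mp hBA⟩, hj⟩, rfl⟩
  · rintro ⟨j, ⟨A, ⟨hA, hBA⟩, hj⟩, rfl⟩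
    exact ⟨_, ⟨(h.children A).mp hA, Finset.map_subset_map.mpr hBA⟩, Finset.mem_map_of_mem _ hj⟩

/-- Relabelling preserves the two classes, non-leaf nodes and the rest, and their relative order. No
inversion occurs between the classes, and `relSign_lex` leaves the product of the signs inside them.
-/
theorem relSign_innerFirst {g : Fin n ≃ Fin n} {t t' : DegTree n} (h : IsImage g t t')
    (N : Finset (Finset (Fin n))) :
    relSign N t.innerFirst (fun B => t'.innerFirst (B.map g.toEmbedding)) =
      relSign (N.filter fun B => B ∈ t.tree.inner) binWeight
          (fun C => binWeight (C.map g.toEmbedding)) *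
        relSign (N.filter fun B => B ∉ t.tree.inner) binWeight
          (fun C => binWeight (C.map g.toEmbedding)) := by
  let k : Finset (Fin n) → ℕ := fun B => if B ∈ t.tree.inner then 0 else 1
  have h1 : (fun B => t'.innerFirst (B.map g.toEmbedding)) =
      fun B => toLex (id (k B), binWeight (B.map g.toEmbedding)) := by
    funext B
    simp only [innerFirst, ← h.inner, id, k]
  have h2 : t.innerFirst = fun B => toLex (id (k B), binWeight B) := rfl
  have hk : ∀ B ∈ N, k B ∈ ({0, 1} : Finset ℕ) := fun B _ => by
    simp only [k]
    split_ifs <;> simp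
  rw [h1, h2, relSign_lex k hk (Set.injOn_id _) (Set.injOn_id _),
    relSign_eq_one fun _ _ _ _ h => not_lt_of_gt h, one_mul, Finset.prod_pair zero_ne_one]
  congr 2
  · ext B; simp [k]
  · ext B; simp [k]

/-- The set `[n]` is the largest in the binary order and is fixed by `g`, so it belongs to no
inversion. -/
theorem relSign_erase_univ (g : Fin n ≃ Fin n) (N : Finset (Finset (Fin n))) :
    relSign (N.erase Finset.univ) binWeight (fun C => binWeight (C.map g.toEmbedding)) =
      relSign N binWeight (fun C => binWeight (C.map g.toEmbedding)) := by
  refine Finset.prod_subset (Finset.filter_subset_filter _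
    (Finset.product_subset_product (Finset.erase_subset _ _) (Finset.erase_subset _ _))) ?_
  have hu : ∀ B : Finset (Fin n), binWeight B ≤ binWeight (Finset.univ : Finset (Fin n)) := fun B =>
    Finset.sum_le_sum_of_subset (Finset.subset_univ B)
  have hg : Finset.univ.map g.toEmbedding = (Finset.univ : Finset (Fin n)) := by ext; simp
  rintro ⟨B, C⟩ h h'
  simp only [Finset.mem_filter, Finset.mem_product, Finset.mem_erase] at h h'
  apply if_neg
  intro hlt
  dsimp only at hlt
  by_cases hB : B = Finset.univ
  · subst hB
    exact absurd h.2 (not_lt.mpr (hu C))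
  · by_cases hC : C = Finset.univ
    · subst hC
      rw [hg] at hlt
      exact absurd hlt (not_lt.mpr (hu _))
    · exact h' ⟨⟨⟨hB, h.1.1⟩, hC, h.1.2⟩, h.2⟩

/-- The maps `i_A` and `i_B` are increasing, hence preserve the binary order. The sign of `g` on
subsets of `A` is therefore that of the induced bijection `τ`. -/
theorem relSign_map_blockEmb {A B : Finset (Fin n)} {g : Fin n ≃ Fin n}
    {τ : Fin A.card ≃ Fin B.card} (hτ : ∀ i, blockEmb B (τ i) = g (blockEmb A i))
    (N : Finset (Finset (Fin A.card))) :
    relSign (N.map (Finset.mapEmbedding (blockEmb A)).toEmbedding) binWeight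
        (fun C => binWeight (C.map g.toEmbedding)) =
      relSign N binWeight (fun C => binWeight (C.map τ.toEmbedding)) := by
  rw [relSign_map]
  refine relSign_congr (fun C _ D _ => binWeight_map_lt_iff (A.orderEmbOfFin rfl))
    fun C _ D _ => ?_
  have key : ∀ C : Finset (Fin A.card), (C.map (blockEmb A)).map g.toEmbedding =
      (C.map τ.toEmbedding).map (blockEmb B) := by
    intro C
    rw [Finset.map_map, Finset.map_map]
    congr 1
    ext i
    exact congrArg _ (hτ i).symm
  change binWeight ((C.map (blockEmb A)).map g.toEmbedding) <
    binWeight ((D.map (blockEmb A)).map g.toEmbedding) ↔ _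
  rw [key, key]
  exact binWeight_map_lt_iff (B.orderEmbOfFin rfl)

/-- Compatibility of the shuffle signs with relabelling. -/
theorem rootSign_mul {g : Fin n ≃ Fin n} {t t' : DegTree n} (h : IsImage g t t')
    (ht : Finset.univ ∈ t.tree.inner) (τ : ∀ A : Blocks (t.tree.rootPartition ht),
      Σ B : Finset (Fin n), Fin A.1.card ≃ Fin B.card)
    (hτ : ∀ A i, blockEmb (τ A).1 ((τ A).2 i) = g (blockEmb A.1 i)) :
    t'.rootSign * (relSign (oddBlocks fun A => (t.part ht A).degree) binWeight
      (fun C => binWeight (C.map g.toEmbedding)) * ∏ A, symSign (τ A).2 (t.part ht A)) =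
      symSign g t * t.rootSign := by
  have hne : ∀ B ∈ t.symbols.erase Finset.univ,
      ∃ (A : Blocks (t.tree.rootPartition ht)) (C : Finset (Fin A.1.card)),
        C ∈ (t.part ht A).symbols ∧ C.map (blockEmb A.1) = B := by
    intro B hB
    obtain ⟨hBu, hB⟩ := Finset.mem_erase.mp hB
    obtain ⟨A, C, rfl⟩ := exists_block_map ht (t.symbols_subset_nodes hB) hBu
    exact ⟨A, C, (t.mem_part_symbols ht).mpr hB, rfl⟩
  have hchild : ∀ (A : Blocks (t.tree.rootPartition ht)) (C : Finset (Fin A.1.card)),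
      C ∈ (t.part ht A).symbols → t.childAbove (C.map (blockEmb A.1)) = A.1 := fun A C hC =>
    childAbove_eq A.2 (((t.part ht A).nonempty_of_mem_symbols hC).map) (map_blockEmb_subset _ _)
  -- The fibers of `childAbove` on the symbols other than the root are the symbols of the parts.
  have hfib : ∀ A : Blocks (t.tree.rootPartition ht),
      (t.symbols.erase Finset.univ).filter (fun B => t.childAbove B = A.1) =
        (t.part ht A).symbols.map (Finset.mapEmbedding (blockEmb A.1)).toEmbedding := by
    intro A
    ext B
    rw [Finset.mem_filter, Finset.mem_map]
    constructor
    · rintro ⟨hB, e⟩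
      obtain ⟨A', C, hC, rfl⟩ := hne B hB
      obtain rfl : A' = A := Subtype.ext ((hchild A' C hC).symm.trans e)
      exact ⟨C, hC, rfl⟩
    · rintro ⟨C, hC, rfl⟩
      refine ⟨Finset.mem_erase.mpr ⟨fun e => ?_, (t.mem_part_symbols ht).mp hC⟩, hchild A C hC⟩
      have := map_blockEmb_subset A.1 C
      change C.map (blockEmb A.1) = _ at e
      rw [e, Finset.univ_subset_iff] at this
      exact block_ne_univ (univ_notMem_rootPartition ht) A this
  set N := t.symbols.erase Finset.univ with hN
  have hN' : t'.symbols.erase Finset.univ =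
      N.map (Finset.mapEmbedding g.toEmbedding).toEmbedding := by
    rw [hN, Finset.map_erase, ← h.symbols_eq]
    congr 1
    ext i
    simp
  -- The two orders on the symbols of `t'`, pulled back along `g`. All four orders now live on the
  -- same set `N`.
  let a' : Finset (Fin n) → ℕ ×ₗ ℕ := fun B => t'.innerFirst (B.map g.toEmbedding)
  let b' : Finset (Fin n) → ℕ ×ₗ (ℕ ×ₗ ℕ) := fun B => t'.byChild (B.map g.toEmbedding)
  have ha' : Function.Injective a' := fun _ _ e =>
    Finset.map_injective _ (t'.innerFirst_injective e)
  have hb' : Function.Injective b' := fun _ _ e =>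
    Finset.map_injective _ (t'.byChild_injective e)
  have h1 : t'.rootSign = relSign N a' b' := by
    rw [rootSign, hN', relSign_map]
    rfl
  have h2 : relSign N t.innerFirst a' = symSign g t := by
    rw [relSign_innerFirst h, symSign, ← relSign_erase_univ g t.tree.inner]
    congr 2
    · ext B
      simp only [hN, Finset.mem_filter, Finset.mem_erase, symbols, Finset.mem_union]
      tauto
    · ext B
      have hd : B ∈ t.odd → B ∉ t.tree.inner := fun h1 h2 =>
        Finset.disjoint_left.mp t.disjoint_inner_odd h2 h1
      have hu : B ∈ t.odd → B ≠ Finset.univ := fun h1 h2 => univ_notMem_odd ht (h2 ▸ h1)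
      simp only [hN, Finset.mem_filter, Finset.mem_erase, symbols, Finset.mem_union]
      tauto
  -- Both orders are lexicographic over the child of the root, so the sign splits into the sign on
  -- the children with an odd number of symbols and the signs inside the parts.
  have h3 : relSign N t.byChild b' =
      relSign (oddBlocks fun A => (t.part ht A).degree) binWeight
        (fun C => binWeight (C.map g.toEmbedding)) * ∏ A, symSign (τ A).2 (t.part ht A) := by
    have hb : b' = fun B => toLex ((fun A => binWeight (A.map g.toEmbedding)) (t.childAbove B),
        a' B) := by
      funext B
      simp only [b', byChild, h.childAbove, a']
    have hmem : ∀ B ∈ N, t.childAbove B ∈ t.tree.children := by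
      intro B hB
      obtain ⟨A, C, hC, rfl⟩ := hne B hB
      rw [hchild A C hC]
      exact A.2
    rw [hb]
    refine (relSign_lex t.childAbove hmem binWeight_injective.injOn
      (fun A _ B _ e => Finset.map_injective _ (binWeight_injective e)) t.innerFirst a').trans ?_
    congr 1
    · congr 1
      ext A
      simp only [oddBlocks, Finset.mem_filter, Finset.mem_map, Finset.mem_univ, true_and,
        Function.Embedding.subtype_apply]
      have key : ∀ A : Blocks (t.tree.rootPartition ht),
          Odd (N.filter fun B => t.childAbove B = A.1).card ↔ (t.part ht A).degree = 1 := by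
        intro A
        rw [hfib, Finset.card_map, degree_eq_card, ZMod.natCast_eq_one_iff_odd]
      constructor
      · rintro ⟨hA, h'⟩
        exact ⟨⟨A, hA⟩, (key ⟨A, hA⟩).mp h', rfl⟩
      · rintro ⟨A, h', rfl⟩
        exact ⟨A.2, (key A).mpr h'⟩
    · rw [← rootPartition_parts t.tree ht, ← Finset.prod_coe_sort]
      refine Finset.prod_congr rfl fun A _ => ?_
      rw [hfib A, relSign_innerFirst h, symSign, ← relSign_map_blockEmb (hτ A),
        ← relSign_map_blockEmb (hτ A)]
      congr 2
      · ext B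
        simp only [Finset.mem_filter, Finset.mem_map, symbols, Finset.mem_union]
        constructor
        · rintro ⟨⟨C, hC, rfl⟩, hB⟩
          exact ⟨C, (t.mem_part_inner ht).mpr hB, rfl⟩
        · rintro ⟨C, hC, rfl⟩
          exact ⟨⟨C, Or.inl hC, rfl⟩, (t.mem_part_inner ht).mp hC⟩
      · ext B
        simp only [Finset.mem_filter, Finset.mem_map, symbols, Finset.mem_union]
        constructor
        · rintro ⟨⟨C, hC | hC, rfl⟩, hB⟩
          · exact absurd ((t.mem_part_inner ht).mp hC) hB
          · exact ⟨C, hC, rfl⟩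
        · rintro ⟨C, hC, rfl⟩
          exact ⟨⟨C, Or.inr hC, rfl⟩, fun h' => Finset.disjoint_left.mp t.disjoint_inner_odd h'
            ((t.mem_part_odd ht).mp hC)⟩
  rw [← h2, ← h3, h1]
  -- The sign from `t.innerFirst` to `b'` is computed through `t.byChild` and through `a'`. As all
  -- signs square to one, the equality of the two products rearranges to the claim.
  have e1 := relSign_trans (N := N) t.innerFirst_injective.injOn t.byChild_injective.injOn
    hb'.injOn
  have e2 := relSign_trans (N := N) t.innerFirst_injective.injOn ha'.injOn hb'.injOn
  have q1 := relSign_mul_self N a' b'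
  have q2 := relSign_mul_self N t.innerFirst t.byChild
  have e3 := e1.trans e2.symm
  change relSign N a' b' * relSign N t.byChild b' =
    relSign N t.innerFirst a' * relSign N t.innerFirst t.byChild
  generalize relSign N a' b' = w at *
  generalize relSign N t.innerFirst t.byChild = z at *
  linear_combination (w * z) * e3 + (-w * relSign N t.byChild b') * q2 +
    z * relSign N t.innerFirst a' * q1

end DegTree

end TreeSigns

/-! ### Decompositions of a sheaf indexed by trees. -/

section TreeDecomp

open AlgebraicGeometry CategoryTheory
open scoped Pointwise

variable {X : Over (Spec (CommRingCat.of ℂ))} {R S T : Type} [CommRing R] [CommRing S] [CommRing T]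
  [Algebra ℂ R] [Algebra ℂ S] [Algebra ℂ T] {φ : R →ₐ[ℂ] S} {ψ : S →ₐ[ℂ] T}
  {d : ℕ} {a : TorusAction d X} {m n l : ℕ}

/-- The tensor product of the sheaves of `F` over the leaves of the tree `t`. -/
abbrev LeafTensor (F : ∀ m, SuperSheaf a m) (t : DegTree n) (x : Pt X n R) : Type :=
  BlockTensor F t.tree.leafPartition t.deg x

/-- The map between tensor products over the leaves induced by a relabelling, without signs. -/
def leafTensorMap (F : ∀ m, SuperSheaf a m) {x : Pt X m R} {y : Pt X n S} (f : PtHom a φ x y)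
    {t : DegTree m} {t' : DegTree n} (h : DegTree.IsImage f.perm t t') :
    LeafTensor F t x →ₛₗ[(φ : R →+* S)] LeafTensor F t' y :=
  f.toEmb.tensor F (A := Subtype.val) (B := Subtype.val) h.leafEquiv h.map_leafEquiv_symm
    h.deg_leafEquiv_symm

theorem leafTensorMap_tprod (F : ∀ m, SuperSheaf a m) {x : Pt X m R} {y : Pt X n S}
    (f : PtHom a φ x y) {t : DegTree m} {t' : DegTree n} (h : DegTree.IsImage f.perm t t')
    (v : ∀ B : Blocks t.tree.leafPartition, BlockObj F B.1 (t.deg B) x) :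
    leafTensorMap F f h (PiTensorProduct.tprod R v) =
      PiTensorProduct.tprod S fun B : Blocks t'.tree.leafPartition =>
        f.toEmb.blockMap F (h.map_leafEquiv_symm B) (h.deg_leafEquiv_symm B)
          (v (h.leafEquiv.symm B)) :=
  PtEmb.tensor_tprod F f.toEmb h.leafEquiv h.map_leafEquiv_symm h.deg_leafEquiv_symm v

/-- A decomposition of a graded sheaf on `[X^n / S_n]` as the direct sum of the sheaves
`F_T[k]`, for `T` an index tree of order `n` with `k` non-leaf nodes. -/
structure TreeDecomp (F : ∀ m, SuperSheaf a m) (G : SuperSheaf a n) where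
  proj (t : DegTree n) {e : ZMod 2} (ht : t.degree = e) {R : Type} [CommRing R] [Algebra ℂ R]
    (x : Pt X n R) : (G e).obj x →ₗ[R] LeafTensor F t x
  natural {R S : Type} [CommRing R] [Algebra ℂ R] [CommRing S] [Algebra ℂ S] {φ : R →ₐ[ℂ] S}
    {x : Pt X n R} {y : Pt X n S} (f : PtHom a φ x y) {t t' : DegTree n}
    (h : DegTree.IsImage f.perm t t') {e : ZMod 2} (ht : t.degree = e) (ht' : t'.degree = e)
    (v : (G e).obj x) : proj t' ht' y ((G e).map f v) =
      DegTree.symSign f.perm t • leafTensorMap F f h (proj t ht x v)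
  bijective (e : ZMod 2) {R : Type} [CommRing R] [Algebra ℂ R] (x : Pt X n R) :
    Function.Bijective fun (v : (G e).obj x) (t : { t : DegTree n // t.degree = e }) =>
      proj t.1 t.2 x v

variable {F : ∀ m, SuperSheaf a m} {K : ∀ m, SuperSheaf a m}

/-- A block and its image have sizes that are equal only propositionally; this is naturality in the
form needed for `blockMap`. -/
theorem TreeDecomp.natural_seqMap (D : ∀ m, 1 ≤ m → m < n → TreeDecomp F (K m))
    {x : Pt X m R} {y : Pt X l S} (f : PtHom a φ x y) {t : DegTree m} {t' : DegTree l}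
    (h : DegTree.IsImage f.perm t t') {p q : ZMod 2} (hpq : p = q) (ht : t.degree = p)
    (ht' : t'.degree = q) (hm : 1 ≤ m) (hm' : m < n) (hl : 1 ≤ l) (hl' : l < n)
    (v : (K m p).obj x) : (D l hl hl').proj t' ht' y (seqMap K hpq f v) =
      DegTree.symSign f.perm t • leafTensorMap F f h ((D m hm hm').proj t ht x v) := by
  have hml : m = l := Fin.equiv_iff_eq.mp ⟨f.perm⟩
  subst hml
  subst hpq
  exact (D m hm hm').natural f h ht ht' v

/-! ### Assembling the tensor products over the leaves below the children of the root -/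

section Assemble

open IndexTree

variable (F) (t : DegTree n) (h : Finset.univ ∈ t.tree.inner)

/-- The leaves of a tree are the leaves of its parts below the children of the root. -/
def DegTree.sigmaLeavesEquiv :
    (Σ A : Blocks (t.tree.rootPartition h), Blocks (t.part h A).tree.leafPartition) ≃
      Blocks t.tree.leafPartition :=
  t.tree.sigmaLeavesEquiv h

theorem DegTree.map_sigmaLeavesEquiv_symm (B : Blocks t.tree.leafPartition) :
    ((t.sigmaLeavesEquiv h).symm B).2.1.map
      (blockEmb ((t.sigmaLeavesEquiv h).symm B).1.1) = B.1 :=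
  congrArg Subtype.val ((t.sigmaLeavesEquiv h).apply_symm_apply B)

theorem DegTree.deg_sigmaLeavesEquiv_symm (B : Blocks t.tree.leafPartition) :
    (t.part h ((t.sigmaLeavesEquiv h).symm B).1).deg
      ((t.sigmaLeavesEquiv h).symm B).2 = t.deg B :=
  congrArg t.deg ((t.sigmaLeavesEquiv h).apply_symm_apply B)

/-- The tensor product over all leaves is the tensor product, over the children of the root, of the
tensor products over the leaves below them. -/
def assemble (x : Pt X n R) :
    (⨂[R] A : Blocks (t.tree.rootPartition h), LeafTensor F (t.part h A) (Pt.restrict x A.1)) ≃ₗ[R]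
      LeafTensor F t x :=
  (nestedEquivSigma (M := fun (A : Blocks (t.tree.rootPartition h))
      (C : Blocks (t.part h A).tree.leafPartition) =>
        BlockObj F C.1 ((t.part h A).deg C) (Pt.restrict x A.1))).trans <|
    (PiTensorProduct.reindex R _ (t.sigmaLeavesEquiv h)).trans <|
      PiTensorProduct.congr fun B => PtEmb.ofBlockEquiv F x _ (t.map_sigmaLeavesEquiv_symm h B)
        (t.deg_sigmaLeavesEquiv_symm h B)

theorem assemble_tprod (x : Pt X n R) (v : ∀ (A : Blocks (t.tree.rootPartition h))
    (C : Blocks (t.part h A).tree.leafPartition),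
      BlockObj F C.1 ((t.part h A).deg C) (Pt.restrict x A.1)) :
    assemble F t h x (PiTensorProduct.tprod R fun A => PiTensorProduct.tprod R (v A)) =
      PiTensorProduct.tprod R fun B : Blocks t.tree.leafPartition =>
        (PtEmb.ofBlock a x ((t.sigmaLeavesEquiv h).symm B).1.1).blockMap F
          (t.map_sigmaLeavesEquiv_symm h B) (t.deg_sigmaLeavesEquiv_symm h B)
          (v ((t.sigmaLeavesEquiv h).symm B).1 ((t.sigmaLeavesEquiv h).symm B).2) := by
  rw [assemble, LinearEquiv.trans_apply, LinearEquiv.trans_apply, nestedEquivSigma_tprod,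
    PiTensorProduct.reindex_tprod]
  exact PiTensorProduct.congr_tprod _ _

variable {t} {t' : DegTree n} (h' : Finset.univ ∈ t'.tree.inner)

theorem map_restrict_perm {x : Pt X n R} {y : Pt X n S} (f : PtHom a φ x y)
    {A B : Finset (Fin n)} (hAB : f.sigma • A = B) (C : Finset (Fin A.card)) :
    (C.map (f.restrict hAB).perm.toEmbedding).map (blockEmb B) =
      (C.map (blockEmb A)).map f.perm.toEmbedding := by
  rw [Finset.map_map, Finset.map_map]
  congr 1
  ext i
  exact congrArg Fin.val (ShLog.blockPerm_spec f.sigma hAB i)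

/-- Relabelling a tree relabels the parts below the children of the root. -/
theorem DegTree.IsImage.part {x : Pt X n R} {y : Pt X n S} {f : PtHom a φ x y}
    (hf : IsImage f.perm t t') {A : Blocks (t.tree.rootPartition h)}
    {B : Blocks (t'.tree.rootPartition h')} (hAB : f.sigma • A.1 = B.1) :
    IsImage (f.restrict hAB).perm (t.part h A) (t'.part h' B) := by
  constructor
  · intro C
    rw [t.mem_part_nodes h, t'.mem_part_nodes h', map_restrict_perm, hf.nodes]
  · intro C
    rw [t.mem_part_odd h, t'.mem_part_odd h', map_restrict_perm, hf.odd]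

/-- Assembling commutes with relabelling. -/
theorem assemble_natural {x : Pt X n R} {y : Pt X n S} (f : PtHom a φ x y)
    (hf : DegTree.IsImage f.perm t t')
    (hP : f.sigma • t.tree.rootPartition h = t'.tree.rootPartition h')
    (w : ∀ A : Blocks (t.tree.rootPartition h), LeafTensor F (t.part h A) (Pt.restrict x A.1)) :
    assemble F t' h' y (PiTensorProduct.tprod S fun B =>
      leafTensorMap F (f.restrict (smul_blockEquiv_symm f.sigma hP B)) (hf.part h h' _)
        (w ((blockEquiv f.sigma hP).symm B))) =
      leafTensorMap F f hf (assemble F t h x (PiTensorProduct.tprod R w)) := by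
  -- Both sides are semilinear in `tprod R w`, so it is enough to compare `g₁` and `g₂` on iterated
  -- pure tensors.
  let g₁ : (⨂[R] A : Blocks (t.tree.rootPartition h),
      LeafTensor F (t.part h A) (Pt.restrict x A.1)) →ₛₗ[(φ : R →+* S)] LeafTensor F t' y :=
    (assemble F t' h' y).toLinearMap.comp (tensorMap (blockEquiv f.sigma hP) fun B =>
      leafTensorMap F (f.restrict (smul_blockEquiv_symm f.sigma hP B)) (hf.part h h' _))
  let g₂ : (⨂[R] A : Blocks (t.tree.rootPartition h),
      LeafTensor F (t.part h A) (Pt.restrict x A.1)) →ₛₗ[(φ : R →+* S)] LeafTensor F t' y :=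
    (leafTensorMap F f hf).comp (assemble F t h x).toLinearMap
  have h₁ : ∀ w : ∀ A : Blocks (t.tree.rootPartition h),
      LeafTensor F (t.part h A) (Pt.restrict x A.1), g₁ (PiTensorProduct.tprod R w) =
      assemble F t' h' y (PiTensorProduct.tprod S fun B =>
        leafTensorMap F (f.restrict (smul_blockEquiv_symm f.sigma hP B)) (hf.part h h' _)
          (w ((blockEquiv f.sigma hP).symm B))) := fun w =>
    congrArg (assemble F t' h' y)
      (tensorMap_tprod (φ := (φ : R →+* S)) (blockEquiv f.sigma hP) _ w)
  rw [← h₁]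
  refine nested_semilinear_ext (M := fun (A : Blocks (t.tree.rootPartition h))
    (C : Blocks (t.part h A).tree.leafPartition) =>
        BlockObj F C.1 ((t.part h A).deg C) (Pt.restrict x A.1)) g₁ g₂ (fun v => ?_) _
  rw [h₁]
  simp only [leafTensorMap_tprod]
  refine (assemble_tprod F t' h' y fun B C => _).trans ?_
  refine Eq.trans ?_ (congrArg (leafTensorMap F f hf) (assemble_tprod F t h x v)).symm
  rw [leafTensorMap_tprod]
  congr 1
  funext B
  -- The leaf of `t` corresponding to `B` can be found by relabelling inside a part or in the whole
  -- tree. Both answers have image `B` under the injective relabelling.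
  have hs : (⟨(blockEquiv f.sigma hP).symm ((t'.sigmaLeavesEquiv h').symm B).1,
      (hf.part h h' (smul_blockEquiv_symm f.sigma hP _)).leafEquiv.symm
        ((t'.sigmaLeavesEquiv h').symm B).2⟩ : Σ A : Blocks (t.tree.rootPartition h),
          Blocks (t.part h A).tree.leafPartition) =
      (t.sigmaLeavesEquiv h).symm (hf.leafEquiv.symm B) := by
    apply (t.sigmaLeavesEquiv h).injective
    rw [Equiv.apply_symm_apply]
    apply Subtype.ext
    apply Finset.map_injective f.perm.toEmbedding
    refine Eq.trans ?_ (hf.map_leafEquiv_symm B).symm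
    refine (map_restrict_perm f (smul_blockEquiv_symm f.sigma hP _) _).symm.trans ?_
    refine Eq.trans ?_ (t'.map_sigmaLeavesEquiv_symm h' B)
    exact congrArg (Finset.map _) ((hf.part h h' _).map_leafEquiv_symm _)
  -- Stating the comparison for variables `s = s'` replaces casts by a substitution. What remains is
  -- that restricting to a block commutes with `f`.
  have key : ∀ (s s' : Σ A : Blocks (t.tree.rootPartition h),
          Blocks (t.part h A).tree.leafPartition) (_ : s = s')
      (B' : Blocks (t'.tree.rootPartition h')) (C' : Finset (Fin B'.1.card)) (D : Finset (Fin n))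
      (p₁ p₂ : ZMod 2) (hB : f.sigma • s.1.1 = B'.1)
      (h₁ : C'.map (PtEmb.ofBlock a y B'.1).emb = B.1) (h₂ : p₁ = t'.deg B)
      (h₃ : s.2.1.map (f.restrict hB).toEmb.emb = C') (h₄ : (t.part h s.1).deg s.2 = p₁)
      (h₅ : D.map f.toEmb.emb = B.1) (h₆ : p₂ = t'.deg B)
      (h₇ : s'.2.1.map (PtEmb.ofBlock a x s'.1.1).emb = D)
      (h₈ : (t.part h s'.1).deg s'.2 = p₂),
      (PtEmb.ofBlock a y B'.1).blockMap F h₁ h₂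
        ((f.restrict hB).toEmb.blockMap F h₃ h₄ (v s.1 s.2)) =
      f.toEmb.blockMap F h₅ h₆
        ((PtEmb.ofBlock a x s'.1.1).blockMap F h₇ h₈ (v s'.1 s'.2)) := by
    rintro s _ rfl B' C' D p₁ p₂ hB h₁ h₂ h₃ h₄ h₅ h₆ h₇ h₈
    refine PtEmb.blockMap_blockMap F (φ := φ) (ψ := AlgHom.id ℂ S)
      (φ' := AlgHom.id ℂ R) (ψ' := φ) rfl (f.restrict hB).toEmb
      (PtEmb.ofBlock a y B'.1) (PtEmb.ofBlock a x s.1.1) f.toEmb ?_ (fun i => ?_)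
      h₃ h₁ h₇ h₅ h₄ h₂ h₈ h₆ _
    · change (1 : Fin d → Sˣ) * f.t = f.t * torusMap φ 1
      rw [map_one, one_mul, mul_one]
    · exact ShLog.blockPerm_spec f.sigma hB i
  exact key _ _ hs _ _ _ _ _ _ _ _ _ _ _ _ _ _

end Assemble

end TreeDecomp

/-! ### Summands of trees whose root is not a leaf. -/

section NodeProjection

open AlgebraicGeometry CategoryTheory IndexTree
open scoped Pointwise

variable {X : Over (Spec (CommRingCat.of ℂ))} {R S T : Type} [CommRing R] [CommRing S] [CommRing T]
  [Algebra ℂ R] [Algebra ℂ S] [Algebra ℂ T] {φ : R →ₐ[ℂ] S} {ψ : S →ₐ[ℂ] T}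
  {d : ℕ} {a : TorusAction d X} {m n l : ℕ} {F : ∀ m, SuperSheaf a m} {K : ∀ m, SuperSheaf a m}

section

variable (D : ∀ m, 1 ≤ m → m < n → TreeDecomp F (K m)) (t : DegTree n)
  (h : Finset.univ ∈ t.tree.inner) {p : Blocks (t.tree.rootPartition h) → ZMod 2}
  (hp : ∀ A, (t.part h A).degree = p A)

/-- The projection of `K_A` to the summand given by the part of the tree below `A`. -/
def partProj (x : Pt X n R) (A : Blocks (t.tree.rootPartition h)) :
    BlockObj K A.1 (p A) x →ₗ[R] LeafTensor F (t.part h A) (Pt.restrict x A.1) :=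
  (D A.1.card (block_card_pos A) (block_card_lt (univ_notMem_rootPartition h) A)).proj
    (t.part h A) (hp A) (Pt.restrict x A.1)

/-- The projection of the tensor product of the `K_A`, for `A` a child of the root of the tree, to
the summand given by the tree. -/
def nodeProj (x : Pt X n R) :
    BlockTensor K (t.tree.rootPartition h) p x →ₗ[R] LeafTensor F t x :=
  -- The scalar passes from the order of the symbols grouped by child, natural for the tensor
  -- product, to the order with non-leaf nodes first, used by `symSign`.
  t.rootSign • (assemble F t h x).toLinearMap.comp
    (PiTensorProduct.map (partProj D t h hp x))

theorem nodeProj_tprod (x : Pt X n R)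
    (v : ∀ A : Blocks (t.tree.rootPartition h), BlockObj K A.1 (p A) x) :
    nodeProj D t h hp x (PiTensorProduct.tprod R v) = t.rootSign •
      assemble F t h x (PiTensorProduct.tprod R fun A => partProj D t h hp x A (v A)) :=
  congrArg (fun w => t.rootSign • assemble F t h x w) (PiTensorProduct.map_tprod _ _)

variable {t} {t' : DegTree n} (h' : Finset.univ ∈ t'.tree.inner)
  {q : Blocks (t'.tree.rootPartition h') → ZMod 2} (hq : ∀ A, (t'.part h' A).degree = q A)

/-- On pure tensors the left side acquires the Koszul sign of the odd blocks, a `symSign` from each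
part by induction, and `t'.rootSign`. Assembling is compatible with relabelling without signs, so
`rootSign_mul` is precisely the remaining identity of scalars. -/
theorem nodeProj_natural {x : Pt X n R} {y : Pt X n S} (f : PtHom a φ x y)
    (hf : DegTree.IsImage f.perm t t')
    (hP : f.sigma • t.tree.rootPartition h = t'.tree.rootPartition h')
    (hpq : ∀ A, p A = q (blockEquiv f.sigma hP A))
    (u : BlockTensor K (t.tree.rootPartition h) p x) :
    nodeProj D t' h' hq y (blockTensorMap K f hP p q hpq u) =
      DegTree.symSign f.perm t • leafTensorMap F f hf (nodeProj D t h hp x u) := by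
  induction u using PiTensorProduct.induction_on with
  | add u v hu hv =>
    rw [map_add, map_add, map_add, map_add, hu, hv]
    exact (zsmul_add (α := LeafTensor F t' y) _ _ _).symm
  | smul_tprod r v =>
    rw [LinearMap.map_smulₛₗ, map_smul, map_smul, LinearMap.map_smulₛₗ, smul_comm]
    congr 1
    rw [blockTensorMap_tprod, map_zsmul, nodeProj_tprod, nodeProj_tprod]
    have h1 : ∀ B, partProj D t' h' hq y B
        (blockMap K f (smul_blockEquiv_symm f.sigma hP B)
          ((hpq _).trans (congrArg q (Equiv.apply_symm_apply _ B)))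
          (v ((blockEquiv f.sigma hP).symm B))) =
        DegTree.symSign (f.restrict (smul_blockEquiv_symm f.sigma hP B)).perm
          (t.part h ((blockEquiv f.sigma hP).symm B)) •
        leafTensorMap F (f.restrict (smul_blockEquiv_symm f.sigma hP B)) (hf.part h h' _)
          (partProj D t h hp x _ (v ((blockEquiv f.sigma hP).symm B))) := fun B =>
      TreeDecomp.natural_seqMap D (f.restrict (smul_blockEquiv_symm f.sigma hP B))
        (hf.part h h' _) _ (hp _) (hq B) _ _ _ _ _
    rw [funext h1, tprod_zsmul, map_zsmul, map_zsmul, assemble_natural F h h' f hf hP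
        fun A => partProj D t h hp x A (v A), smul_smul,
      smul_smul, smul_smul]
    congr 1
    let τ : ∀ A : Blocks (t.tree.rootPartition h),
        Σ B : Finset (Fin n), Fin A.1.card ≃ Fin B.card := fun A =>
      ⟨f.sigma • A.1, (f.restrict rfl).perm⟩
    have h2 := DegTree.rootSign_mul hf h τ fun A i => blockPerm_spec f.sigma rfl i
    rw [mul_comm (sgn _ _), mul_assoc]
    refine Eq.trans ?_ h2
    congr 2
    · rw [sgn_eq_relSign]
      simp only [hp]
    · refine Fintype.prod_equiv (blockEquiv f.sigma hP).symm _ _ fun B => ?_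
      -- The target block equals `σ(A)` only propositionally, whereas `τ` uses `σ(A)` itself.
      have key : ∀ (A : Finset (Fin n)) (s : DegTree A.card) (B : Finset (Fin n))
          (hAB : f.sigma • A = B), DegTree.symSign (f.restrict hAB).perm s =
            DegTree.symSign (f.restrict (A := A) rfl).perm s := by
        rintro A s _ rfl
        rfl
      exact key _ _ _ _

end

/-! ### Joint bijectivity of the projections -/

/-- One tensor factor is the value of a sheaf of index `n`, which vanishes. This is how the
truncation of the series removes the partition with one block. -/
theorem blockTensor_subsingleton (hK : ∀ m, n ≤ m → ∀ (e : ZMod 2) (x : Pt X m R),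
      Subsingleton ((K m e).obj x)) {P : SetPartition n} (hP : Finset.univ ∈ P.parts)
    (p : Blocks P → ZMod 2) (x : Pt X n R) : Subsingleton (BlockTensor K P p x) := by
  have hs : Subsingleton (BlockObj K (Finset.univ : Finset (Fin n)) (p ⟨_, hP⟩) x) :=
    hK _ (by rw [Finset.card_univ, Fintype.card_fin]) _ _
  refine ⟨fun u w => ?_⟩
  have key : ∀ u : BlockTensor K P p x, u = 0 := by
    intro u
    induction u using PiTensorProduct.induction_on with
    | add u v hu hv => rw [hu, hv, add_zero]
    | smul_tprod r v =>
      rw [(PiTensorProduct.tprod R).map_coord_zero ⟨_, hP⟩ (hs.elim _ _), smul_zero]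
  rw [key u, key w]

theorem piTensor_treeProj_bijective (D : ∀ m, 1 ≤ m → m < n → TreeDecomp F (K m))
    {P : SetPartition n} (hP : Finset.univ ∉ P.parts) (p : Blocks P → ZMod 2) (x : Pt X n R) :
    Function.Bijective fun (u : BlockTensor K P p x)
      (f : ∀ A : Blocks P, { s : DegTree A.1.card // s.degree = p A }) =>
        (PiTensorProduct.map (fun A : Blocks P =>
          ((D A.1.card (block_card_pos A) (block_card_lt hP A)).proj (f A).1 (f A).2
            (Pt.restrict x A.1) : BlockObj K A.1 (p A) x →ₗ[R] _)) u :
          ⨂[R] A : Blocks P, LeafTensor F (f A).1 (Pt.restrict x A.1)) := by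
  -- Distributivity requires finitely many summands; a tree with degrees is determined by two finite
  -- sets of subsets.
  have hfin : ∀ A : Blocks P, Finite { s : DegTree A.1.card // s.degree = p A } := by
    intro A
    refine Finite.of_injective
      (β := Finset (Finset (Fin A.1.card)) × Finset (Finset (Fin A.1.card)))
      (fun s => (s.1.tree.nodes, s.1.odd)) fun s s' e => Subtype.ext (DegTree.ext ?_ ?_)
    · exact congrArg Prod.fst e
    · exact congrArg Prod.snd e
  exact piTensor_map_bijective (R := R) (ι := Blocks P)
    (κ := fun A => { s : DegTree A.1.card // s.degree = p A })
    (M := fun A s => LeafTensor F s.1 (Pt.restrict x A.1)) (V := fun A => BlockObj K A.1 (p A) x)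
    (fun A s => (D A.1.card (block_card_pos A) (block_card_lt hP A)).proj s.1 s.2
      (Pt.restrict x A.1))
    fun A => (D A.1.card (block_card_pos A) (block_card_lt hP A)).bijective (p A)
      (Pt.restrict x A.1)

/-- The map is a composite of three bijections: distributivity for each partition with more than one
block, reindexing by cutting trees at the root, and assembling with a sign in each summand. -/
theorem nodeProj_bijective (hn : 1 ≤ n) (D : ∀ m, 1 ≤ m → m < n → TreeDecomp F (K m))
    (hK : ∀ m, n ≤ m → ∀ (e : ZMod 2) (x : Pt X m R), Subsingleton ((K m e).obj x))
    (e : ZMod 2) (x : Pt X n R) :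
    Function.Bijective fun (v : ∀ (P : SetPartition n) (p : Degrees P (e + ((1 : ℕ) : ZMod 2))),
        BlockTensor K P p.1 x)
      (t : { t : DegTree n // t.degree = e ∧ Finset.univ ∈ t.tree.inner }) =>
        nodeProj D t.1 t.2.2 (p := (DegTree.decompose t).2.1.1) (fun _ => rfl) x
          (v _ (DegTree.decompose t).2.1) := by
  let N : NodeIndex n (e + ((1 : ℕ) : ZMod 2)) → Type := fun s =>
    ⨂[R] A : Blocks s.1.1, LeafTensor F (s.2.2 A).1 (Pt.restrict x A.1)
  let Ψ : (∀ (P : SetPartition n) (p : Degrees P (e + ((1 : ℕ) : ZMod 2))),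
      BlockTensor K P p.1 x) → ∀ s, N s := fun v s =>
    PiTensorProduct.map (fun A : Blocks s.1.1 =>
      ((D A.1.card (block_card_pos A) (block_card_lt s.1.2 A)).proj (s.2.2 A).1 (s.2.2 A).2
        (Pt.restrict x A.1) : BlockObj K A.1 (s.2.1.1 A) x →ₗ[R] _)) (v s.1.1 s.2.1)
  have hΨ : Function.Bijective Ψ := by
    constructor
    · intro v w hvw
      funext P p
      by_cases hP : Finset.univ ∈ P.parts
      · exact (blockTensor_subsingleton hK hP p.1 x).elim _ _
      · exact (piTensor_treeProj_bijective D hP p.1 x).1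
          (funext fun f => congrFun hvw ⟨⟨P, hP⟩, p, f⟩)
    · intro w
      choose g hg using fun (P : { P : SetPartition n // Finset.univ ∉ P.parts })
        (p : Degrees P.1 (e + ((1 : ℕ) : ZMod 2))) =>
          (piTensor_treeProj_bijective D P.2 p.1 x).2 fun f => w ⟨P, p, f⟩
      classical
      -- On the partition with one block the value `0` is the only element.
      refine ⟨fun P p => if hP : Finset.univ ∉ P.parts then g ⟨P, hP⟩ p else 0, funext fun s => ?_⟩
      simp only [Ψ, dif_pos s.1.2]
      exact congrFun (hg s.1 s.2.1) s.2.2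
  have hE : Function.Bijective fun (w : ∀ s, N s)
      (t : { t : DegTree n // t.degree = e ∧ Finset.univ ∈ t.tree.inner }) =>
        w (DegTree.decompose t) :=
    ((Equiv.ofBijective _ (DegTree.decompose_bijective hn e)).piCongrLeft N).symm.bijective
  let c : ∀ t : { t : DegTree n // t.degree = e ∧ Finset.univ ∈ t.tree.inner },
      N (DegTree.decompose t) → LeafTensor F t.1 x := fun t w =>
    t.1.rootSign • assemble F t.1 t.2.2 x w
  have hc : ∀ t, Function.Bijective (c t) := by
    intro t
    -- The shuffle sign squares to one, so rescaling by it is an involution and hence bijective.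
    have hs : Function.Involutive fun w : LeafTensor F t.1 x => t.1.rootSign • w := fun w => by
      change t.1.rootSign • t.1.rootSign • w = w
      rw [smul_smul]
      exact (congrArg (· • w) (relSign_mul_self _ _ _)).trans (one_smul ℤ w)
    exact hs.bijective.comp (assemble F t.1 t.2.2 x).bijective
  have hC : Function.Bijective fun (w : ∀ t, N (DegTree.decompose t)) t => c t (w t) :=
    Function.Bijective.piMap hc
  exact (hC.comp hE).comp hΨ

end NodeProjection

/-! ### The trees with a single node -/

section LeafProjection

open AlgebraicGeometry CategoryTheory IndexTree
open scoped Pointwise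

variable {X : Over (Spec (CommRingCat.of ℂ))} {R S : Type} [CommRing R] [CommRing S]
  [Algebra ℂ R] [Algebra ℂ S] {φ : R →ₐ[ℂ] S} {d : ℕ} {a : TorusAction d X} {n : ℕ}

namespace IndexTree

theorem inner_eq_empty {T : IndexTree n} (h : Finset.univ ∉ T.inner) : T.inner = ∅ := by
  by_contra hne
  exact h (univ_mem_inner (Finset.nonempty_iff_ne_empty.mpr hne))

theorem univ_mem_leaves {T : IndexTree n} (h : Finset.univ ∉ T.inner) : Finset.univ ∈ T.leaves := by
  by_contra h'
  exact h (Finset.mem_sdiff.mpr ⟨T.univ_mem, h'⟩)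

theorem eq_univ_of_mem_nodes {T : IndexTree n} (h : Finset.univ ∉ T.inner) {A : Finset (Fin n)}
    (hA : A ∈ T.nodes) : A = Finset.univ := by
  by_contra hne
  exact (mem_leaves.mp (univ_mem_leaves h)).2 A hA (Finset.ssubset_univ_iff.mpr hne)

theorem block_eq_univ {T : IndexTree n} (h : Finset.univ ∉ T.inner) (B : Blocks T.leafPartition) :
    B.1 = Finset.univ :=
  eq_univ_of_mem_nodes h (mem_leaves.mp B.2).1

theorem subsingleton_blocks {T : IndexTree n} (h : Finset.univ ∉ T.inner) :
    Subsingleton (Blocks T.leafPartition) :=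
  ⟨fun B C => Subtype.ext ((block_eq_univ h B).trans (block_eq_univ h C).symm)⟩

/-- The tree with a single node. -/
def single (hn : 1 ≤ n) : IndexTree n where
  nodes := {Finset.univ}
  univ_mem := Finset.mem_singleton_self _
  empty_notMem h := by
    have : (⟨0, hn⟩ : Fin n) ∈ (∅ : Finset (Fin n)) :=
      (Finset.mem_singleton.mp h).symm ▸ Finset.mem_univ _
    exact absurd this (Finset.notMem_empty _)
  laminar A hA B hB := by
    rw [Finset.mem_singleton.mp hA, Finset.mem_singleton.mp hB]
    exact Or.inl subset_rfl
  eq_union A hA h := by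
    obtain ⟨B, hB, hBA⟩ := h
    rw [Finset.mem_singleton.mp hA, Finset.mem_singleton.mp hB] at hBA
    exact absurd hBA (ssubset_irrefl _)

theorem univ_notMem_inner_single (hn : 1 ≤ n) : Finset.univ ∉ (single hn).inner := fun h => by
  obtain ⟨-, B, hB, hBu⟩ := mem_inner.mp h
  rw [Finset.mem_singleton.mp hB] at hBu
  exact ssubset_irrefl _ hBu

end IndexTree

theorem DegTree.degree_eq_deg {t : DegTree n} (h : Finset.univ ∉ t.tree.inner)
    (B : Blocks t.tree.leafPartition) : t.degree = t.deg B := by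
  have := subsingleton_blocks h
  rw [DegTree.degree, inner_eq_empty h, Finset.card_empty, Nat.cast_zero, add_zero,
    Fintype.sum_subsingleton _ B]

/-- The only leaf is `[n]` and its degree is the total degree. Thus each degree has exactly one
summand of this kind, matching the single copy of `F_n`. -/
theorem DegTree.ext_of_degree_eq {t t' : DegTree n} (h : Finset.univ ∉ t.tree.inner)
    (h' : Finset.univ ∉ t'.tree.inner) (e : t.degree = t'.degree) : t = t' := by
  obtain ⟨T, p⟩ := t
  obtain ⟨T', p'⟩ := t'
  have hT : T = T' := IndexTree.ext <| by
    ext A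
    exact ⟨fun hA => eq_univ_of_mem_nodes h hA ▸ T'.univ_mem,
      fun hA => eq_univ_of_mem_nodes h' hA ▸ T.univ_mem⟩
  subst hT
  have hp : p = p' := funext fun B =>
    (degree_eq_deg h B).symm.trans (e.trans (degree_eq_deg h' B))
  rw [hp]

theorem DegTree.exists_degree_eq (hn : 1 ≤ n) (e : ZMod 2) :
    ∃ t : DegTree n, t.degree = e ∧ Finset.univ ∉ t.tree.inner := by
  have h := univ_notMem_inner_single hn
  refine ⟨⟨single hn, fun _ => e⟩, ?_, h⟩
  have hB : Finset.univ ∈ (single hn).leafPartition.parts := univ_mem_leaves h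
  have := degree_eq_deg (t := ⟨single hn, fun _ => e⟩) h ⟨_, hB⟩
  exact this

/-- The bijection `[n] → [|B|]` for `B = [n]`. -/
def univBlockEquiv {B : Finset (Fin n)} (hB : B = Finset.univ) : Fin n ≃ Fin B.card :=
  (Equiv.ofBijective (blockEmb B) ⟨(blockEmb B).injective, fun i => by
    have hi : i ∈ Finset.univ.map (blockEmb B) := by
      rw [map_univ_blockEmb, hB]
      exact Finset.mem_univ i
    obtain ⟨j, -, hj⟩ := Finset.mem_map.mp hi
    exact ⟨j, hj⟩⟩).symm

theorem blockEmb_univBlockEquiv {B : Finset (Fin n)} (hB : B = Finset.univ) (i : Fin n) :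
    blockEmb B (univBlockEquiv hB i) = i :=
  Equiv.apply_symm_apply (Equiv.ofBijective (blockEmb B) _) i

variable (F : ∀ m, SuperSheaf a m)

/-- The isomorphism of `F_n` with `F_B` for `B = [n]`. -/
def univBlockObjEquiv {B : Finset (Fin n)} (hB : B = Finset.univ) {e p : ZMod 2} (hp : e = p)
    (x : Pt X n R) : (F n e).obj x ≃ₗ[R] BlockObj F B p x :=
  seqEquiv F (univBlockEquiv hB) (fun i => congrArg x (blockEmb_univBlockEquiv hB i)) hp

theorem univBlockObjEquiv_natural {x : Pt X n R} {y : Pt X n S} (f : PtHom a φ x y)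
    {B C : Finset (Fin n)} (hB : B = Finset.univ) (hC : C = Finset.univ) {e p q : ZMod 2}
    (hp : e = p) (hq : e = q) (hBC : B.map f.toEmb.emb = C) (hpq : p = q) (v : (F n e).obj x) :
    univBlockObjEquiv F hC hq y ((F n e).map f v) =
      f.toEmb.blockMap F hBC hpq (univBlockObjEquiv F hB hp x v) := by
  have key : ∀ (θ θ' : R →ₐ[ℂ] S) (_ : θ = θ') (h : PtHom a θ x (Pt.restrict y C))
      (h' : PtHom a θ' x (Pt.restrict y C)) (_ : h.t = h'.t) (_ : h.perm = h'.perm),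
      seqMap F hq h v = seqMap F hq h' v := by
    rintro θ _ rfl h h' h1 h2
    rw [PtHom.ext' h1 h2]
  refine (seqMap_comp F rfl hq hq f (PtHom.ofPerm (univBlockEquiv hC) _) v).symm.trans ?_
  refine Eq.trans ?_ (seqMap_comp F hp hpq hq (PtHom.ofPerm (univBlockEquiv hB) _)
    (f.toEmb.restrict hBC) v)
  refine key _ _ rfl _ _ ?_ (Equiv.ext fun i => ?_)
  · change (1 : Fin d → Sˣ) * torusMap _ f.t = f.t * torusMap φ 1
    rw [map_one, one_mul, mul_one]
    rfl
  · apply (blockEmb C).injective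
    refine (blockEmb_univBlockEquiv hC _).trans ?_
    refine Eq.trans ?_ (PtEmb.blockPerm_spec _ hBC _).symm
    exact congrArg f.perm (blockEmb_univBlockEquiv hB i).symm

/-- The isomorphism of `F_n` with the summand given by a tree with a single node. -/
def leafProj (t : DegTree n) (h : Finset.univ ∉ t.tree.inner) {e : ZMod 2} (ht : t.degree = e)
    (x : Pt X n R) : (F n e).obj x ≃ₗ[R] LeafTensor F t x :=
  haveI := subsingleton_blocks h
  let B : Blocks t.tree.leafPartition := ⟨Finset.univ, univ_mem_leaves h⟩
  (univBlockObjEquiv F rfl (ht.symm.trans (DegTree.degree_eq_deg h B)) x).trans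
    (PiTensorProduct.subsingletonEquiv (s := fun B => BlockObj F B.1 (t.deg B) x) B).symm

theorem leafProj_apply (t : DegTree n) (h : Finset.univ ∉ t.tree.inner) {e : ZMod 2}
    (ht : t.degree = e) (x : Pt X n R) (v : (F n e).obj x) :
    leafProj F t h ht x v = PiTensorProduct.tprod R fun B : Blocks t.tree.leafPartition =>
      univBlockObjEquiv F (block_eq_univ h B) (ht.symm.trans (DegTree.degree_eq_deg h B)) x v := by
  have := subsingleton_blocks h
  rw [leafProj, LinearEquiv.trans_apply, LinearEquiv.symm_apply_eq,
    PiTensorProduct.subsingletonEquiv_apply_tprod]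

theorem leafProj_natural {x : Pt X n R} {y : Pt X n S} (f : PtHom a φ x y) {t t' : DegTree n}
    (hf : DegTree.IsImage f.perm t t') (h : Finset.univ ∉ t.tree.inner)
    (h' : Finset.univ ∉ t'.tree.inner) {e : ZMod 2} (ht : t.degree = e) (ht' : t'.degree = e)
    (v : (F n e).obj x) : leafProj F t' h' ht' y ((F n e).map f v) =
      DegTree.symSign f.perm t • leafTensorMap F f hf (leafProj F t h ht x v) := by
  -- There are no non-leaf nodes and `[n]` is the only possible odd leaf, so nothing can be
  -- inverted.
  have hs : DegTree.symSign f.perm t = 1 := by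
    rw [DegTree.symSign, inner_eq_empty h, relSign_eq_one, relSign_eq_one, mul_one]
    · intro A hA B hB
      rw [eq_univ_of_mem_nodes h (mem_leaves.mp (t.odd_subset_leaves hA)).1,
        eq_univ_of_mem_nodes h (mem_leaves.mp (t.odd_subset_leaves hB)).1]
      simp
    · simp
  rw [hs, one_smul, leafProj_apply, leafProj_apply, leafTensorMap_tprod]
  congr 1
  funext B
  exact univBlockObjEquiv_natural F f _ _ _ _ _ _ v

end LeafProjection

/-! ### The recursion for `G_n` and the induction. -/

section Recursion

open AlgebraicGeometry CategoryTheory IndexTree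
open scoped Pointwise

variable {X : Over (Spec (CommRingCat.of ℂ))} {R S : Type} [CommRing R] [CommRing S]
  [Algebra ℂ R] [Algebra ℂ S] {φ : R →ₐ[ℂ] S} {d : ℕ} {a : TorusAction d X} {n : ℕ}
  {F K : ∀ m, SuperSheaf a m}

/-- The structure map of the sum reads the component at `σ⁻¹(Q)` with pulled back degrees; this form
accepts any `P` and `p` that are carried to `Q` and `q`. -/
theorem partitionFamily_sum_map {e : ZMod 2} {x : Pt X n R} {y : Pt X n S} (f : PtHom a φ x y)
    {P Q : SetPartition n} (hP : f.sigma • P = Q) (p : Degrees P e) (q : Degrees Q e)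
    (hpq : ∀ A, p.1 A = q.1 (blockEquiv f.sigma hP A))
    (v : ∀ (P : SetPartition n) (p : Degrees P e), BlockTensor K P p.1 x) :
    (partitionFamily K e).sum.map f v Q q = blockTensorMap K f hP p.1 q.1 hpq (v P p) := by
  refine (congrFun ((partitionFamily K e).map_congr f (i' := P) ?_ _ hP v) q).trans ?_
  · rw [inv_smul_eq_iff, hP]
  · exact blockTensorMap_congr K f hP (Subtype.ext (funext fun A => (hpq A).symm)) q
      (fun _ => rfl) _ (v P)

/-- The total degrees of the parts of a tree below the children of its root. -/
def DegTree.rootDegrees (t : DegTree n) (h : Finset.univ ∈ t.tree.inner) {e : ZMod 2}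
    (ht : t.degree = e) : Degrees (t.tree.rootPartition h) (e + ((1 : ℕ) : ZMod 2)) :=
  (DegTree.decompose ⟨t, ht, h⟩).2.1

theorem DegTree.IsImage.degree {m : ℕ} {g : Fin m ≃ Fin n} {t : DegTree m} {t' : DegTree n}
    (h : IsImage g t t') : t'.degree = t.degree := by
  rw [DegTree.degree_eq_card, DegTree.degree_eq_card, h.symbols_eq, Finset.card_map]

theorem DegTree.IsImage.smul_rootPartition {g : Equiv.Perm (Fin n)} {t t' : DegTree n}
    (hf : IsImage g t t') (h : Finset.univ ∈ t.tree.inner) (h' : Finset.univ ∈ t'.tree.inner) :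
    g • t.tree.rootPartition h = t'.tree.rootPartition h' := by
  refine Finpartition.ext ?_
  rw [parts_smul, rootPartition_parts, rootPartition_parts]
  ext B
  obtain ⟨C, rfl⟩ := DegTree.exists_map_eq g B
  rw [← hf.children, ← smul_eq_map]
  exact Finset.smul_mem_smul_finset_iff g

variable (D : ∀ m, 1 ≤ m → m < n → TreeDecomp F (K m))

/-- The projection of `F_n ⊕ Exp(∑ K_m q^m)_n[1]` to the summand given by a tree. -/
def recProj (t : DegTree n) {e : ZMod 2} (ht : t.degree = e) (x : Pt X n R) :
    (((F n).oplus ((shExp K n).shift 1)) e).obj x →ₗ[R] LeafTensor F t x :=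
  -- In the direct sum, `true` labels `F_n` and `false` the shifted exponential, whose component in
  -- degree `e` consists of tensors of degree `e + 1`.
  if h : Finset.univ ∈ t.tree.inner then
    { toFun := fun v => nodeProj D t h (p := (t.rootDegrees h ht).1) (fun _ => rfl) x
        (v false (t.tree.rootPartition h) (t.rootDegrees h ht))
      map_add' := fun _ _ => map_add _ _ _
      map_smul' := fun r v => map_smul (nodeProj D t h (p := (t.rootDegrees h ht).1)
        (fun _ => rfl) x) r (v false (t.tree.rootPartition h) (t.rootDegrees h ht)) }
  else
    { toFun := fun v => leafProj F t h ht x (v true)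
      map_add' := fun _ _ => map_add _ _ _
      map_smul' := fun r v => map_smul (leafProj F t h ht x) r (v true) }

theorem recProj_node (t : DegTree n) (h : Finset.univ ∈ t.tree.inner) {e : ZMod 2}
    (ht : t.degree = e) (x : Pt X n R) (v : (((F n).oplus ((shExp K n).shift 1)) e).obj x) :
    recProj D t ht x v = nodeProj D t h (p := (t.rootDegrees h ht).1) (fun _ => rfl) x
        (v false (t.tree.rootPartition h) (t.rootDegrees h ht)) := by
  rw [recProj, dif_pos h]
  rfl

theorem recProj_leaf (t : DegTree n) (h : Finset.univ ∉ t.tree.inner) {e : ZMod 2}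
    (ht : t.degree = e) (x : Pt X n R) (v : (((F n).oplus ((shExp K n).shift 1)) e).obj x) :
    recProj D t ht x v = leafProj F t h ht x (v true) := by
  rw [recProj, dif_neg h]
  rfl

theorem recProj_natural {x : Pt X n R} {y : Pt X n S} (f : PtHom a φ x y) {t t' : DegTree n}
    (hf : DegTree.IsImage f.perm t t') {e : ZMod 2} (ht : t.degree = e) (ht' : t'.degree = e)
    (v : (((F n).oplus ((shExp K n).shift 1)) e).obj x) :
    recProj D t' ht' y ((((F n).oplus ((shExp K n).shift 1)) e).map f v) =
      DegTree.symSign f.perm t • leafTensorMap F f hf (recProj D t ht x v) := by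
  by_cases h : Finset.univ ∈ t.tree.inner
  · have h' := hf.univ_mem_inner.mp h
    have hP : f.sigma • t.tree.rootPartition h = t'.tree.rootPartition h' :=
      hf.smul_rootPartition h h'
    have hpq : ∀ A, (t.rootDegrees h ht).1 A =
        (t'.rootDegrees h' ht').1 (blockEquiv f.sigma hP A) := fun A =>
      (hf.part h h' (f := f) (A := A) (B := blockEquiv f.sigma hP A) rfl).degree.symm
    rw [recProj_node D t h, recProj_node D t' h']
    exact (congrArg (nodeProj D t' h' (fun _ => rfl) y)
      (partitionFamily_sum_map f hP _ _ hpq (v false))).trans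
        (nodeProj_natural D h (fun _ => rfl) h' (fun _ => rfl) f hf hP hpq _)
  · rw [recProj_leaf D t h, recProj_leaf D t' fun h' => h (hf.univ_mem_inner.mpr h')]
    exact leafProj_natural F f hf h _ ht ht' (v true)

/-- The unique tree with a single node in degree `e` detects the component in `F_n`; the trees with
a non-leaf root detect the exponential, by `nodeProj_bijective`. -/
theorem recProj_bijective (hn : 1 ≤ n)
    (hK : ∀ m, n ≤ m → ∀ (e : ZMod 2) (x : Pt X m R), Subsingleton ((K m e).obj x))
    (e : ZMod 2) (x : Pt X n R) :
    Function.Bijective fun (v : (((F n).oplus ((shExp K n).shift 1)) e).obj x)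
      (t : { t : DegTree n // t.degree = e }) => recProj D t.1 t.2 x v := by
  have hN := nodeProj_bijective hn D hK e x
  obtain ⟨s, hs, hs'⟩ := DegTree.exists_degree_eq hn e
  constructor
  · intro v w hvw
    funext b
    cases b
    · refine hN.1 (funext fun t => ?_)
      have := congrFun hvw ⟨t.1, t.2.1⟩
      dsimp only at this
      rw [recProj_node D t.1 t.2.2, recProj_node D t.1 t.2.2] at this
      exact this
    · have := congrFun hvw ⟨s, hs⟩
      dsimp only at this
      rw [recProj_leaf D s hs', recProj_leaf D s hs'] at this
      exact (leafProj F s hs' hs x).injective this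
  · intro z
    obtain ⟨u, hu⟩ := hN.2 fun t => z ⟨t.1, t.2.1⟩
    let v : (((F n).oplus ((shExp K n).shift 1)) e).obj x := fun b => by
      cases b
      · exact u
      · exact (leafProj F s hs' hs x).symm (z ⟨s, hs⟩)
    refine ⟨v, funext fun t => ?_⟩
    obtain ⟨t, ht⟩ := t
    by_cases h : Finset.univ ∈ t.tree.inner
    · exact (recProj_node D t h ht x v).trans (congrFun hu ⟨t, ht, h⟩)
    · obtain rfl := DegTree.ext_of_degree_eq h hs' (ht.trans hs.symm)
      exact (recProj_leaf D t h ht x v).trans ((leafProj F t h ht x).apply_symm_apply _)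

/-- The decomposition of `F_n ⊕ Exp(∑ K_m q^m)_n[1]` given by decompositions of the `K_m` for
`m < n`. -/
def TreeDecomp.step (hn : 1 ≤ n) (hK : ∀ m, n ≤ m → K m = SuperSheaf.zero m) :
    TreeDecomp F ((F n).oplus ((shExp K n).shift 1)) where
  proj t _ ht _ _ _ x := recProj D t ht x
  natural f _ _ h _ ht ht' v := recProj_natural D f h ht ht' v
  bijective e _ _ _ x := recProj_bijective D hn (fun m hm e x => by
    rw [hK m hm]
    exact inferInstanceAs (Subsingleton PUnit)) e x

theorem nonempty_treeDecomp (F : ∀ m, SuperSheaf a m) (n : ℕ) (hn : 1 ≤ n) :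
    Nonempty (TreeDecomp F (shLog F n)) := by
  induction n using Nat.strong_induction_on with
  | h n ih =>
    rw [shLog]
    -- For `1 ≤ m < n` the exponentiated term is `G_m`, decomposed by induction; from `m = n` on it
    -- is zero, which eliminates the partition with one block.
    refine ⟨TreeDecomp.step (fun m hm hm' => ?_) hn fun m hm => if_neg fun h => ?_⟩
    · rw [if_pos ⟨hm, hm'⟩]
      exact (ih m hm' hm).some
    · exact absurd h.2 (not_lt.mpr hm)

end Recursion

/-! ### From a decomposition to the isomorphism of sheaves. -/

section TreeSheafIso

open AlgebraicGeometry CategoryTheory IndexTree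
open scoped Pointwise

variable {X : Over (Spec (CommRingCat.of ℂ))} {R S : Type} [CommRing R] [CommRing S]
  [Algebra ℂ R] [Algebra ℂ S] {φ : R →ₐ[ℂ] S} {d : ℕ} {a : TorusAction d X} {n : ℕ}
  {F : ∀ m, SuperSheaf a m}

/-- A homomorphism of equivariant sheaves that is bijective on values is an isomorphism. -/
def EqCoh.isoOfBijective {G H : EqCoh a n} (α : G ⟶ H)
    (hα : ∀ {R : Type} [CommRing R] [Algebra ℂ R] (x : Pt X n R),
      Function.Bijective (EqCoh.Hom.app α x)) : G ≅ H where
  hom := α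
  inv :=
    { app := fun x => (LinearEquiv.ofBijective (EqCoh.Hom.app α x) (hα x)).symm
      naturality := fun {R S _ _ _ _ φ x y} f v => by
        obtain ⟨v, rfl⟩ := (LinearEquiv.ofBijective (EqCoh.Hom.app α x) (hα x)).surjective v
        refine (LinearEquiv.symm_apply_eq _).mpr ?_
        refine (EqCoh.Hom.naturality α f v).symm.trans ?_
        exact congrArg (fun w => EqCoh.Hom.app α y (G.map f w))
          ((LinearEquiv.ofBijective (EqCoh.Hom.app α x) (hα x)).symm_apply_apply v).symm }
  hom_inv_id := by
    change EqCoh.Hom.mk _ _ = EqCoh.Hom.mk _ _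
    congr 1
    funext R _ _ x
    exact LinearMap.ext fun v =>
      (LinearEquiv.ofBijective (EqCoh.Hom.app α x) (hα x)).symm_apply_apply v
  inv_hom_id := by
    change EqCoh.Hom.mk _ _ = EqCoh.Hom.mk _ _
    congr 1
    funext R _ _ x
    exact LinearMap.ext fun v =>
      (LinearEquiv.ofBijective (EqCoh.Hom.app α x) (hα x)).apply_symm_apply v

/-- An index tree with degrees of its leaves, as a tree of given degree. -/
abbrev treeOf {k : ℕ} {e : ZMod 2} (T : IndexTreeWith n k)
    (p : Degrees T.1.leafPartition (e + (k : ZMod 2))) : DegTree n :=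
  ⟨T.1, p.1⟩

/-- In `F_T[k]` the part of degree `e` has leaf degrees of sum `e + k`. The `k` non-leaf nodes add
another `k`, and `2k = 0` in `ℤ/2`. -/
theorem degree_treeOf {k : ℕ} {e : ZMod 2} (T : IndexTreeWith n k)
    (p : Degrees T.1.leafPartition (e + (k : ZMod 2))) : (treeOf T p).degree = e := by
  rw [DegTree.degree, p.2, T.2, add_assoc, CharTwo.add_self_eq_zero, add_zero]

theorem isImage_treeOf {k : ℕ} {e : ZMod 2} (σ : Equiv.Perm (Fin n)) {T T' : IndexTreeWith n k}
    (hT : σ • T.1 = T'.1) (h : σ • T.1.leafPartition = T'.1.leafPartition)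
    (p : Degrees T'.1.leafPartition (e + (k : ZMod 2))) :
    DegTree.IsImage σ (treeOf T (p.pull σ h)) (treeOf T' p) := by
  constructor
  · intro C
    rw [← smul_eq_map]
    change C ∈ T.1.nodes ↔ σ • C ∈ T'.1.nodes
    rw [← hT, nodes_smul, Finset.smul_mem_smul_finset_iff]
  · intro C
    rw [← smul_eq_map]
    change C ∈ oddBlocks (p.pull σ h).1 ↔ σ • C ∈ oddBlocks p.1
    rw [oddBlocks_smul σ h (p.pull σ h).1 p.1 fun _ => rfl, Finset.smul_mem_smul_finset_iff]

/-- Separates the Koszul sign of the leaves from the underlying unsigned map, so that it can be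
combined with the sign of the non-leaf nodes. -/
theorem blockTensorMap_eq {x : Pt X n R} {y : Pt X n S} (f : PtHom a φ x y) {t t' : DegTree n}
    (hf : DegTree.IsImage f.perm t t')
    (h : f.sigma • t.tree.leafPartition = t'.tree.leafPartition)
    (hpq : ∀ A, t.deg A = t'.deg (blockEquiv f.sigma h A)) (u : LeafTensor F t x) :
    blockTensorMap F f h t.deg t'.deg hpq u =
      sgn f.sigma t.odd • leafTensorMap F f hf u := by
  induction u using PiTensorProduct.induction_on with
  | add u v hu hv =>
    rw [map_add, map_add, hu, hv]
    exact (zsmul_add (α := LeafTensor F t' y) _ _ _).symm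
  | smul_tprod r v =>
    rw [LinearMap.map_smulₛₗ, LinearMap.map_smulₛₗ, blockTensorMap_tprod, leafTensorMap_tprod,
      smul_comm]
    refine congrArg (fun w => sgn f.sigma t.odd • (φ : R →+* S) r • PiTensorProduct.tprod S w) ?_
    funext B
    have hB : (blockEquiv f.sigma h).symm B = hf.leafEquiv.symm B := by
      apply Subtype.ext
      apply MulAction.injective f.sigma
      exact (smul_blockEquiv_symm f.sigma h B).trans <|
        (hf.map_leafEquiv_symm B).symm.trans (smul_eq_map f.sigma _).symm
    have key : ∀ (A A' : Blocks t.tree.leafPartition) (_ : A = A') (h₁ : f.sigma • A.1 = B.1)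
        (h₂ : t.deg A = t'.deg B) (h₃ : A'.1.map f.toEmb.emb = B.1) (h₄ : t.deg A' = t'.deg B),
        blockMap F f h₁ h₂ (v A) = f.toEmb.blockMap F h₃ h₄ (v A') := by
      rintro A _ rfl h₁ h₂ h₃ h₄
      rw [PtEmb.blockMap, PtEmb.restrict_toEmb f h₃ h₁]
      rfl
    exact key _ _ hB _ _ _ _

/-- The homomorphism to the direct sum of the sheaves `F_T[k]` given by a decomposition. -/
def TreeDecomp.hom {G : SuperSheaf a n} (D : TreeDecomp F G) (e : ZMod 2) :
    G e ⟶ (SuperSheaf.directSum fun k : Fin n => (treeSheaf F n (k : ℕ)).shift (k : ℕ)) e where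
  app x :=
    { toFun := fun v k T p => D.proj (treeOf T p) (degree_treeOf T p) x v
      map_add' := fun v w => by
        funext k T p
        exact map_add _ _ _
      map_smul' := fun r v => by
        funext k T p
        exact map_smul (D.proj (treeOf T p) (degree_treeOf T p) x) r v }
  naturality f v := by
    funext k T p
    have hT : f.sigma • (f.sigma⁻¹ • T).1 = T.1 := congrArg Subtype.val (smul_inv_smul f.sigma T)
    have h : f.sigma • (f.sigma⁻¹ • T).1.leafPartition = T.1.leafPartition := by
      rw [← leafPartition_smul, hT]
    have hf := isImage_treeOf f.sigma hT h p
    refine (D.natural f hf (degree_treeOf _ _) (degree_treeOf T p) v).trans ?_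
    -- The structure map of `treeFamily` is the one for the leaf partition, multiplied by the sign
    -- on non-leaf nodes; the product of this sign and the Koszul sign is `symSign`.
    change _ = sgn f.sigma (f.sigma⁻¹ • T).1.inner • blockTensorMap F f h (p.pull f.sigma h).1 p.1
      (fun _ => rfl) (D.proj (treeOf (f.sigma⁻¹ • T) (p.pull f.sigma h)) (degree_treeOf _ _) _ v)
    refine Eq.trans ?_ (congrArg (fun w => sgn f.sigma (f.sigma⁻¹ • T).1.inner • w)
      (blockTensorMap_eq f hf h (fun _ => rfl) _)).symm
    rw [smul_smul, sgn_eq_relSign, sgn_eq_relSign, DegTree.symSign]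

/-- A triple of `k < n`, a tree with `k` non-leaf nodes and leaf degrees of sum `e + k` is the same
as a tree with degrees of total degree `e`. The bound `k < n` loses no tree, by `card_inner_lt`. -/
theorem TreeDecomp.hom_app_bijective {G : SuperSheaf a n} (hn : 1 ≤ n) (D : TreeDecomp F G)
    (e : ZMod 2) (x : Pt X n R) : Function.Bijective (EqCoh.Hom.app (D.hom e) x) := by
  have hsum : ∀ t : { t : DegTree n // t.degree = e },
      ∑ A, t.1.deg A = e + (t.1.tree.inner.card : ZMod 2) := by
    rintro ⟨t, rfl⟩
    change ∑ A, t.deg A = t.degree + (t.tree.inner.card : ZMod 2)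
    rw [DegTree.degree, add_assoc, CharTwo.add_self_eq_zero, add_zero]
  constructor
  · intro v w hvw
    refine (D.bijective e x).1 (funext fun t => ?_)
    exact congrFun (congrFun (congrFun hvw ⟨_, card_inner_lt n hn t.1.tree⟩) ⟨t.1.tree, rfl⟩)
      ⟨t.1.deg, hsum t⟩
  · intro w
    obtain ⟨v, hv⟩ := (D.bijective e x).2 fun t =>
      w ⟨_, card_inner_lt n hn t.1.tree⟩ ⟨t.1.tree, rfl⟩ ⟨t.1.deg, hsum t⟩
    refine ⟨v, ?_⟩
    funext k T
    obtain ⟨k, hk⟩ := k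
    obtain ⟨T, hT⟩ := T
    change T.inner.card = k at hT
    subst hT
    funext p
    exact congrFun hv ⟨treeOf ⟨T, rfl⟩ p, degree_treeOf ⟨T, rfl⟩ p⟩

end TreeSheafIso

end ShLog
end

/-- Let `X` be a quasi-projective complex scheme with an action of a torus, `F` a sequence of sheaves
`F_m` on `[X^m / S_m]` for `m ≥ 1` (the term `F 0` is not used), and `G_n = shLog F n` the
coefficient of `q^n` in the plethystic logarithm of `1 + ∑ F_m q^m`. Then `G_n` is isomorphic
to `⨁_{k=0}^{n-1} G_{n,k}[k]` as a sheaf on `[X^n / S_n]`. -/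
theorem mainTheorem6 {d : ℕ}
    {X : CategoryTheory.Over (AlgebraicGeometry.Spec (CommRingCat.of ℂ))}
    (hX : ShLog.IsQuasiProjective X) (a : ShLog.TorusAction d X)
    (F : ∀ m : ℕ, ShLog.SuperSheaf a m) (n : ℕ) (hn : 1 ≤ n) :
    Nonempty (CategoryTheory.Iso (ShLog.shLog F n)
      (ShLog.SuperSheaf.directSum fun k : Fin n =>
        (ShLog.treeSheaf F n (k : ℕ)).shift (k : ℕ))) := by
  obtain ⟨D⟩ := ShLog.nonempty_treeDecomp F n hn
  exact ⟨CategoryTheory.GradedObject.isoMk _ _ fun e =>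
    ShLog.EqCoh.isoOfBijective (D.hom e) fun x => D.hom_app_bijective hn e x⟩
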